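/- **Setting.** A stochastic linear bandit with $K\ge 1$ arms in dimension $d\ge 1$ is given by known vectors $a^{(1)},\dots,a^{(K)}\in\mathbb R^d$ with $\|a^{(k)}\|_2\le 1$ and an unknown $\theta^\star\in\mathbb R^d$ with $\|\theta^\star\|_2\le 1$. Pulling arm $a_t$ in round $t$ yields the reward $r_t=\langle\theta^\star,a_t\rangle+\eta_t$, where $\eta_t$ has mean zero, is 1-subgaussian (its law may depend on the round and on the arm), and is independent of everything else. A bandit algorithm chooses $a_t$ as a measurable function of $(a_1,r_1),\dots,(a_{t-1},r_{t-1})$ and of an internal random seed $\xi$. It is *$\rho$-reproducible* over the horizon $T$ if, for all $\theta^\star$ and all noise laws as above, two executions with the same seed and with independent rewards pull the same sequence of $T$ arms with probability at least $1-\rho$. Its expected regret is $\mathbf E[R_T]=T\max_k\langle\theta^\star,a^{(k)}\rangle-\mathbf E\big[\sum_{t=1}^T\langle\theta^\star,a_t\rangle\big]$. **Algorithm** (absolute constants $c>0$, $c_\beta\ge 1$, $0<c_1\le c_2$). Let $B=\lceil\log T\rceil$, $q=(T/c)^{1/B}$, $\beta=\lfloor\max\{c_\beta K^2/\rho^2,\,2304\}\rfloor$,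 $\delta=1/(KT^2)$. Start with all arms active and $r=T$ remaining rounds. For $i=1,\dots,B-1$: 1. Put $\varepsilon_i=\sqrt{d\log(KT^2)/q^i}$ and $\tilde\varepsilon_i=\sqrt{d\log(KT^2)/(\beta q^i)}$. Compute, by a fixed deterministic rule, an approximately G-optimal design multiset of active arms for accuracy $\tilde\varepsilon_i$ and confidence $\delta$; let $n_i$ be its size. If $n_i>r$, leave the loop. 2. Pull the arms of the multiset, let $\hat\theta_i$ be the least-squares estimate (in the span of the pulled arms) from these $n_i$ rewards, and replace $r$ by $r-n_i$. 3. Draw $\bar\varepsilon_i$ uniformly from $[\varepsilon_i/2,\varepsilon_i]$ using the seed, and remove every active arm $a$ with $\langle a,\hat\theta_i\rangle+\tilde\varepsilon_i<\max_b\langle b,\hat\theta_i\rangle-\bar\varepsilon_i$, the maximum being over the active arms $b$. In all remaining rounds pull the active arm of smallest index. Here an *approximately G-optimal design multiset* of a set $A$ of active arms, for accuracy $\varepsilon>0$ and confidence $\delta\in(0,1/2]$, is a finite multiset $b_1,\dots,b_n$ of elements of $A$ with $c_1\,d\log(1/\delta)/\varepsilon^2\le n\le c_2\,d\log(1/\delta)/\varepsilon^2$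 that spans the span of $A$ and satisfies $\|a\|^2_{V^{-1}}\le\varepsilon^2/(2\log(2/\delta))$ for all $a\in A$, where $V=\sum_j b_jb_j^\top$ is inverted on its range. (By the subgaussian tail bound, the least-squares estimate from the multiset then estimates $\langle a,\theta^\star\rangle$ up to $\varepsilon$ with probability at least $1-\delta$, for each $a\in A$.) The rule has to return such a multiset for every nonempty $A$ with $|A|\le d\log(1/\delta)/\varepsilon^2$. **Theorem.** There are absolute constants $C,c,c_1,c_2>0$ and $c_\beta\ge1$, and a deterministic rule for the design multisets, such that for all $d,K\ge1$, $T\in\mathbb N$, $\rho\in(0,1]$ and all arms as above, the algorithm is $\rho$-reproducible over the horizon $T$, and in every such environment $$\mathbf E[R_T]\le C\cdot\frac{K^2}{\rho^2}\sqrt{dT\log(KT)}.$$ Moreover, a single program of a random-access machine over the reals, with input $d,K,T,\rho$ and the arms, implements the algorithm including the design rule. For all rewards and seeds it halts within a number of steps bounded by a fixed polynomial in $d,K,T,1/\rho$. (Unit-cost operations of the machine: addition, subtraction and comparison of natural numbers; exact real arithmetic, square root, $\exp$, $\log$ and comparison; conversion of naturals to reals; memory access; drawing a uniform number from $[0,1]$;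 pulling an arm and receiving its reward.) -/

import Mathlib

noncomputable section

namespace ReproBandit

open MeasureTheory ProbabilityTheory

/-! ## Stochastic linear bandits with finitely many arms -/

/-- `ℝ^d` with the Euclidean norm. -/
abbrev E (d : ℕ) : Type := EuclideanSpace ℝ (Fin d)

/-- The part of a linear bandit instance that is unknown to the player: the parameter `θ` and the
laws of the noise. The reward of arm `k` in round `t` is `⟪θ, arms k⟫ + η (t, k)`, where the
`η (t, k)` are independent, `η (t, k)` has law `noise t k`, has mean zero and is 1-subgaussian. -/
structure Environment (d K : ℕ) where
  θ : E d
  norm_θ_le : ‖θ‖ ≤ 1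
  noise : ℕ → Fin K → Measure ℝ
  isProbabilityMeasure_noise : ∀ t k, IsProbabilityMeasure (noise t k)
  integral_noise : ∀ t k, ∫ x, x ∂(noise t k) = 0
  subgaussian_noise : ∀ t k, HasSubgaussianMGF (fun x : ℝ => x) 1 (noise t k)

attribute [instance] Environment.isProbabilityMeasure_noise

namespace Environment

variable {d K : ℕ}

/-- The joint law of all the noise variables of one execution. -/
def noiseLaw (M : Environment d K) : Measure (ℕ × Fin K → ℝ) :=
  Measure.infinitePi (fun p : ℕ × Fin K => M.noise p.1 p.2)

/-- The reward obtained if arm `k` is pulled in round `t`. -/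
def reward (M : Environment d K) (arms : Fin K → E d) (η : ℕ × Fin K → ℝ) (t : ℕ) (k : Fin K) :
    ℝ :=
  inner ℝ M.θ (arms k) + η (t, k)

end Environment

/-- The internal randomness of an algorithm: a sequence of numbers in `[0, 1]`. -/
abbrev Seed : Type := ℕ → unitInterval

/-- The entries of the internal randomness are independent and uniform on `[0, 1]`. -/
def seedLaw : Measure Seed :=
  Measure.infinitePi (fun _ : ℕ => (volume : Measure unitInterval))

/-- A bandit algorithm chooses the next arm from the arm-reward pairs seen so far (in order) and
its internal randomness. -/
abbrev Policy (K : ℕ) : Type := List (Fin K × ℝ) → Seed → Fin K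

namespace Policy

variable {K : ℕ}

/-- The first `t` arm-reward pairs, if pulling arm `k` in round `s` yields the reward `Y s k`. -/
def history (π : Policy K) (ξ : Seed) (Y : ℕ → Fin K → ℝ) : ℕ → List (Fin K × ℝ)
  | 0 => []
  | t + 1 =>
      π.history ξ Y t ++ [(π (π.history ξ Y t) ξ, Y t (π (π.history ξ Y t) ξ))]

/-- The arm pulled in round `t`; rounds are numbered `0, 1, 2, …`. -/
def arm (π : Policy K) (ξ : Seed) (Y : ℕ → Fin K → ℝ) (t : ℕ) : Fin K :=
  π (π.history ξ Y t) ξ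

/-- In each round the choice is a measurable function of the history and of the randomness. -/
def IsMeasurable (π : Policy K) : Prop :=
  ∀ t : ℕ, Measurable (fun p : (Fin t → Fin K × ℝ) × Seed => π (List.ofFn p.1) p.2)

variable {d : ℕ}

/-- `ρ`-reproducibility over the horizon `T`: in every environment, two executions that share the
internal randomness and have independent rewards pull the same sequence of arms with probability
at least `1 - ρ`. -/
def IsReproducible (π : Policy K) (arms : Fin K → E d) (T : ℕ) (ρ : ℝ) : Prop :=
  ∀ M : Environment d K,
    ENNReal.ofReal (1 - ρ) ≤
      (seedLaw.prod (M.noiseLaw.prod M.noiseLaw))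
        {p | ∀ t < T, π.arm p.1 (M.reward arms p.2.1) t = π.arm p.1 (M.reward arms p.2.2) t}

/-- The expected regret after `T` rounds. -/
def expectedRegret (π : Policy K) (arms : Fin K → E d) (T : ℕ) (M : Environment d K) : ℝ :=
  T * (⨆ k, inner ℝ M.θ (arms k)) -
    ∫ p : Seed × (ℕ × Fin K → ℝ),
      ∑ t ∈ Finset.range T, inner ℝ M.θ (arms (π.arm p.1 (M.reward arms p.2) t))
      ∂(seedLaw.prod M.noiseLaw)

end Policy

/-! ## Least squares and approximately G-optimal design multisets -/

section Design

variable {d K : ℕ}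

/-- `θ` is a least-squares estimate for the data `(a₁, r₁), …, (a_n, r_n)`: it solves the normal
equations `(∑ a_j a_jᵀ) θ = ∑ r_j a_j` and lies in the span of the `a_j`. -/
def IsLSE (data : List (E d × ℝ)) (θ : E d) : Prop :=
  θ ∈ Submodule.span ℝ {a | a ∈ data.map Prod.fst} ∧
    (data.map fun p => inner ℝ p.1 θ • p.1).sum = (data.map fun p => p.2 • p.1).sum

theorem existsUnique_isLSE (data : List (E d × ℝ)) : ∃! θ, IsLSE data θ := by
  classical
  set S : Submodule ℝ (E d) := Submodule.span ℝ {a | a ∈ data.map Prod.fst} with hS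
  have hmem : ∀ p ∈ data, p.1 ∈ S := fun p hp =>
    Submodule.subset_span (List.mem_map_of_mem hp)
  have hsum : ∀ f : E d × ℝ → ℝ, (data.map fun p => f p • p.1).sum ∈ S := fun f =>
    list_sum_mem fun x hx => by
      obtain ⟨p, hp, rfl⟩ := List.mem_map.1 hx
      exact S.smul_mem _ (hmem p hp)
  let V : S →ₗ[ℝ] S :=
    { toFun := fun x => ⟨_, hsum fun p => inner ℝ p.1 (x : E d)⟩
      map_add' := fun x y => by
        ext1
        simp [inner_add_right, add_smul, List.sum_map_add]
      map_smul' := fun c x => by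
        ext1
        simp [inner_smul_right, mul_smul, List.smul_sum, Function.comp_def] }
  have hinj : Function.Injective V := by
    rw [← LinearMap.ker_eq_bot, LinearMap.ker_eq_bot']
    intro x hx
    have h0 : (data.map fun p => inner ℝ p.1 (x : E d) • p.1).sum = 0 := congrArg Subtype.val hx
    have hq : ∀ l : List (E d × ℝ),
        inner ℝ ((l.map fun p => inner ℝ p.1 (x : E d) • p.1).sum) (x : E d) = (l.map fun p => (inner ℝ p.1 (x : E d)) ^ 2).sum := by
      intro l
      induction l with
      | nil => simp
      | cons a l ih => simp [inner_add_left, inner_smul_left, ih, sq]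
    have h1 := hq data
    rw [h0, inner_zero_left] at h1
    have h2 : ∀ p ∈ data, inner ℝ p.1 (x : E d) = 0 := by
      intro p hp
      have := List.single_le_sum (l := data.map fun p => (inner ℝ p.1 (x : E d)) ^ 2)
        (by intro y hy; obtain ⟨q, -, rfl⟩ := List.mem_map.1 hy; positivity) _
        (List.mem_map_of_mem hp)
      rw [← h1] at this
      exact pow_eq_zero_iff (two_ne_zero) |>.1 (le_antisymm this (sq_nonneg _))
    have h3 : ∀ y ∈ S, inner ℝ y (x : E d) = 0 := by
      intro y hy
      induction hy using Submodule.span_induction with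
      | mem y hy => obtain ⟨p, hp, rfl⟩ := List.mem_map.1 hy; exact h2 p hp
      | zero => simp
      | add a b _ _ ha hb => simp [inner_add_left, ha, hb]
      | smul c a _ ha => simp [inner_smul_left, ha]
    exact Subtype.ext (inner_self_eq_zero.1 (h3 _ x.2))
  obtain ⟨x, hx⟩ := (LinearMap.injective_iff_surjective.1 hinj) ⟨_, hsum fun p => p.2⟩
  refine ⟨x, ⟨x.2, congrArg Subtype.val hx⟩, fun y hy => ?_⟩
  have : V ⟨y, hy.1⟩ = V x := by rw [hx]; exact Subtype.ext hy.2
  exact congrArg Subtype.val (hinj this)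

/-- The least-squares estimate. If the `a_j` span `ℝ^d`, it is `(∑ a_j a_jᵀ)⁻¹ (∑ r_j a_j)`. -/
def lse (data : List (E d × ℝ)) : E d :=
  (existsUnique_isLSE data).choose

/-- With `V = ∑ b bᵀ` (the sum over the list `L`): `a` lies in the range of `V`, which is the span
of `L`, and `‖a‖²_{V⁻¹} ≤ s`, where `V⁻¹` is the inverse of `V` on its range. This is the same as
`⟪a, x⟫² ≤ s * xᵀ V x` for all `x`. -/
def InvNormSqLE (L : List (E d)) (a : E d) (s : ℝ) : Prop :=
  ∀ x : E d, (inner ℝ a x) ^ 2 ≤ s * (L.map fun b => (inner ℝ b x) ^ 2).sum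

/-- `L` is a multiset of active arms of size `Θ(d log(1/δ) / ε²)`, with constants `c₁` and `c₂`,
that spans the active arms and whose empirical design is approximately G-optimal, with
`‖a‖²_{V⁻¹} ≤ ε² / (2 log(2/δ))` for every active arm `a`. For 1-subgaussian noise this bound
says that the least-squares estimate from one reward for each member of `L` estimates the mean of
any given active arm up to `ε` with probability at least `1 - δ`. -/
structure IsDesignMultiset (c₁ c₂ : ℝ) (arms : Fin K → E d) (active : Finset (Fin K))
    (ε δ : ℝ) (L : List (Fin K)) : Prop where
  mem_active : ∀ k ∈ L, k ∈ active
  le_length : c₁ * (d * Real.log (1 / δ) / ε ^ 2) ≤ L.length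
  length_le : (L.length : ℝ) ≤ c₂ * (d * Real.log (1 / δ) / ε ^ 2)
  design : ∀ k ∈ active, InvNormSqLE (L.map arms) (arms k) (ε ^ 2 / (2 * Real.log (2 / δ)))

end Design

/-- A deterministic rule that maps the arms, the set of active arms, the accuracy `ε` and the
confidence parameter `δ` to a list of arms. -/
abbrev DesignRule : Type :=
  ∀ d K : ℕ, (Fin K → E d) → Finset (Fin K) → ℝ → ℝ → List (Fin K)

/-- The rule always produces a design multiset, provided that `d log(1/δ) / ε²`, the order of the
number of pulls, is at least the number of active arms. -/
def DesignRule.IsValid (D : DesignRule) (c₁ c₂ : ℝ) : Prop :=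
  ∀ (d K : ℕ) (arms : Fin K → E d) (active : Finset (Fin K)) (ε δ : ℝ),
    1 ≤ d → (∀ k, ‖arms k‖ ≤ 1) → active.Nonempty → 0 < ε → 0 < δ → δ ≤ 1 / 2 →
    (active.card : ℝ) ≤ d * Real.log (1 / δ) / ε ^ 2 →
    IsDesignMultiset c₁ c₂ arms active ε δ (D d K arms active ε δ)

/-! ## The batched elimination algorithm -/

/-- The number `B` of batches, `log T` rounded up. -/
def numBatches (T : ℕ) : ℕ := ⌈Real.log T⌉₊

/-- The growth rate `q = (T / c) ^ (1 / B)` of the batches. -/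
def growth (c : ℝ) (T : ℕ) : ℝ := ((T : ℝ) / c) ^ (1 / (numBatches T : ℝ))

/-- The blow-up factor `β` that makes the algorithm reproducible. -/
def blowup (cβ : ℝ) (K : ℕ) (ρ : ℝ) : ℕ := ⌊max (cβ * ((K : ℝ) ^ 2 / ρ ^ 2)) 2304⌋₊

/-- The scale `ε_i` of the elimination threshold in batch `i`. -/
def eps (c : ℝ) (d K T i : ℕ) : ℝ :=
  Real.sqrt (d * Real.log ((K : ℝ) * (T : ℝ) ^ 2) / growth c T ^ i)

/-- The accuracy of the estimates in batch `i`. -/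
def epsTilde (c cβ : ℝ) (d K T : ℕ) (ρ : ℝ) (i : ℕ) : ℝ :=
  Real.sqrt (d * Real.log ((K : ℝ) * (T : ℝ) ^ 2) / ((blowup cβ K ρ : ℝ) * growth c T ^ i))

/-- The confidence parameter `δ`. -/
def delta (K T : ℕ) : ℝ := 1 / ((K : ℝ) * (T : ℝ) ^ 2)

/-- The active arm with the smallest index. -/
def firstArm {K : ℕ} [NeZero K] (active : Finset (Fin K)) : Fin K :=
  if h : active.Nonempty then active.min' h else 0

open Classical in
/-- The arms that stay active when arm `a` is removed if
`⟪a, θ̂⟫ + ε̃ < max_b ⟪b, θ̂⟫ - ε̄`, the maximum being over the active arms `b`. -/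
def survivors {d K : ℕ} (arms : Fin K → E d) (active : Finset (Fin K)) (θ : E d)
    (εt εb : ℝ) : Finset (Fin K) :=
  active.filter fun a =>
    ¬ ∃ b ∈ active, inner ℝ (arms a) θ + εt < inner ℝ (arms b) θ - εb

/-- The next arm that the algorithm pulls, when it is about to start a batch:
* `b` is the number of batches that may still follow, `i + 1` is the number of the coming batch;
* `active` is the set of arms that are not eliminated, `r` is the number of remaining rounds;
* `rs` is the list of the rewards received since the coming batch started.

The arms of the design multiset `L` are pulled in order; after that the least-squares estimate is
computed, the threshold is drawn uniformly from `[ε_i / 2, ε_i]` and arms are eliminated. If `L`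
does not fit into the remaining rounds or if there is no further batch, the active arm with the
smallest index is pulled in all remaining rounds. -/
def nextArm {d K : ℕ} [NeZero K] (D : DesignRule) (c cβ : ℝ) (T : ℕ) (ρ : ℝ)
    (arms : Fin K → E d) (ξ : Seed) :
    (b i : ℕ) → (active : Finset (Fin K)) → (r : ℕ) → (rs : List ℝ) → Fin K
  | 0, _, active, _, _ => firstArm active
  | b + 1, i, active, r, rs =>
      let εt := epsTilde c cβ d K T ρ (i + 1)
      let ε := eps c d K T (i + 1)
      let L := D d K arms active εt (delta K T)
      if r < L.length then firstArm active
      else if h : rs.length < L.length then L[rs.length]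
      else
        let θ := lse ((L.map arms).zip rs)
        let εb := ε / 2 + (ξ i : ℝ) * (ε / 2)
        nextArm D c cβ T ρ arms ξ b (i + 1) (survivors arms active θ εt εb)
          (r - L.length) (rs.drop L.length)

/-- The batched elimination algorithm with at most `B - 1` estimation batches. -/
def batchedElimination {d K : ℕ} [NeZero K] (D : DesignRule) (c cβ : ℝ) (T : ℕ) (ρ : ℝ)
    (arms : Fin K → E d) : Policy K :=
  fun h ξ =>
    nextArm D c cβ T ρ arms ξ (numBatches T - 1) 0 Finset.univ T (h.map Prod.snd)

/-! ## Programs on a random-access machine over the reals, with a step count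

Natural numbers serve as indices and counters and can only be added, subtracted (truncated) and
compared. Real numbers admit exact arithmetic, `sqrt`, `exp`, `log` and comparison. There is no
rounding from reals to natural numbers. Each operation costs one step. -/

/-- Expressions with values in `ℕ`. -/
inductive NExp : Type
  | const (n : ℕ)
  | var (x : ℕ)
  | get (name : ℕ) (index : NExp)
  | add (e f : NExp)
  | sub (e f : NExp)

/-- Expressions with values in `ℝ`. -/
inductive RExp : Type
  | const (x : ℚ)
  | get (name : ℕ) (row col : NExp)
  | ofNat (e : NExp)
  | add (e f : RExp)
  | sub (e f : RExp)
  | mul (e f : RExp)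
  | div (e f : RExp)
  | sqrt (e : RExp)
  | exp (e : RExp)
  | log (e : RExp)

/-- Tests. -/
inductive BExp : Type
  | nlt (e f : NExp)
  | rlt (e f : RExp)
  | not (b : BExp)
  | and (b b' : BExp)

/-- Programs. `rand` writes the next number of the internal randomness into a real cell; `pull`
pulls the arm whose index is the value of `arm` and writes the reward into a real cell. -/
inductive Prog : Type
  | skip
  | setVar (x : ℕ) (e : NExp)
  | setNat (name : ℕ) (index e : NExp)
  | setReal (name : ℕ) (row col : NExp) (e : RExp)
  | rand (name : ℕ) (row col : NExp)
  | pull (arm : NExp) (name : ℕ) (row col : NExp)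
  | seq (P Q : Prog)
  | ite (b : BExp) (P Q : Prog)
  | while (b : BExp) (P : Prog)

/-- The memory: natural number variables, arrays of natural numbers and two-dimensional arrays of
reals, together with the amount of randomness used and the arms pulled so far. -/
structure State where
  nvar : ℕ → ℕ
  narr : ℕ → ℕ → ℕ
  rarr : ℕ → ℕ → ℕ → ℝ
  used : ℕ
  pulls : List ℕ

namespace NExp

def eval (s : State) : NExp → ℕ
  | const n => n
  | var x => s.nvar x
  | get a i => s.narr a (i.eval s)
  | add e f => e.eval s + f.eval s
  | sub e f => e.eval s - f.eval s

def cost : NExp → ℕ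
  | const _ => 1
  | var _ => 1
  | get _ i => i.cost + 1
  | add e f => e.cost + f.cost + 1
  | sub e f => e.cost + f.cost + 1

end NExp

namespace RExp

def eval (s : State) : RExp → ℝ
  | const x => (x : ℝ)
  | get a i j => s.rarr a (i.eval s) (j.eval s)
  | ofNat e => (e.eval s : ℝ)
  | add e f => e.eval s + f.eval s
  | sub e f => e.eval s - f.eval s
  | mul e f => e.eval s * f.eval s
  | div e f => e.eval s / f.eval s
  | sqrt e => Real.sqrt (e.eval s)
  | exp e => Real.exp (e.eval s)
  | log e => Real.log (e.eval s)

def cost : RExp → ℕ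
  | const _ => 1
  | get _ i j => i.cost + j.cost + 1
  | ofNat e => e.cost + 1
  | add e f => e.cost + f.cost + 1
  | sub e f => e.cost + f.cost + 1
  | mul e f => e.cost + f.cost + 1
  | div e f => e.cost + f.cost + 1
  | sqrt e => e.cost + 1
  | exp e => e.cost + 1
  | log e => e.cost + 1

end RExp

namespace BExp

def eval (s : State) : BExp → Prop
  | nlt e f => e.eval s < f.eval s
  | rlt e f => e.eval s < f.eval s
  | not b => ¬ b.eval s
  | and b b' => b.eval s ∧ b'.eval s

def cost : BExp → ℕ
  | nlt e f => e.cost + f.cost + 1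
  | rlt e f => e.cost + f.cost + 1
  | not b => b.cost + 1
  | and b b' => b.cost + b'.cost + 1

end BExp

namespace State

def setVar (s : State) (x v : ℕ) : State :=
  { s with nvar := Function.update s.nvar x v }

def setNat (s : State) (a i v : ℕ) : State :=
  { s with narr := Function.update s.narr a (Function.update (s.narr a) i v) }

def setReal (s : State) (a i j : ℕ) (v : ℝ) : State :=
  { s with
    rarr := Function.update s.rarr a
      (Function.update (s.rarr a) i (Function.update (s.rarr a i) j v)) }

end State

/-- `Exec ξ Y P s s' n`: with internal randomness `ξ`, and if pulling arm `k` in round `t` yields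
the reward `Y t k`, the program `P` started in `s` halts in `s'` after `n` steps. -/
inductive Exec (ξ : Seed) (Y : ℕ → ℕ → ℝ) : Prog → State → State → ℕ → Prop
  | skip (s : State) : Exec ξ Y .skip s s 1
  | setVar (s : State) (x : ℕ) (e : NExp) :
      Exec ξ Y (.setVar x e) s (s.setVar x (e.eval s)) (e.cost + 1)
  | setNat (s : State) (a : ℕ) (i e : NExp) :
      Exec ξ Y (.setNat a i e) s (s.setNat a (i.eval s) (e.eval s)) (i.cost + e.cost + 1)
  | setReal (s : State) (a : ℕ) (i j : NExp) (e : RExp) :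
      Exec ξ Y (.setReal a i j e) s (s.setReal a (i.eval s) (j.eval s) (e.eval s))
        (i.cost + j.cost + e.cost + 1)
  | rand (s : State) (a : ℕ) (i j : NExp) :
      Exec ξ Y (.rand a i j) s
        { s.setReal a (i.eval s) (j.eval s) (ξ s.used : ℝ) with used := s.used + 1 }
        (i.cost + j.cost + 1)
  | pull (s : State) (k : NExp) (a : ℕ) (i j : NExp) :
      Exec ξ Y (.pull k a i j) s
        { s.setReal a (i.eval s) (j.eval s) (Y s.pulls.length (k.eval s)) with
          pulls := s.pulls ++ [k.eval s] }
        (k.cost + i.cost + j.cost + 1)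
  | seq {P Q : Prog} {s s' s'' : State} {m n : ℕ} :
      Exec ξ Y P s s' m → Exec ξ Y Q s' s'' n → Exec ξ Y (.seq P Q) s s'' (m + n + 1)
  | ite_true {b : BExp} {P Q : Prog} {s s' : State} {n : ℕ} :
      b.eval s → Exec ξ Y P s s' n → Exec ξ Y (.ite b P Q) s s' (b.cost + n + 1)
  | ite_false {b : BExp} {P Q : Prog} {s s' : State} {n : ℕ} :
      ¬ b.eval s → Exec ξ Y Q s s' n → Exec ξ Y (.ite b P Q) s s' (b.cost + n + 1)
  | while_false {b : BExp} {P : Prog} {s : State} :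
      ¬ b.eval s → Exec ξ Y (.while b P) s s (b.cost + 1)
  | while_true {b : BExp} {P : Prog} {s s' s'' : State} {m n : ℕ} :
      b.eval s → Exec ξ Y P s s' m → Exec ξ Y (.while b P) s' s'' n →
        Exec ξ Y (.while b P) s s'' (b.cost + m + n + 1)

theorem Exec.det {ξ : Seed} {Y : ℕ → ℕ → ℝ} {P : Prog} {s s₁ s₂ : State} {n₁ n₂ : ℕ}
    (h₁ : Exec ξ Y P s s₁ n₁) (h₂ : Exec ξ Y P s s₂ n₂) : s₁ = s₂ ∧ n₁ = n₂ := by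
  induction h₁ generalizing s₂ n₂ with
  | seq _ _ ih ih' =>
    cases h₂ with
    | seq a b => obtain ⟨rfl, rfl⟩ := ih a; obtain ⟨rfl, rfl⟩ := ih' b; exact ⟨rfl, rfl⟩
  | ite_true hb _ ih =>
    cases h₂ with
    | ite_true _ a => obtain ⟨rfl, rfl⟩ := ih a; exact ⟨rfl, rfl⟩
    | ite_false h _ => exact absurd hb h
  | ite_false hb _ ih =>
    cases h₂ with
    | ite_false _ a => obtain ⟨rfl, rfl⟩ := ih a; exact ⟨rfl, rfl⟩
    | ite_true h _ => exact absurd h hb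
  | while_false hb =>
    cases h₂ with
    | while_false => exact ⟨rfl, rfl⟩
    | while_true h => exact absurd h hb
  | while_true hb _ _ ih ih' =>
    cases h₂ with
    | while_false h => exact absurd hb h
    | while_true _ a b => obtain ⟨rfl, rfl⟩ := ih a; obtain ⟨rfl, rfl⟩ := ih' b; exact ⟨rfl, rfl⟩
  | _ => cases h₂; exact ⟨rfl, rfl⟩

/-- The initial memory on the input `d`, `K`, `T` (in the variables `0`, `1`, `2`), `ρ` (in the
cell `[0][0]` of the real array `0`) and the arms (the rows of the real array `1`). -/
def initState {d K : ℕ} (T : ℕ) (ρ : ℝ) (arms : Fin K → E d) : State where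
  nvar x := if x = 0 then d else if x = 1 then K else if x = 2 then T else 0
  narr _ _ := 0
  rarr a i j :=
    if a = 0 ∧ i = 0 ∧ j = 0 then ρ
    else if a = 1 then
      if h : i < K ∧ j < d then arms ⟨i, h.1⟩ ⟨j, h.2⟩ else 0
    else 0
  used := 0
  pulls := []

/-- For all rewards and all internal randomness, the program halts within `N` steps and has then
pulled exactly the `T` arms that the policy `π` pulls. -/
def Implements {d K : ℕ} (P : Prog) (T : ℕ) (ρ : ℝ) (arms : Fin K → E d) (π : Policy K) (N : ℝ) :
    Prop :=
  ∀ (ξ : Seed) (Y : ℕ → ℕ → ℝ), ∃ (s : State) (n : ℕ),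
    Exec ξ Y P (initState T ρ arms) s n ∧ (n : ℝ) ≤ N ∧
      s.pulls = (List.range T).map fun t => (π.arm ξ (fun t k => Y t k) t : ℕ)

end ReproBandit

end

/-! Reproducibility comes from the random elimination thresholds. Suppose that in every executed
batch each active arm is estimated up to ε̃. An active arm with gap Δ to the best arm then survives
if Δ + ε̃ ≤ ε̄ and is removed if Δ > ε̄ + 3ε̃. Unless ε̄ falls into the window [Δ - 3ε̃, Δ + ε̃) of
some arm, the survivors depend only on the gaps and the seed (`mem_batchSurvivors_iff`), so two
executions with a common seed stay together (`batchArm_eq_of_not_fails`). The window has length 4ε̃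
and ε̄ is uniform on an interval of length ε/2, so it is hit with probability at most 8ε̃/ε = 8/√β.
Only batches whose ε is comparable to Δ are dangerous for an arm, and by geometric decay there are
at most four of them (`card_near_le`). The total is 32K/√β ≤ ρ/2, without a factor for the number of
batches. Bad estimates have probability at most 1/T in each execution. This is at most ρ/4 as soon
as the first batch fits into T rounds; if it does not fit, the play is deterministic.

The error of a least-squares prediction is a linear form in the noise of the batch, and its
coefficients have squared norm ‖a‖² with respect to V⁻¹ (`inner_lse_sub`, `sum_sq_coeff_le`). The
active set is random, but it depends only on the seed and on earlier rounds, whose noise is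
independent of that of the batch. The tail bounds therefore add up along the recursion over batches
(`noiseLaw_fails_le`).

For the regret, arms active after batch i have gap at most 2ε_i, and batch i + 1 has O(β q^(i+1))
pulls. These contributions grow geometrically, so their sum is of the order of the last one, β√(dT
log(KT)) (`sum_gap_le_of_not_fails`, `regret_sum_le`).

The design rule runs a Frank-Wolfe iteration from uniform weights and moves mass to an arm of
leverage above 4d while there is one. Each such step multiplies a regularised determinant by at
least 3/2, while the determinant can grow only by a factor K^d in total. Hence 2dK steps suffice
(`excess_designWeights`), and rounding the scaled weights up gives the multiset.

The program is verified in a small Hoare logic in which no loop runs more than Z times per entry. As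
its nesting of loops is fixed, the step count is bounded by a polynomial in Z, and Z by one in d, K,
T, 1/ρ. -/

noncomputable section

namespace ReproBandit

open MeasureTheory ProbabilityTheory

/-! ## A generalised inverse by elimination -/

section GeneralizedInverse

open Matrix

variable {d : ℕ}

/-- The direction by which the elimination step for the coordinate `l` enlarges `M`. -/
def ginvDir (V M : Matrix (Fin d) (Fin d) ℝ) (l : Fin d) : Fin d → ℝ :=
  Pi.single l 1 - M *ᵥ V.col l

/-- One elimination step. -/
def ginvStep (V M : Matrix (Fin d) (Fin d) ℝ) (l : Fin d) : Matrix (Fin d) (Fin d) ℝ :=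
  M + (ginvDir V M l ⬝ᵥ V.col l)⁻¹ • vecMulVec (ginvDir V M l) (ginvDir V M l)

/-- The elimination steps for the first `n` coordinates. -/
def ginvIter (V : Matrix (Fin d) (Fin d) ℝ) : ℕ → Matrix (Fin d) (Fin d) ℝ
  | 0 => 0
  | n + 1 => if h : n < d then ginvStep V (ginvIter V n) ⟨n, h⟩ else ginvIter V n

/-- A symmetric reflexive generalised inverse of a positive semidefinite matrix. -/
def ginv (V : Matrix (Fin d) (Fin d) ℝ) : Matrix (Fin d) (Fin d) ℝ :=
  ginvIter V d

theorem dotProduct_mulVec_comm {V : Matrix (Fin d) (Fin d) ℝ} (hV : Vᵀ = V) (x y : Fin d → ℝ) :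
    x ⬝ᵥ V *ᵥ y = (V *ᵥ x) ⬝ᵥ y := by
  rw [dotProduct_mulVec, ← mulVec_transpose, hV]

theorem ginvStep_mulVec (V M : Matrix (Fin d) (Fin d) ℝ) (l : Fin d) (x : Fin d → ℝ) :
    ginvStep V M l *ᵥ x = M *ᵥ x +
      ((ginvDir V M l ⬝ᵥ V.col l)⁻¹ * (ginvDir V M l ⬝ᵥ x)) • ginvDir V M l := by
  rw [ginvStep, add_mulVec, smul_mulVec, vecMulVec_mulVec, mul_smul]
  congr 2
  ext i
  simp [mul_comm]

/-- Gram-Schmidt for the form x ↦ xᵀVx applied to the unit vectors: f is e_l minus its V-orthogonal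
projection to the range of M, so M V f = 0, and M is the sum of the matrices f fᵀ / (fᵀ V f). Any
rank is allowed and no pivot has to be searched, which suits the machine. -/
theorem ginvIter_spec {V : Matrix (Fin d) (Fin d) ℝ} (hV : V.PosSemidef) (n : ℕ) :
    (ginvIter V n)ᵀ = ginvIter V n ∧
      (∀ x, ginvIter V n *ᵥ V *ᵥ ginvIter V n *ᵥ x = ginvIter V n *ᵥ x) ∧
      ∀ j : Fin d, (j : ℕ) < n → V *ᵥ ginvIter V n *ᵥ V.col j = V.col j := by
  have hVt : Vᵀ = V := by simpa using hV.isHermitian.eq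
  induction n with
  | zero => simp [ginvIter]
  | succ n ih =>
    obtain ⟨hs, hM, hj⟩ := ih
    by_cases hn : n < d
    swap
    · simp only [ginvIter, hn, dif_neg, not_false_eq_true]
      exact ⟨hs, hM, fun j _ => hj j (by omega)⟩
    simp only [ginvIter, hn, dif_pos]
    set M := ginvIter V n
    set l : Fin d := ⟨n, hn⟩
    set f := ginvDir V M l with hf
    set u := V.col l with hu
    have hVl : V *ᵥ Pi.single l 1 = u := by simp [hu]
    have hVf : V *ᵥ f = u - V *ᵥ M *ᵥ u := by
      rw [hf, ginvDir, mulVec_sub, hVl]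
    have hMVf : M *ᵥ V *ᵥ f = 0 := by
      rw [hVf, mulVec_sub, hM, sub_self]
    -- The denominator of the update is the squared V-length of f, because M V f = 0.
    have hfu : f ⬝ᵥ V *ᵥ f = f ⬝ᵥ u := by
      have e : f = Pi.single l 1 - M *ᵥ u := rfl
      calc f ⬝ᵥ V *ᵥ f = (Pi.single l 1 - M *ᵥ u) ⬝ᵥ V *ᵥ f := by rw [← e]
        _ = f ⬝ᵥ u := by
          rw [sub_dotProduct, ← dotProduct_mulVec_comm hs, hMVf, dotProduct_zero, sub_zero,
            dotProduct_mulVec_comm hVt, hVl, dotProduct_comm]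
    refine ⟨?_, fun x => ?_, fun j hjn => ?_⟩
    · rw [ginvStep, transpose_add, hs, transpose_smul, transpose_vecMulVec]
    · simp only [ginvStep_mulVec]
      simp only [← hf, ← hu, mulVec_add, mulVec_smul, hM, hMVf, smul_zero, add_zero]
      have h1 : f ⬝ᵥ V *ᵥ M *ᵥ x = 0 := by
        rw [dotProduct_mulVec_comm hVt, dotProduct_mulVec_comm hs, hMVf, zero_dotProduct]
      rw [dotProduct_add, h1, dotProduct_smul, hfu, zero_add, smul_eq_mul]
      congr 2
      by_cases h0 : f ⬝ᵥ u = 0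
      · simp [h0]
      · field_simp
    · simp only [ginvStep_mulVec]
      simp only [← hf, ← hu, mulVec_add, mulVec_smul]
      have key : f ⬝ᵥ V.col j = Pi.single j 1 ⬝ᵥ V *ᵥ f := by
        rw [dotProduct_comm f, dotProduct_mulVec_comm hVt]
        simp
      rcases Nat.lt_succ_iff_lt_or_eq.1 hjn with h | h
      · have h0 : f ⬝ᵥ V.col j = 0 := by
          rw [← hj j h, dotProduct_mulVec_comm hVt, dotProduct_mulVec_comm hs, hMVf,
            zero_dotProduct]
        rw [h0, hj j h]
        simp
      · have : j = l := Fin.ext h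
        subst this
        rw [← hu]
        -- If the pivot vanishes, semidefiniteness gives V f = 0, that is, column l is already
        -- reproduced by the old M.
        by_cases h0 : f ⬝ᵥ u = 0
        · have : V *ᵥ f = 0 := by
            have := hV.dotProduct_mulVec_zero_iff f
            simp only [star_trivial] at this
            exact this.1 (by rw [hfu, h0])
          rw [this, smul_zero, add_zero]
          rw [hVf] at this
          exact (sub_eq_zero.1 this).symm
        · rw [inv_mul_cancel₀ h0, one_smul, hVf]
          abel

theorem ginv_transpose {V : Matrix (Fin d) (Fin d) ℝ} (hV : V.PosSemidef) :
    (ginv V)ᵀ = ginv V :=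
  (ginvIter_spec hV d).1

theorem mulVec_ginv_mulVec {V : Matrix (Fin d) (Fin d) ℝ} (hV : V.PosSemidef)
    (x : Fin d → ℝ) : V *ᵥ ginv V *ᵥ V *ᵥ x = V *ᵥ x := by
  have h : V * ginv V * V = V := by
    refine ext_of_mulVec_single fun j => ?_
    rw [← mulVec_mulVec, ← mulVec_mulVec, mulVec_single_one]
    exact (ginvIter_spec hV d).2.2 j j.2
  rw [mulVec_mulVec, mulVec_mulVec, h]

end GeneralizedInverse

/-! ## Approximately G-optimal weights -/

section Weights

open Matrix

variable {d K : ℕ}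

/-- The information matrix `∑ w_k v_k v_kᵀ`. -/
def infoMatrix (v : Fin K → Fin d → ℝ) (w : Fin K → ℝ) : Matrix (Fin d) (Fin d) ℝ :=
  ∑ k, w k • vecMulVec (v k) (v k)

theorem infoMatrix_apply (v : Fin K → Fin d → ℝ) (w : Fin K → ℝ) (i j : Fin d) :
    infoMatrix v w i j = ∑ k, w k * v k i * v k j := by
  simp [infoMatrix, Matrix.sum_apply, vecMulVec_apply, mul_assoc]

theorem infoMatrix_mulVec (v : Fin K → Fin d → ℝ) (w : Fin K → ℝ) (x : Fin d → ℝ) :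
    infoMatrix v w *ᵥ x = ∑ k, (w k * (v k ⬝ᵥ x)) • v k := by
  rw [infoMatrix, Matrix.sum_mulVec]
  refine Finset.sum_congr rfl fun k _ => ?_
  rw [smul_mulVec, vecMulVec_mulVec, mul_smul]
  congr 1
  ext i
  simp [mul_comm]

theorem dotProduct_infoMatrix_mulVec (v : Fin K → Fin d → ℝ) (w : Fin K → ℝ) (x : Fin d → ℝ) :
    x ⬝ᵥ infoMatrix v w *ᵥ x = ∑ k, w k * (v k ⬝ᵥ x) ^ 2 := by
  rw [infoMatrix_mulVec, dotProduct_sum]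
  refine Finset.sum_congr rfl fun k _ => ?_
  rw [dotProduct_smul, dotProduct_comm x, smul_eq_mul]
  ring

theorem posSemidef_infoMatrix (v : Fin K → Fin d → ℝ) {w : Fin K → ℝ} (hw : ∀ k, 0 ≤ w k) :
    (infoMatrix v w).PosSemidef := by
  refine posSemidef_sum _ fun k _ => PosSemidef.smul ?_ (hw k)
  simpa using posSemidef_vecMulVec_self_star (v k)

/-- The squared norm of `a` with respect to the generalised inverse of the information matrix. -/
def leverage (v : Fin K → Fin d → ℝ) (w : Fin K → ℝ) (a : Fin d → ℝ) : ℝ :=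
  a ⬝ᵥ ginv (infoMatrix v w) *ᵥ a

theorem eq_zero_of_infoMatrix_mulVec_eq_zero (v : Fin K → Fin d → ℝ) {w : Fin K → ℝ}
    (hw : ∀ k, 0 ≤ w k) {x : Fin d → ℝ} (hx : infoMatrix v w *ᵥ x = 0) {k : Fin K}
    (hk : 0 < w k) : v k ⬝ᵥ x = 0 := by
  have h := dotProduct_infoMatrix_mulVec v w x
  rw [hx, dotProduct_zero] at h
  have h2 := (Finset.sum_eq_zero_iff_of_nonneg
    (fun k _ => mul_nonneg (hw k) (sq_nonneg (v k ⬝ᵥ x)))).1 h.symm k (Finset.mem_univ k)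
  have := (mul_eq_zero.1 h2).resolve_left hk.ne'
  exact pow_eq_zero_iff two_ne_zero |>.1 this

/-- A vector orthogonal to the kernel of a symmetric matrix lies in its range. The hypothesis is
tested on u - ginv V (V u), which V annihilates. -/
theorem mulVec_ginv_eq_self {V : Matrix (Fin d) (Fin d) ℝ} (hV : V.PosSemidef) {a : Fin d → ℝ}
    (ha : ∀ x, V *ᵥ x = 0 → a ⬝ᵥ x = 0) : V *ᵥ ginv V *ᵥ a = a := by
  have hVt : Vᵀ = V := by simpa using hV.isHermitian.eq
  have h : ∀ u, (a - V *ᵥ ginv V *ᵥ a) ⬝ᵥ u = 0 := fun u => by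
    have := ha (u - ginv V *ᵥ V *ᵥ u) (by rw [mulVec_sub, mulVec_ginv_mulVec hV, sub_self])
    rw [dotProduct_sub, dotProduct_mulVec_comm (ginv_transpose hV),
      dotProduct_mulVec_comm hVt] at this
    rwa [sub_dotProduct]
  exact (sub_eq_zero.1 (dotProduct_self_eq_zero.1 (h _))).symm

/-! ### Cauchy-Schwarz inequalities for semidefinite forms -/

theorem sq_dotProduct_mulVec_le {V : Matrix (Fin d) (Fin d) ℝ} (hV : V.PosSemidef)
    (x y : Fin d → ℝ) : (x ⬝ᵥ V *ᵥ y) ^ 2 ≤ (x ⬝ᵥ V *ᵥ x) * (y ⬝ᵥ V *ᵥ y) := by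
  have hVt : Vᵀ = V := by simpa using hV.isHermitian.eq
  have h : ∀ t : ℝ, 0 ≤ (y ⬝ᵥ V *ᵥ y) * (t * t) + (2 * (x ⬝ᵥ V *ᵥ y)) * t + (x ⬝ᵥ V *ᵥ x) := by
    intro t
    have := hV.dotProduct_mulVec_nonneg (x + t • y)
    simp only [star_trivial, mulVec_add, mulVec_smul, dotProduct_add, add_dotProduct,
      smul_dotProduct, dotProduct_smul, smul_eq_mul] at this
    have e : y ⬝ᵥ V *ᵥ x = x ⬝ᵥ V *ᵥ y := by
      rw [dotProduct_mulVec_comm hVt, dotProduct_comm]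
    rw [e] at this
    linarith
  have := discrim_le_zero h
  rw [discrim] at this
  nlinarith

/-- Cauchy-Schwarz for V at the vectors ginv V a and x. It turns a bound on a leverage into the
inverse-free inequality of `InvNormSqLE`. -/
theorem sq_dotProduct_le_ginv {V : Matrix (Fin d) (Fin d) ℝ} (hV : V.PosSemidef)
    {a : Fin d → ℝ} (ha : V *ᵥ ginv V *ᵥ a = a) (x : Fin d → ℝ) :
    (a ⬝ᵥ x) ^ 2 ≤ (a ⬝ᵥ ginv V *ᵥ a) * (x ⬝ᵥ V *ᵥ x) := by
  have hVt : Vᵀ = V := by simpa using hV.isHermitian.eq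
  have h := sq_dotProduct_mulVec_le hV (ginv V *ᵥ a) x
  rw [ha, dotProduct_mulVec_comm hVt, ha] at h
  rwa [dotProduct_comm (ginv V *ᵥ a)] at h

theorem sq_dotProduct_le_inv {A : Matrix (Fin d) (Fin d) ℝ} (hA : A.PosDef)
    (a x : Fin d → ℝ) : (a ⬝ᵥ x) ^ 2 ≤ (a ⬝ᵥ A⁻¹ *ᵥ a) * (x ⬝ᵥ A *ᵥ x) := by
  have hAt : Aᵀ = A := by simpa using hA.isHermitian.eq
  have h := sq_dotProduct_mulVec_le hA.posSemidef (A⁻¹ *ᵥ a) x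
  have ha : A *ᵥ A⁻¹ *ᵥ a = a := by
    rw [mulVec_mulVec, mul_nonsing_inv _ ((isUnit_iff_isUnit_det A).1 hA.isUnit), one_mulVec]
  rw [ha, dotProduct_mulVec_comm hAt, ha] at h
  rwa [dotProduct_comm (A⁻¹ *ᵥ a)] at h

/-! ### Determinants under rank-one updates -/

theorem det_add_smul_vecMulVec {A : Matrix (Fin d) (Fin d) ℝ} (hA : IsUnit A.det) (c : ℝ)
    (u : Fin d → ℝ) :
    (A + c • vecMulVec u u).det = A.det * (1 + c * (u ⬝ᵥ A⁻¹ *ᵥ u)) := by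
  have h := det_add_mul (A := A) (replicateCol Unit (c • u)) (replicateRow Unit u) hA
  have e : replicateCol Unit (c • u) * replicateRow Unit u = c • vecMulVec u u := by
    ext i j
    simp [Matrix.mul_apply, vecMulVec_apply, mul_assoc]
  rw [e] at h
  rw [h, det_unique (n := Unit), Matrix.mul_assoc, ← replicateCol_mulVec, Matrix.add_apply,
    Matrix.one_apply_eq, Matrix.replicateRow_mul_replicateCol_apply, mulVec_smul, dotProduct_smul,
    smul_eq_mul]

/-- Each term multiplies the determinant by 1 + c uᵀA⁻¹u ≥ 1. This serves to bound the potential of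
the last Frank-Wolfe iterate by that of the first. -/
theorem det_le_det_add_sum {ι : Type*} (s : Finset ι) {A : Matrix (Fin d) (Fin d) ℝ}
    (hA : A.PosDef) (c : ι → ℝ) (hc : ∀ j ∈ s, 0 ≤ c j) (u : ι → Fin d → ℝ) :
    (A + ∑ j ∈ s, c j • vecMulVec (u j) (u j)).PosDef ∧
      A.det ≤ (A + ∑ j ∈ s, c j • vecMulVec (u j) (u j)).det := by
  classical
  induction s using Finset.induction_on with
  | empty => simpa using hA
  | insert j s hj ih =>
    obtain ⟨hP, hle⟩ := ih fun i hi => hc i (Finset.mem_insert_of_mem hi)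
    have hcj := hc j (Finset.mem_insert_self j s)
    rw [Finset.sum_insert hj, add_comm (c j • _), ← add_assoc]
    constructor
    · refine hP.add_posSemidef (PosSemidef.smul ?_ hcj)
      simpa using posSemidef_vecMulVec_self_star (u j)
    · rw [det_add_smul_vecMulVec ((isUnit_iff_isUnit_det _).1 hP.isUnit)]
      have h1 := hP.inv.posSemidef.dotProduct_mulVec_nonneg (u j)
      rw [star_trivial] at h1
      exact hle.trans (le_mul_of_one_le_right hP.det_pos.le
        (le_add_of_nonneg_right (mul_nonneg hcj h1)))

/-! ### The Frank-Wolfe iteration and its determinant potential -/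

/-- The uniform weights on `s`. -/
def uniformWeights (s : Finset (Fin K)) (k : Fin K) : ℝ :=
  if k ∈ s then 1 / (s.card : ℝ) else 0

/-- The weights of the active arms whose leverage exceeds `4 d`. -/
def excess (v : Fin K → Fin d → ℝ) (s : Finset (Fin K)) (w : Fin K → ℝ) : Finset (Fin K) :=
  s.filter fun k => 4 * (d : ℝ) < leverage v w (v k)

/-- A step of the Frank-Wolfe algorithm towards the first arm of too large leverage. -/
def weightStep (v : Fin K → Fin d → ℝ) (s : Finset (Fin K)) (w : Fin K → ℝ) : Fin K → ℝ :=
  if h : (excess v s w).Nonempty then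
    (1 - 1 / (2 * d : ℝ)) • w + (1 / (2 * d : ℝ)) • Pi.single ((excess v s w).min' h) 1
  else w

/-- The weights after `n` steps. -/
def weightIter (v : Fin K → Fin d → ℝ) (s : Finset (Fin K)) : ℕ → Fin K → ℝ
  | 0 => uniformWeights s
  | n + 1 => weightStep v s (weightIter v s n)

/-- Weights for which no arm of `s` has a leverage above `4 d`. -/
def designWeights (v : Fin K → Fin d → ℝ) (s : Finset (Fin K)) : Fin K → ℝ :=
  weightIter v s (2 * d * K)

theorem weightStep_coeff_nonneg (hd : 1 ≤ d) : 0 < 1 - 1 / (2 * d : ℝ) := by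
  have : (1 : ℝ) ≤ d := by exact_mod_cast hd
  rw [sub_pos, div_lt_one (by positivity)]
  linarith

/-- A step shrinks the old weights by the positive factor 1 - 1/(2d), so all of `s` keeps positive
weight. At every stage the information matrix therefore has the whole span of the arms in `s` as its
range. -/
theorem weightIter_spec (hd : 1 ≤ d) (v : Fin K → Fin d → ℝ) {s : Finset (Fin K)}
    (hs : s.Nonempty) (n : ℕ) :
    (∀ k ∈ s, 0 < weightIter v s n k) ∧ (∀ k ∉ s, weightIter v s n k = 0) ∧
      ∑ k, weightIter v s n k = 1 := by
  have hcard : (0 : ℝ) < s.card := by exact_mod_cast hs.card_pos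
  induction n with
  | zero =>
    refine ⟨fun k hk => ?_, fun k hk => ?_, ?_⟩
    · simp [weightIter, uniformWeights, hk, hcard]
    · simp [weightIter, uniformWeights, hk]
    · simp [weightIter, uniformWeights, hcard.ne']
  | succ n ih =>
    obtain ⟨h1, h2, h3⟩ := ih
    simp only [weightIter, weightStep]
    split_ifs with h
    swap
    · exact ⟨h1, h2, h3⟩
    have hmem : (excess v s (weightIter v s n)).min' h ∈ s :=
      (Finset.mem_filter.1 (Finset.min'_mem _ h)).1
    have hc := weightStep_coeff_nonneg hd
    refine ⟨fun k hk => ?_, fun k hk => ?_, ?_⟩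
    · have := mul_pos hc (h1 k hk)
      have h0 : (0 : ℝ) ≤ (Pi.single ((excess v s (weightIter v s n)).min' h) 1 : Fin K → ℝ) k := by
        rw [Pi.single_apply]; split_ifs <;> simp
      have h4 : 0 ≤ (1 / (2 * d : ℝ)) *
        (Pi.single ((excess v s (weightIter v s n)).min' h) 1 : Fin K → ℝ) k := by positivity
      simpa using add_pos_of_pos_of_nonneg this h4
    · have : k ≠ (excess v s (weightIter v s n)).min' h := fun e => hk (e ▸ hmem)
      simp [h2 k hk, this]
    · simp only [Pi.add_apply, Pi.smul_apply, smul_eq_mul, Finset.sum_add_distrib,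
        ← Finset.mul_sum, h3]
      simp

theorem weightIter_nonneg (hd : 1 ≤ d) (v : Fin K → Fin d → ℝ) {s : Finset (Fin K)}
    (hs : s.Nonempty) (n : ℕ) (k : Fin K) : 0 ≤ weightIter v s n k := by
  obtain ⟨h1, h2, -⟩ := weightIter_spec hd v hs n
  by_cases hk : k ∈ s
  · exact (h1 k hk).le
  · exact (h2 k hk).ge

theorem weightIter_le_one (hd : 1 ≤ d) (v : Fin K → Fin d → ℝ) {s : Finset (Fin K)}
    (hs : s.Nonempty) (n : ℕ) (k : Fin K) : weightIter v s n k ≤ 1 := by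
  rw [← (weightIter_spec hd v hs n).2.2]
  exact Finset.single_le_sum (fun k _ => weightIter_nonneg hd v hs n k) (Finset.mem_univ k)

theorem mulVec_ginv_infoMatrix_weightIter (hd : 1 ≤ d) (v : Fin K → Fin d → ℝ)
    {s : Finset (Fin K)} (hs : s.Nonempty) (n : ℕ) {k : Fin K} (hk : k ∈ s) :
    infoMatrix v (weightIter v s n) *ᵥ ginv (infoMatrix v (weightIter v s n)) *ᵥ v k = v k := by
  have h0 := weightIter_nonneg hd v hs n
  exact mulVec_ginv_eq_self (posSemidef_infoMatrix v h0) fun x hx =>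
    eq_zero_of_infoMatrix_mulVec_eq_zero v h0 hx ((weightIter_spec hd v hs n).1 k hk)

theorem posDef_infoMatrix_add_smul_one (v : Fin K → Fin d → ℝ) {w : Fin K → ℝ}
    (hw : ∀ k, 0 ≤ w k) {c : ℝ} (hc : 0 < c) : (infoMatrix v w + c • 1).PosDef :=
  PosDef.posSemidef_add (posSemidef_infoMatrix v hw) (PosDef.one.smul hc)

/-- For small regularisation, the regularised leverage is large if the leverage is. -/
theorem eventually_le_regularized (hd : 1 ≤ d) (v : Fin K → Fin d → ℝ) {w : Fin K → ℝ}
    (hw : ∀ k, 0 ≤ w k) {a : Fin d → ℝ}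
    (ha : infoMatrix v w *ᵥ ginv (infoMatrix v w) *ᵥ a = a)
    (hg : 4 * (d : ℝ) < leverage v w a) {γ : ℝ} (hγ : 0 < γ) :
    ∀ᶠ c : ℝ in nhdsWithin 0 (Set.Ioi 0),
      4 * (d : ℝ) ≤ a ⬝ᵥ (infoMatrix v w + (c * γ) • (1 : Matrix (Fin d) (Fin d) ℝ))⁻¹ *ᵥ a := by
  set g := leverage v w a with hgdef
  set x := ginv (infoMatrix v w) *ᵥ a with hx
  have hV := posSemidef_infoMatrix v hw
  have hd0 : (1 : ℝ) ≤ d := by exact_mod_cast hd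
  have hgpos : 0 < g := by linarith
  have hcont : Filter.Tendsto (fun c : ℝ => 4 * (d : ℝ) * (g + (c * γ) * (x ⬝ᵥ x)))
      (nhdsWithin 0 (Set.Ioi 0)) (nhds (4 * (d : ℝ) * (g + (0 * γ) * (x ⬝ᵥ x)))) :=
    Filter.Tendsto.mono_left (by
      apply Continuous.tendsto (f := fun c : ℝ => 4 * (d : ℝ) * (g + (c * γ) * (x ⬝ᵥ x)))
      fun_prop) nhdsWithin_le_nhds
  -- At c = 0 this reads 4 d g < g², which is the strict excess g > 4 d; it persists for small c.
  -- The test vector x below is the generalised inverse applied to a, so that Cauchy-Schwarz bounds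
  -- the regularised leverage from below by g² / (g + c γ |x|²).
  have hlt : 4 * (d : ℝ) * (g + (0 * γ) * (x ⬝ᵥ x)) < g ^ 2 := by nlinarith
  filter_upwards [hcont.eventually_lt_const hlt, self_mem_nhdsWithin] with c hc hc0
  have hc0' : 0 < c * γ := mul_pos hc0 hγ
  have h := sq_dotProduct_le_inv (posDef_infoMatrix_add_smul_one v hw hc0') a x
  have e1 : a ⬝ᵥ x = g := rfl
  have e2 : x ⬝ᵥ (infoMatrix v w + (c * γ) • (1 : Matrix (Fin d) (Fin d) ℝ)) *ᵥ x
      = g + (c * γ) * (x ⬝ᵥ x) := by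
    rw [add_mulVec, dotProduct_add, ha, smul_mulVec, one_mulVec, dotProduct_smul,
      dotProduct_comm x a, e1, smul_eq_mul]
  rw [e1, e2] at h
  have hxx : 0 ≤ x ⬝ᵥ x := by simpa using dotProduct_star_self_nonneg x
  have hpos : 0 < g + (c * γ) * (x ⬝ᵥ x) := by positivity
  exact le_of_mul_le_mul_right (hc.le.trans h) hpos

theorem infoMatrix_weightStep (v : Fin K → Fin d → ℝ) (w : Fin K → ℝ) (γ : ℝ) (k : Fin K) :
    infoMatrix v ((1 - γ) • w + γ • Pi.single k 1) =
      (1 - γ) • infoMatrix v w + γ • vecMulVec (v k) (v k) := by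
  simp only [infoMatrix, Pi.add_apply, Pi.smul_apply, add_smul, Finset.sum_add_distrib,
    smul_eq_mul, mul_smul, Finset.smul_sum]
  congr 1
  rw [Finset.sum_eq_single k]
  · simp
  · intro b _ hb; simp [hb]
  · simp

/-- The growth factor of the determinant in one step. With γ = 1/(2d), Bernoulli's inequality gives
(1 - γ)^d ≥ 1/2, and g ≥ 4d gives γ g / (1 - γ) ≥ 2. -/
theorem three_halves_le (hd : 1 ≤ d) {g : ℝ} (hg : 4 * (d : ℝ) ≤ g) :
    3 / 2 ≤ (1 - 1 / (2 * d : ℝ)) ^ d * (1 + 1 / (2 * d : ℝ) / (1 - 1 / (2 * d : ℝ)) * g) := by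
  have hd0 : (1 : ℝ) ≤ d := by exact_mod_cast hd
  have hc := weightStep_coeff_nonneg hd
  have h1 : 1 / 2 ≤ (1 - 1 / (2 * d : ℝ)) ^ d := by
    have := one_add_mul_le_pow (a := -(1 / (2 * d : ℝ))) (by
      rw [neg_le_neg_iff, div_le_iff₀ (by positivity)]; linarith) d
    have e : 1 + (d : ℝ) * -(1 / (2 * d : ℝ)) = 1 / 2 := by field_simp; ring
    rw [e] at this
    simpa [sub_eq_add_neg] using this
  have h2 : 2 ≤ 1 / (2 * d : ℝ) / (1 - 1 / (2 * d : ℝ)) * g := by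
    have h3 : 1 / (2 * d : ℝ) ≤ 1 / (2 * d : ℝ) / (1 - 1 / (2 * d : ℝ)) :=
      le_div_self (by positivity) hc (by simp)
    calc (2 : ℝ) = 1 / (2 * d : ℝ) * (4 * d) := by field_simp; norm_num
      _ ≤ _ := mul_le_mul h3 hg (by positivity) (by positivity)
  calc (3 / 2 : ℝ) = 1 / 2 * (1 + 2) := by norm_num
    _ ≤ _ := mul_le_mul h1 (by linarith) (by norm_num) (by positivity)

/-- Otherwise each of the N = 2dK steps would move mass and multiply the potential by at least 3/2.
But weights never exceed 1, which is m = |s| times the initial weight, so the determinant grows by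
at most m^d. The vectors need not span ℝ^d, hence a small multiple of the identity is added to the
information matrices. -/
theorem excess_designWeights (hd : 1 ≤ d) (v : Fin K → Fin d → ℝ) {s : Finset (Fin K)}
    (hs : s.Nonempty) : excess v s (designWeights v s) = ∅ := by
  by_contra hne
  have hne' : (excess v s (designWeights v s)).Nonempty := Finset.nonempty_iff_ne_empty.2 hne
  set N := 2 * d * K with hN
  set γ : ℝ := 1 / (2 * d : ℝ) with hγ
  have hd0 : (1 : ℝ) ≤ d := by exact_mod_cast hd
  have hγ0 : 0 < 1 - γ := weightStep_coeff_nonneg hd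
  -- An iterate without excess is a fixed point, so excess at the end means excess at every earlier
  -- stage.
  have hall : ∀ n, n ≤ N → (excess v s (weightIter v s n)).Nonempty := by
    intro n hn
    by_contra h
    have hconst : ∀ j, weightIter v s (n + j) = weightIter v s n := by
      intro j
      induction j with
      | zero => rfl
      | succ j ih => rw [← add_assoc, weightIter, ih, weightStep, dif_neg h]
    have := hconst (N - n)
    rw [Nat.add_sub_cancel' hn] at this
    rw [designWeights, this] at hne'
    exact h hne'
  have : Nonempty (Fin K) := ⟨hs.choose⟩
  choose! k hk using fun n (hn : n ≤ N) => (⟨_, Finset.min'_mem _ (hall n hn), fun h => rfl⟩ :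
    ∃ k, k ∈ excess v s (weightIter v s n) ∧
      ∀ h, k = (excess v s (weightIter v s n)).min' h)
  have hstep : ∀ n, n ≤ N → weightIter v s (n + 1) =
      (1 - γ) • weightIter v s n + γ • Pi.single (k n) 1 := fun n hn => by
    rw [weightIter, weightStep, dif_pos (hall n hn), (hk n hn).2 (hall n hn)]
  have hmem : ∀ n, n ≤ N → k n ∈ s := fun n hn => (Finset.mem_filter.1 (hk n hn).1).1
  have hlev : ∀ n, n ≤ N → 4 * (d : ℝ) < leverage v (weightIter v s n) (v (k n)) :=
    fun n hn => (Finset.mem_filter.1 (hk n hn).1).2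
  have hev : ∀ᶠ c : ℝ in nhdsWithin 0 (Set.Ioi 0), ∀ n ∈ Finset.range (N + 1),
      4 * (d : ℝ) ≤ v (k n) ⬝ᵥ (infoMatrix v (weightIter v s n) +
        (c * (1 - γ) ^ n) • (1 : Matrix (Fin d) (Fin d) ℝ))⁻¹ *ᵥ v (k n) := by
    rw [Filter.eventually_all_finset]
    intro n hn
    have hn' : n ≤ N := Nat.lt_succ_iff.1 (Finset.mem_range.1 hn)
    exact eventually_le_regularized hd v (weightIter_nonneg hd v hs n)
      (mulVec_ginv_infoMatrix_weightIter hd v hs n (hmem n hn')) (hlev n hn') (by positivity)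
  obtain ⟨c, hc, hc0⟩ := (hev.and self_mem_nhdsWithin).exists
  have hc0 : 0 < c := hc0
  -- The regulariser shrinks by 1 - γ in each step, as the old weights do. This makes A (n + 1)
  -- exactly 1 - γ times a rank-one update of A n.
  set A : ℕ → Matrix (Fin d) (Fin d) ℝ := fun n =>
    infoMatrix v (weightIter v s n) + (c * (1 - γ) ^ n) • 1 with hA
  have hAp : ∀ n, (A n).PosDef := fun n =>
    posDef_infoMatrix_add_smul_one v (weightIter_nonneg hd v hs n) (by positivity)
  have hgrow : ∀ n, n ≤ N → 3 / 2 * (A n).det ≤ (A (n + 1)).det := by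
    intro n hn
    have e : A (n + 1) = (1 - γ) • (A n + (γ / (1 - γ)) • vecMulVec (v (k n)) (v (k n))) := by
      simp only [hA, hstep n hn, infoMatrix_weightStep, smul_add, smul_smul,
        mul_div_cancel₀ γ hγ0.ne']
      rw [pow_succ, show c * ((1 - γ) ^ n * (1 - γ)) = (1 - γ) * (c * (1 - γ) ^ n) by ring]
      abel
    rw [e, det_smul, Fintype.card_fin,
      det_add_smul_vecMulVec ((isUnit_iff_isUnit_det _).1 (hAp n).isUnit), mul_left_comm,
      mul_comm (3 / 2 : ℝ)]
    exact mul_le_mul_of_nonneg_left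
      (three_halves_le hd (hc n (Finset.mem_range.2 (Nat.lt_succ_iff.2 hn)))) (hAp n).det_pos.le
  have hgrowN : ∀ n, n ≤ N → (3 / 2 : ℝ) ^ n * (A 0).det ≤ (A n).det := by
    intro n
    induction n with
    | zero => intro _; simp
    | succ n ih =>
      intro hn
      have h1 := ih (by omega)
      have h2 := hgrow n (by omega)
      calc (3 / 2 : ℝ) ^ (n + 1) * (A 0).det = 3 / 2 * ((3 / 2) ^ n * (A 0).det) := by ring
        _ ≤ 3 / 2 * (A n).det := by linarith
        _ ≤ _ := h2
  have hm : (1 : ℝ) ≤ s.card := by exact_mod_cast hs.card_pos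
  have hmK : (s.card : ℝ) ≤ K := by
    exact_mod_cast (Finset.card_le_univ s).trans_eq (Fintype.card_fin K)
  -- The matrix m • A 0 equals A N plus nonnegative multiples of the rank-one matrices of the unit
  -- vectors and of the v k.
  have hupper : (A N).det ≤ (s.card : ℝ) ^ d * (A 0).det := by
    have h1 := (det_le_det_add_sum Finset.univ (hAp N)
      (fun _ : Fin d => c * (s.card - (1 - γ) ^ N)) (fun _ _ => by
        refine mul_nonneg hc0.le (sub_nonneg.2 (le_trans ?_ hm))
        exact pow_le_one₀ hγ0.le (by simp [hγ])) (fun i => Pi.single i 1))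
    have h2 := (det_le_det_add_sum Finset.univ h1.1
      (fun k : Fin K => s.card * uniformWeights s k - weightIter v s N k) (fun k _ => by
        rw [sub_nonneg, uniformWeights]
        split_ifs with hks
        · rw [mul_one_div_cancel (by positivity)]
          exact weightIter_le_one hd v hs N k
        · rw [(weightIter_spec hd v hs N).2.1 k hks]; simp) v).2
    refine (h1.2.trans h2).trans_eq ?_
    have e0 := det_smul (A 0) (s.card : ℝ)
    rw [Fintype.card_fin] at e0
    rw [← e0]
    congr 1
    have e1 : ∑ j : Fin d, (c * (s.card - (1 - γ) ^ N)) •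
        vecMulVec (Pi.single j 1 : Fin d → ℝ) (Pi.single j 1) =
        (c * (s.card - (1 - γ) ^ N)) • (1 : Matrix (Fin d) (Fin d) ℝ) := by
      rw [← Finset.smul_sum]
      congr 1
      ext i j
      simp [Matrix.sum_apply, vecMulVec_apply, Pi.single_apply, Matrix.one_apply]
    rw [e1]
    simp only [hA, infoMatrix, sub_smul, Finset.sum_sub_distrib, mul_smul, Finset.smul_sum,
      smul_add, weightIter, pow_zero, one_smul, mul_sub]
    rw [smul_smul (s.card : ℝ) c, smul_smul c (s.card : ℝ), mul_comm c]
    abel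
  have hdet0 := (hAp 0).det_pos
  have hfin : (3 / 2 : ℝ) ^ N ≤ (s.card : ℝ) ^ d :=
    le_of_mul_le_mul_right ((hgrowN N le_rfl).trans hupper) hdet0
  -- This is where 2dK comes from: (3/2)^(2K) = (9/4)^K ≥ 2^K > K.
  have hlt : (s.card : ℝ) ^ d < (3 / 2 : ℝ) ^ N := by
    rw [hN, show 2 * d * K = (2 * K) * d by ring, pow_mul]
    refine pow_lt_pow_left₀ (hmK.trans_lt ?_) (by positivity) (by omega)
    rw [pow_mul]
    calc (K : ℝ) < 2 ^ K := by exact_mod_cast Nat.lt_two_pow_self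
      _ ≤ _ := pow_le_pow_left₀ (by norm_num) (by norm_num) K
  linarith

end Weights

section DesignRuleAndLeastSquares

open Matrix

variable {d K : ℕ}

theorem inner_eq_dotProduct (a x : E d) : inner ℝ a x = a.ofLp ⬝ᵥ x.ofLp := by
  rw [EuclideanSpace.inner_eq_star_dotProduct, star_trivial, dotProduct_comm]

/-! ## The design rule -/

/-- The number of pulls of arm `k` in the design multiset. -/
def designCount (arms : Fin K → E d) (active : Finset (Fin K)) (ε δ : ℝ) (k : Fin K) : ℕ :=
  ⌈designWeights (fun k => (arms k).ofLp) active k * (16 * (d * Real.log (1 / δ) / ε ^ 2))⌉₊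

/-- The design rule: round the design weights, scaled to the desired number of pulls, up. -/
def designRule : DesignRule := fun _ K arms active ε δ =>
  (List.finRange K).flatMap fun k => List.replicate (designCount arms active ε δ k) k

theorem length_designRule (arms : Fin K → E d) (active : Finset (Fin K)) (ε δ : ℝ) :
    (designRule d K arms active ε δ).length = ∑ k, designCount arms active ε δ k := by
  simp [designRule, List.length_flatMap, Fin.sum_univ_def]

theorem sum_map_designRule (arms : Fin K → E d) (active : Finset (Fin K)) (ε δ : ℝ)
    (f : Fin K → ℝ) :
    ((designRule d K arms active ε δ).map f).sum = ∑ k, designCount arms active ε δ k * f k := by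
  simp only [designRule, Fin.sum_univ_def]
  induction List.finRange K with
  | nil => simp
  | cons a l ih => simp [ih]

/-- Let x = d log(1/δ) / ε². Rounding up costs at most one pull per active arm, together at most |A|
≤ x, so the size lies between 16x and 17x. The multiset dominates 16x times the weighted design,
hence its leverages are at most 4d / (16x) = ε² / (4 log(1/δ)). For δ ≤ 1/2 one has log(2/δ) ≤ 2
log(1/δ), which gives the required bound. -/
theorem designRule_isValid : designRule.IsValid 16 17 := by
  intro d K arms active ε δ hd _ hne hε hδ hδ2 hcard
  set v : Fin K → Fin d → ℝ := fun k => (arms k).ofLp with hv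
  set w := designWeights v active with hw
  set x := d * Real.log (1 / δ) / ε ^ 2 with hx
  obtain ⟨hw1, hw2, hw3⟩ := weightIter_spec hd v hne (2 * d * K)
  have hw0 : ∀ k, 0 ≤ w k := weightIter_nonneg hd v hne (2 * d * K)
  have hd0 : (1 : ℝ) ≤ d := by exact_mod_cast hd
  have hlog2 : Real.log 2 ≤ Real.log (1 / δ) := by
    refine Real.log_le_log two_pos ?_
    rw [le_div_iff₀ hδ]
    linarith
  have hlog : 0 < Real.log (1 / δ) := (Real.log_pos one_lt_two).trans_le hlog2
  have hx0 : 0 < x := by positivity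
  have hcount : ∀ k, w k * (16 * x) ≤ designCount arms active ε δ k := fun k => Nat.le_ceil _
  have hsum : ∑ k, w k * (16 * x) = 16 * x := by
    rw [← Finset.sum_mul, show ∑ k, w k = 1 from hw3, one_mul]
  refine ⟨fun k hk => ?_, ?_, ?_, fun k hk y => ?_⟩
  · obtain ⟨j, -, hj⟩ := List.mem_flatMap.1 hk
    obtain ⟨hne0, rfl⟩ := List.mem_replicate.1 hj
    by_contra hk'
    refine hne0 ?_
    have : w k = 0 := hw2 k hk'
    rw [designCount, ← hv, ← hw, this, zero_mul, Nat.ceil_zero]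
  · rw [length_designRule, ← hsum]
    push_cast
    exact Finset.sum_le_sum fun k _ => hcount k
  · rw [length_designRule]
    push_cast
    have h1 : ∑ k, (designCount arms active ε δ k : ℝ) ≤
        ∑ k, (w k * (16 * x) + if k ∈ active then 1 else 0) := by
      refine Finset.sum_le_sum fun k _ => ?_
      split_ifs with hk
      · exact (Nat.ceil_lt_add_one (mul_nonneg (hw0 k) (by positivity))).le
      · have : w k = 0 := hw2 k hk
        rw [designCount, ← hv, ← hw, this, zero_mul, Nat.ceil_zero]
        simp
    rw [Finset.sum_add_distrib, hsum] at h1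
    have h2 : ∑ k : Fin K, (if k ∈ active then (1 : ℝ) else 0) = active.card := by simp
    rw [h2] at h1
    linarith
  · rw [List.map_map, Function.comp_def, sum_map_designRule]
    simp only [inner_eq_dotProduct]
    have hP := posSemidef_infoMatrix v hw0
    have h1 := sq_dotProduct_le_ginv hP
      (mulVec_ginv_infoMatrix_weightIter hd v hne (2 * d * K) hk) y.ofLp
    have h2 : v k ⬝ᵥ ginv (infoMatrix v w) *ᵥ v k ≤ 4 * d := by
      by_contra h
      have : k ∈ excess v active (designWeights v active) :=
        Finset.mem_filter.2 ⟨hk, not_le.1 h⟩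
      rw [excess_designWeights hd v hne] at this
      exact absurd this (Finset.notMem_empty k)
    change _ ≤ (v k ⬝ᵥ ginv (infoMatrix v w) *ᵥ v k) * (y.ofLp ⬝ᵥ infoMatrix v w *ᵥ y.ofLp) at h1
    rw [dotProduct_infoMatrix_mulVec] at h1
    set S := ∑ k, w k * (v k ⬝ᵥ y.ofLp) ^ 2 with hS
    have hS0 : 0 ≤ S := Finset.sum_nonneg fun k _ => mul_nonneg (hw0 k) (sq_nonneg _)
    have h3 : 16 * x * S ≤ ∑ k, (designCount arms active ε δ k : ℝ) * (v k ⬝ᵥ y.ofLp) ^ 2 := by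
      rw [hS, Finset.mul_sum]
      refine Finset.sum_le_sum fun k _ => ?_
      rw [← mul_assoc, mul_comm (16 * x)]
      exact mul_le_mul_of_nonneg_right (hcount k) (sq_nonneg _)
    have h4 : Real.log (2 / δ) ≤ 2 * Real.log (1 / δ) := by
      rw [show 2 / δ = 2 * (1 / δ) by ring, Real.log_mul two_ne_zero (by positivity)]
      linarith
    have hpos : 0 < Real.log (2 / δ) := Real.log_pos (by rw [lt_div_iff₀ hδ]; linarith)
    have h5 : 4 * d ≤ ε ^ 2 / (2 * Real.log (2 / δ)) * (16 * x) := by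
      rw [hx, div_mul_eq_mul_div, le_div_iff₀ (by positivity)]
      have : ε ^ 2 * (16 * (d * Real.log (1 / δ) / ε ^ 2)) = 16 * (d * Real.log (1 / δ)) := by
        field_simp
      rw [this]
      nlinarith
    calc (v k ⬝ᵥ y.ofLp) ^ 2 ≤ (v k ⬝ᵥ ginv (infoMatrix v w) *ᵥ v k) * S := h1
      _ ≤ 4 * d * S := mul_le_mul_of_nonneg_right h2 hS0
      _ ≤ ε ^ 2 / (2 * Real.log (2 / δ)) * (16 * x) * S := mul_le_mul_of_nonneg_right h5 hS0
      _ = ε ^ 2 / (2 * Real.log (2 / δ)) * (16 * x * S) := by ring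
      _ ≤ _ := mul_le_mul_of_nonneg_left h3 (by positivity)

/-! ## Least squares -/

theorem isLSE_lse (data : List (E d × ℝ)) : IsLSE data (lse data) :=
  (existsUnique_isLSE data).choose_spec.1

theorem lse_eq {data : List (E d × ℝ)} {θ : E d} (h : IsLSE data θ) : lse data = θ :=
  (existsUnique_isLSE data).unique (isLSE_lse data) h

/-- The data of a regression with design points `b` and responses `y`. -/
def regressionData {n : ℕ} (b : Fin n → E d) (y : Fin n → ℝ) : List (E d × ℝ) :=
  List.ofFn fun s => (b s, y s)

theorem isLSE_regressionData_iff {n : ℕ} (b : Fin n → E d) (y : Fin n → ℝ) (θ : E d) :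
    IsLSE (regressionData b y) θ ↔ θ ∈ Submodule.span ℝ (Set.range b) ∧
      ∑ s, inner ℝ (b s) θ • b s = ∑ s, y s • b s := by
  unfold IsLSE regressionData
  rw [List.map_ofFn, List.map_ofFn, List.map_ofFn, List.sum_ofFn, List.sum_ofFn]
  have : {a | a ∈ List.ofFn (Prod.fst ∘ fun s => (b s, y s))} = Set.range b := by
    ext a
    simp [List.mem_ofFn]
  rw [this]
  rfl

/-- Least squares is linear in the responses. -/
def lseLinear {n : ℕ} (b : Fin n → E d) : (Fin n → ℝ) →ₗ[ℝ] E d where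
  toFun y := lse (regressionData b y)
  map_add' y z := by
    have hy := (isLSE_regressionData_iff b y _).1 (isLSE_lse _)
    have hz := (isLSE_regressionData_iff b z _).1 (isLSE_lse _)
    refine lse_eq ((isLSE_regressionData_iff b _ _).2 ⟨Submodule.add_mem _ hy.1 hz.1, ?_⟩)
    simp only [inner_add_right, add_smul, Finset.sum_add_distrib, hy.2, hz.2, Pi.add_apply]
  map_smul' c y := by
    have hy := (isLSE_regressionData_iff b y _).1 (isLSE_lse _)
    refine lse_eq ((isLSE_regressionData_iff b _ _).2 ⟨Submodule.smul_mem _ c hy.1, ?_⟩)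
    simp only [inner_smul_right, mul_smul, ← Finset.smul_sum, hy.2, Pi.smul_apply, smul_eq_mul,
      RingHom.id_apply]

theorem measurable_lse {Ω : Type*} [MeasurableSpace Ω] {n : ℕ} (b : Fin n → E d)
    {y : Fin n → Ω → ℝ} (hy : ∀ s, Measurable (y s)) :
    Measurable fun ω => lse (regressionData b fun s => y s ω) :=
  ((lseLinear b).continuous_of_finiteDimensional.measurable).comp (measurable_pi_lambda _ hy)

/-- The information matrix of a list of design points. -/
def gramMatrix {n : ℕ} (b : Fin n → E d) : Matrix (Fin d) (Fin d) ℝ :=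
  infoMatrix (fun s => (b s).ofLp) 1

theorem posSemidef_gramMatrix {n : ℕ} (b : Fin n → E d) : (gramMatrix b).PosSemidef :=
  posSemidef_infoMatrix _ fun _ => zero_le_one

theorem gramMatrix_mulVec {n : ℕ} (b : Fin n → E d) (x : E d) :
    gramMatrix b *ᵥ x.ofLp = (∑ s, inner ℝ (b s) x • b s).ofLp := by
  rw [gramMatrix, infoMatrix_mulVec, WithLp.ofLp_sum]
  simp [inner_eq_dotProduct]

/-- `InvNormSqLE` forces a to be orthogonal to the kernel of the Gram matrix, and so to lie in its
range. -/
theorem mulVec_ginv_gramMatrix {n : ℕ} {b : Fin n → E d} {a : E d} {c : ℝ}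
    (h : InvNormSqLE (List.ofFn b) a c) :
    gramMatrix b *ᵥ ginv (gramMatrix b) *ᵥ a.ofLp = a.ofLp := by
  refine mulVec_ginv_eq_self (posSemidef_gramMatrix b) fun x hx => ?_
  have h1 := h (WithLp.toLp 2 x)
  rw [List.map_ofFn, List.sum_ofFn] at h1
  have h2 : ∀ s, inner ℝ (b s) (WithLp.toLp 2 x) = 0 := fun s => by
    rw [inner_eq_dotProduct]
    exact eq_zero_of_infoMatrix_mulVec_eq_zero (fun s => (b s).ofLp) (fun _ => zero_le_one) hx
      (k := s) zero_lt_one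
  simp only [Function.comp_def, h2] at h1
  rw [inner_eq_dotProduct] at h1
  have h3 : (a.ofLp ⬝ᵥ x) ^ 2 ≤ 0 := by simpa using h1
  exact pow_eq_zero_iff two_ne_zero |>.1 (le_antisymm h3 (sq_nonneg _))

/-- The prediction at a is read off from the normal equations without the estimate itself. The
program evaluates this formula. -/
theorem inner_lse {n : ℕ} {b : Fin n → E d} {a : E d} {c : ℝ}
    (h : InvNormSqLE (List.ofFn b) a c) (y : Fin n → ℝ) :
    inner ℝ a (lse (regressionData b y)) =
      (ginv (gramMatrix b) *ᵥ a.ofLp) ⬝ᵥ (∑ s, y s • b s).ofLp := by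
  have hV := posSemidef_gramMatrix b
  have hVt : (gramMatrix b)ᵀ = gramMatrix b := by simpa using hV.isHermitian.eq
  have h1 := ((isLSE_regressionData_iff b y _).1 (isLSE_lse _)).2
  rw [← h1, ← gramMatrix_mulVec, dotProduct_mulVec_comm hVt, mulVec_ginv_gramMatrix h,
    inner_eq_dotProduct]

theorem inner_lse_eq_sum {n : ℕ} {b : Fin n → E d} {a : E d} {c : ℝ}
    (h : InvNormSqLE (List.ofFn b) a c) (y : Fin n → ℝ) :
    inner ℝ a (lse (regressionData b y)) =
      ∑ s, (b s).ofLp ⬝ᵥ ginv (gramMatrix b) *ᵥ a.ofLp * y s := by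
  rw [inner_lse h, WithLp.ofLp_sum, dotProduct_sum]
  refine Finset.sum_congr rfl fun s _ => ?_
  rw [WithLp.ofLp_smul, dotProduct_smul, smul_eq_mul, dotProduct_comm, mul_comm]

/-- Noiseless responses are predicted exactly, since a = V (ginv V a); what is left is a linear form
in the noise. -/
theorem inner_lse_sub {n : ℕ} {b : Fin n → E d} {a : E d} {c : ℝ}
    (h : InvNormSqLE (List.ofFn b) a c) (θ : E d) (η : Fin n → ℝ) :
    inner ℝ a (lse (regressionData b fun s => inner ℝ θ (b s) + η s)) - inner ℝ θ a =
      ∑ s, (b s).ofLp ⬝ᵥ ginv (gramMatrix b) *ᵥ a.ofLp * η s := by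
  have hV := posSemidef_gramMatrix b
  have hVt : (gramMatrix b)ᵀ = gramMatrix b := by simpa using hV.isHermitian.eq
  have h0 : inner ℝ θ a = ∑ s, (b s).ofLp ⬝ᵥ ginv (gramMatrix b) *ᵥ a.ofLp * inner ℝ θ (b s) := by
    rw [real_inner_comm, inner_eq_dotProduct, ← mulVec_ginv_gramMatrix h,
      ← dotProduct_mulVec_comm hVt, gramMatrix_mulVec, WithLp.ofLp_sum, dotProduct_sum]
    refine Finset.sum_congr rfl fun s _ => ?_
    rw [WithLp.ofLp_smul, dotProduct_smul, smul_eq_mul, dotProduct_comm, mul_comm,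
      real_inner_comm, mulVec_ginv_gramMatrix h]
  rw [inner_lse_eq_sum h, h0, ← Finset.sum_sub_distrib]
  exact Finset.sum_congr rfl fun s _ => by ring

/-- With g = ginv V a, the sum S of squares equals a · g, and the hypothesis tested at g reads S² ≤
c S. -/
theorem sum_sq_coeff_le {n : ℕ} {b : Fin n → E d} {a : E d} {c : ℝ} (hc : 0 ≤ c)
    (h : InvNormSqLE (List.ofFn b) a c) :
    ∑ s, ((b s).ofLp ⬝ᵥ ginv (gramMatrix b) *ᵥ a.ofLp) ^ 2 ≤ c := by
  have h1 := h (WithLp.toLp 2 (ginv (gramMatrix b) *ᵥ a.ofLp))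
  rw [List.map_ofFn, List.sum_ofFn] at h1
  simp only [Function.comp_def, inner_eq_dotProduct] at h1
  set g := ginv (gramMatrix b) *ᵥ a.ofLp with hg
  have e := dotProduct_infoMatrix_mulVec (fun s => (b s).ofLp) 1 g
  have e2 : infoMatrix (fun s => (b s).ofLp) 1 *ᵥ g = a.ofLp := mulVec_ginv_gramMatrix h
  rw [e2, dotProduct_comm] at e
  simp only [Pi.one_apply, one_mul] at e
  rw [e] at h1
  set S := ∑ s, ((b s).ofLp ⬝ᵥ g) ^ 2
  by_contra hlt
  rw [not_le] at hlt
  nlinarith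

end DesignRuleAndLeastSquares

/-! ## The algorithm as a sequence of batches -/

section Batches

variable {d K : ℕ} (D : DesignRule) (c cβ : ℝ) (T : ℕ) (ρ : ℝ) (arms : Fin K → E d)

/-- The arms pulled in batch `i + 1` if the arms in `A` are active. -/
def batchList (i : ℕ) (A : Finset (Fin K)) : List (Fin K) :=
  D d K arms A (epsTilde c cβ d K T ρ (i + 1)) (delta K T)

/-- The least-squares estimate of batch `i + 1` if the batch starts in round `t`. -/
def batchEstimate (Y : ℕ → Fin K → ℝ) (i : ℕ) (A : Finset (Fin K)) (t : ℕ) : E d :=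
  lse (regressionData
    (fun s : Fin (batchList D c cβ T ρ arms i A).length =>
      arms (batchList D c cβ T ρ arms i A)[s])
    fun s => Y (t + s) (batchList D c cβ T ρ arms i A)[s])

/-- The random elimination threshold of batch `i + 1`. -/
def threshold (d K : ℕ) (ξ : Seed) (i : ℕ) : ℝ :=
  eps c d K T (i + 1) / 2 + (ξ i : ℝ) * (eps c d K T (i + 1) / 2)

/-- The arms that survive batch `i + 1`. -/
def batchSurvivors (ξ : Seed) (Y : ℕ → Fin K → ℝ) (i : ℕ) (A : Finset (Fin K)) (t : ℕ) :
    Finset (Fin K) :=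
  survivors arms A (batchEstimate D c cβ T ρ arms Y i A t) (epsTilde c cβ d K T ρ (i + 1))
    (threshold c T d K ξ i)

/-- The arm pulled in round `s`, if batch `i + 1` starts in round `t` with the active arms `A`
and at most `b` batches follow. -/
def batchArm [NeZero K] (ξ : Seed) (Y : ℕ → Fin K → ℝ) :
    (b i : ℕ) → Finset (Fin K) → (t s : ℕ) → Fin K
  | 0, _, A, _, _ => firstArm A
  | b + 1, i, A, t, s =>
      if T - t < (batchList D c cβ T ρ arms i A).length then firstArm A
      else if h : s - t < (batchList D c cβ T ρ arms i A).length then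
        (batchList D c cβ T ρ arms i A)[s - t]
      else batchArm ξ Y b (i + 1) (batchSurvivors D c cβ T ρ arms ξ Y i A t)
        (t + (batchList D c cβ T ρ arms i A).length) s

/-- `nextArm` consumes a list of past rewards, `batchArm` reads a reward table at absolute times.
They agree on the list of rewards that `batchArm` itself collects. This removes histories from all
later arguments. -/
theorem nextArm_eq_batchArm [NeZero K] (ξ : Seed) (Y : ℕ → Fin K → ℝ) (b i : ℕ) (A : Finset (Fin K))
    (t n : ℕ) :
    nextArm D c cβ T ρ arms ξ b i A (T - t) ((List.range n).map fun j =>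
      Y (t + j) (batchArm D c cβ T ρ arms ξ Y b i A t (t + j))) =
      batchArm D c cβ T ρ arms ξ Y b i A t (t + n) := by
  induction b generalizing i A t n with
  | zero => simp [nextArm, batchArm]
  | succ b ih =>
    have hL : D d K arms A (epsTilde c cβ d K T ρ (i + 1)) (delta K T) =
      batchList D c cβ T ρ arms i A := rfl
    simp only [nextArm, hL]
    conv_rhs => rw [batchArm]
    split_ifs with h1 h2 h3 h4
    · rfl
    · simp
    · simp at h2 h3; omega
    · simp at h2 h4; omega
    · rw [List.length_map, List.length_range, not_lt] at h2
      have hzip : ((batchList D c cβ T ρ arms i A).map arms).zip ((List.range n).map fun j =>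
          Y (t + j) (batchArm D c cβ T ρ arms ξ Y (b + 1) i A t (t + j))) =
          regressionData
            (fun s : Fin (batchList D c cβ T ρ arms i A).length =>
              arms (batchList D c cβ T ρ arms i A)[s])
            fun s => Y (t + s) (batchList D c cβ T ρ arms i A)[s] := by
        refine List.ext_getElem ?_ fun j hj hj' => ?_
        · simp [regressionData, h2]
        · have hj2 : j < (batchList D c cβ T ρ arms i A).length := by
            simpa [regressionData] using hj'
          simp [regressionData, batchArm, h1, hj2]
      have hdrop : ((List.range n).map fun j =>
          Y (t + j) (batchArm D c cβ T ρ arms ξ Y (b + 1) i A t (t + j))).drop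
            (batchList D c cβ T ρ arms i A).length =
          (List.range (n - (batchList D c cβ T ρ arms i A).length)).map fun j =>
            Y (t + (batchList D c cβ T ρ arms i A).length + j)
              (batchArm D c cβ T ρ arms ξ Y b (i + 1)
                (batchSurvivors D c cβ T ρ arms ξ Y i A t)
                (t + (batchList D c cβ T ρ arms i A).length)
                (t + (batchList D c cβ T ρ arms i A).length + j)) := by
        refine List.ext_getElem (by simp) fun j hj hj' => ?_
        rw [List.getElem_drop, List.getElem_map, List.getElem_map, List.getElem_range,
          List.getElem_range, ← add_assoc]
        conv_lhs => rw [batchArm]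
        rw [if_neg h1, dif_neg (by omega)]
      rw [hzip, hdrop]
      have := ih (i + 1) (batchSurvivors D c cβ T ρ arms ξ Y i A t)
        (t + (batchList D c cβ T ρ arms i A).length)
        (n - (batchList D c cβ T ρ arms i A).length)
      rw [← Nat.sub_sub, show t + (batchList D c cβ T ρ arms i A).length +
        (n - (batchList D c cβ T ρ arms i A).length) = t + n by omega] at this
      exact this

theorem map_snd_history [NeZero K] (ξ : Seed) (Y : ℕ → Fin K → ℝ) (n : ℕ) :
    ((batchedElimination D c cβ T ρ arms).history ξ Y n).map Prod.snd =
      (List.range n).map fun j =>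
        Y j (batchArm D c cβ T ρ arms ξ Y (numBatches T - 1) 0 Finset.univ 0 j) := by
  induction n with
  | zero => simp [Policy.history]
  | succ n ih =>
    have h := nextArm_eq_batchArm D c cβ T ρ arms ξ Y (numBatches T - 1) 0 Finset.univ 0 n
    simp only [zero_add, tsub_zero] at h
    rw [Policy.history, List.map_append, ih, List.range_succ, List.map_append]
    have hπ : batchedElimination D c cβ T ρ arms
        ((batchedElimination D c cβ T ρ arms).history ξ Y n) ξ =
        batchArm D c cβ T ρ arms ξ Y (numBatches T - 1) 0 Finset.univ 0 n := by
      rw [← h, ← ih]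
      rfl
    rw [List.map_singleton, List.map_singleton, hπ]

theorem arm_batchedElimination [NeZero K] (ξ : Seed) (Y : ℕ → Fin K → ℝ) (n : ℕ) :
    (batchedElimination D c cβ T ρ arms).arm ξ Y n =
      batchArm D c cβ T ρ arms ξ Y (numBatches T - 1) 0 Finset.univ 0 n := by
  have h := nextArm_eq_batchArm D c cβ T ρ arms ξ Y (numBatches T - 1) 0 Finset.univ 0 n
  simp only [zero_add, tsub_zero] at h
  rw [Policy.arm, ← h]
  conv_lhs => rw [batchedElimination]
  rw [map_snd_history]

/-! ### Measurability -/

theorem measurableSet_survivors_eq {Ω : Type*} {_ : MeasurableSpace Ω} (A A' : Finset (Fin K))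
    {θ : Ω → E d} (hθ : Measurable θ) (εt : ℝ) {εb : Ω → ℝ} (hεb : Measurable εb) :
    MeasurableSet {ω | survivors arms A (θ ω) εt (εb ω) = A'} := by
  classical
  have hmem : ∀ a, MeasurableSet {ω | a ∈ survivors arms A (θ ω) εt (εb ω)} := by
    intro a
    simp only [survivors, Finset.mem_filter, Set.ofPred_and]
    refine (MeasurableSet.const _).inter (MeasurableSet.compl ?_)
    have : {ω | ∃ b ∈ A, inner ℝ (arms a) (θ ω) + εt < inner ℝ (arms b) (θ ω) - εb ω} =
        ⋃ b ∈ A, {ω | inner ℝ (arms a) (θ ω) + εt < inner ℝ (arms b) (θ ω) - εb ω} := by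
      ext; simp
    change MeasurableSet {ω | ∃ b ∈ A, inner ℝ (arms a) (θ ω) + εt < inner ℝ (arms b) (θ ω) - εb ω}
    rw [this]
    refine Finset.measurableSet_biUnion _ fun b _ => measurableSet_lt ?_ ?_ <;> fun_prop
  have : {ω | survivors arms A (θ ω) εt (εb ω) = A'} =
      ⋂ a, {ω | a ∈ survivors arms A (θ ω) εt (εb ω) ↔ a ∈ A'} := by
    ext; simp [Finset.ext_iff]
  rw [this]
  refine MeasurableSet.iInter fun a => ?_
  by_cases ha : a ∈ A'
  · simp only [ha, iff_true]
    exact hmem a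
  · simp only [ha, iff_false]
    exact (hmem a).compl

theorem measurable_batchEstimate {Ω : Type*} {mΩ : MeasurableSpace Ω} {Y : Ω → ℕ → Fin K → ℝ} {t : ℕ}
    (i : ℕ) (A : Finset (Fin K))
    (hY : ∀ s < t + (batchList D c cβ T ρ arms i A).length, t ≤ s →
      ∀ k, Measurable fun ω => Y ω s k) :
    Measurable fun ω => batchEstimate D c cβ T ρ arms (Y ω) i A t :=
  measurable_lse _ (y := fun s ω => Y ω (t + s) (batchList D c cβ T ρ arms i A)[s])
    fun s => hY _ (Nat.add_lt_add_left s.2 t) (Nat.le_add_right t s) _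

theorem measurableSet_batchSurvivors_eq {Ω : Type*} {mΩ : MeasurableSpace Ω} {ξ : Ω → Seed}
    {Y : Ω → ℕ → Fin K → ℝ} {i t : ℕ} (hξ : Measurable fun ω => ξ ω i) (A A' : Finset (Fin K))
    (hY : ∀ s < t + (batchList D c cβ T ρ arms i A).length, t ≤ s →
      ∀ k, Measurable fun ω => Y ω s k) :
    MeasurableSet {ω | batchSurvivors D c cβ T ρ arms (ξ ω) (Y ω) i A t = A'} := by
  refine measurableSet_survivors_eq arms A A' (measurable_batchEstimate D c cβ T ρ arms i A hY) _ ?_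
  unfold threshold
  fun_prop

/-- Used with S the random set of survivors: after splitting into its finitely many values, the rest
of the execution starts from a deterministic set. -/
theorem measurable_of_finite_cases {Ω ι β : Type*} [MeasurableSpace Ω] [MeasurableSpace β]
    [Finite ι] {S : Ω → ι} (hS : ∀ a, MeasurableSet {ω | S ω = a}) {F : ι → Ω → β}
    (hF : ∀ a, Measurable (F a)) : Measurable fun ω => F (S ω) ω := by
  intro U hU
  have : (fun ω => F (S ω) ω) ⁻¹' U = ⋃ a, {ω | S ω = a} ∩ F a ⁻¹' U := by
    ext; simp
  rw [this]
  exact MeasurableSet.iUnion fun a => (hS a).inter (hF a hU)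

theorem measurable_batchArm [NeZero K] {Ω : Type*} [MeasurableSpace Ω] {ξ : Ω → Seed}
    {Y : Ω → ℕ → Fin K → ℝ} (hξ : ∀ i, Measurable fun ω => ξ ω i)
    (hY : ∀ s k, Measurable fun ω => Y ω s k) (b i : ℕ) (A : Finset (Fin K)) (t s : ℕ) :
    Measurable fun ω => batchArm D c cβ T ρ arms (ξ ω) (Y ω) b i A t s := by
  induction b generalizing i A t with
  | zero => simp only [batchArm]; exact measurable_const
  | succ b ih =>
    simp only [batchArm]
    split_ifs
    · exact measurable_const
    · exact measurable_const
    · exact measurable_of_finite_cases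
        (measurableSet_batchSurvivors_eq D c cβ T ρ arms (hξ i) A · fun s _ _ => hY s)
        fun A' => ih (i + 1) A' _

theorem isMeasurable_batchedElimination [NeZero K] :
    (batchedElimination D c cβ T ρ arms).IsMeasurable := by
  intro t
  -- The policy ignores the arms in the history, so the recorded rewards may serve as a table that
  -- does not depend on the arm; from round t on it has the default value 0.
  have h : (fun p : (Fin t → Fin K × ℝ) × Seed =>
      batchedElimination D c cβ T ρ arms (List.ofFn p.1) p.2) =
      fun p => batchArm D c cβ T ρ arms p.2
        (fun s _ => if h : s < t then (p.1 ⟨s, h⟩).2 else 0) (numBatches T - 1) 0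
        Finset.univ 0 t := by
    funext p
    have h := nextArm_eq_batchArm D c cβ T ρ arms p.2
      (fun s _ => if h : s < t then (p.1 ⟨s, h⟩).2 else 0) (numBatches T - 1) 0 Finset.univ 0 t
    simp only [zero_add, tsub_zero] at h
    rw [← h, batchedElimination]
    congr 1
    refine List.ext_getElem (by simp) fun j hj hj' => ?_
    have : j < t := by simpa using hj
    simp [this]
  rw [h]
  refine measurable_batchArm D c cβ T ρ arms (fun i => by fun_prop) (fun s _ => ?_) _ _ _ _ _
  split_ifs <;> fun_prop

end Batches

/-! ## Failure of the estimates -/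

section Concentration

open scoped NNReal

theorem HasSubgaussianMGF.mono {Ω : Type*} {_ : MeasurableSpace Ω} {μ : Measure Ω} {X : Ω → ℝ}
    {c c' : ℝ≥0} (h : HasSubgaussianMGF X c μ) (hc : c ≤ c') : HasSubgaussianMGF X c' μ where
  integrable_exp_mul := h.integrable_exp_mul
  mgf_le t := (h.mgf_le t).trans (Real.exp_le_exp.2 (by
    have : (c : ℝ) ≤ c' := hc
    gcongr))

variable {d K : ℕ}

theorem hasSubgaussianMGF_sum_noise (M : Environment d K) {n : ℕ} {p : Fin n → ℕ × Fin K}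
    (hp : Function.Injective p) (a : Fin n → ℝ) {s : ℝ≥0} (hs : ∑ j, a j ^ 2 ≤ s) :
    HasSubgaussianMGF (fun η : ℕ × Fin K → ℝ => ∑ j, a j * η (p j)) s M.noiseLaw := by
  have hind : iIndepFun (fun (j : Fin n) (η : ℕ × Fin K → ℝ) => a j * η (p j)) M.noiseLaw := by
    have h1 : iIndepFun (fun (i : ℕ × Fin K) (η : ℕ × Fin K → ℝ) => η i) M.noiseLaw :=
      iIndepFun_infinitePi (X := fun _ x => x) fun _ => measurable_id
    exact (h1.precomp hp).comp (fun j x => a j * x) fun j => measurable_const_mul (a j)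
  have hsub : ∀ j ∈ (Finset.univ : Finset (Fin n)),
      HasSubgaussianMGF (fun η : ℕ × Fin K → ℝ => a j * η (p j)) (⟨a j ^ 2, sq_nonneg _⟩ * 1)
        M.noiseLaw := by
    intro j _
    refine HasSubgaussianMGF.const_mul ?_ (a j)
    have h2 : (M.noiseLaw.map fun η => η (p j)) = M.noise (p j).1 (p j).2 :=
      Measure.infinitePi_map_eval (fun q : ℕ × Fin K => M.noise q.1 q.2) (p j)
    have h3 := M.subgaussian_noise (p j).1 (p j).2
    rw [← h2] at h3
    exact HasSubgaussianMGF.of_map (Y := fun η : ℕ × Fin K → ℝ => η (p j))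
      (measurable_pi_apply (p j)).aemeasurable h3
  refine HasSubgaussianMGF.mono (HasSubgaussianMGF.sum_of_iIndepFun hind hsub) ?_
  rw [← NNReal.coe_le_coe]
  refine le_trans (le_of_eq ?_) hs
  rw [NNReal.coe_sum]
  exact Finset.sum_congr rfl fun j _ => mul_one (a j ^ 2)

instance (M : Environment d K) : IsProbabilityMeasure M.noiseLaw := by
  unfold Environment.noiseLaw
  infer_instance

instance : IsProbabilityMeasure seedLaw := by
  unfold seedLaw
  infer_instance

/-- Chernoff bound for both tails. With variance proxy ε² / (2 log(2/δ)) each tail has probability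
at most exp(-log(2/δ)) = δ/2. -/
theorem noiseLaw_abs_sum_gt_le (M : Environment d K) {n : ℕ} {p : Fin n → ℕ × Fin K}
    (hp : Function.Injective p) (a : Fin n → ℝ) {ε δ : ℝ} (hε : 0 < ε) (hδ : 0 < δ) (hδ1 : δ < 2)
    (hs : ∑ j, a j ^ 2 ≤ ε ^ 2 / (2 * Real.log (2 / δ))) :
    M.noiseLaw.real {η | ε < |∑ j, a j * η (p j)|} ≤ δ := by
  have hlog : 0 < Real.log (2 / δ) := Real.log_pos (by rwa [lt_div_iff₀ hδ, one_mul])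
  have h0 : 0 ≤ ε ^ 2 / (2 * Real.log (2 / δ)) := by positivity
  have h1 := hasSubgaussianMGF_sum_noise M hp a (s := ⟨_, h0⟩) hs
  have hexp : Real.exp (-ε ^ 2 / (2 * (ε ^ 2 / (2 * Real.log (2 / δ))))) = δ / 2 := by
    have : -ε ^ 2 / (2 * (ε ^ 2 / (2 * Real.log (2 / δ)))) = -Real.log (2 / δ) := by
      field_simp
    rw [this, Real.exp_neg, Real.exp_log (by positivity), inv_div]
  have h2 := (h1.measure_ge_le hε.le).trans_eq hexp
  have h3 := (h1.neg.measure_ge_le hε.le).trans_eq hexp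
  have hsub : {η : ℕ × Fin K → ℝ | ε < |∑ j, a j * η (p j)|} ⊆
      {η | ε ≤ ∑ j, a j * η (p j)} ∪ {η | ε ≤ (-fun η => ∑ j, a j * η (p j)) η} := by
    intro η (hη : ε < |∑ j, a j * η (p j)|)
    rcases lt_abs.1 hη with h | h
    · exact Or.inl h.le
    · exact Or.inr h.le
  calc _ ≤ _ := measureReal_mono hsub
    _ ≤ _ := measureReal_union_le _ _
    _ ≤ δ := by linarith

/-- Conditioning on a finitely valued past: F a is independent of the event S = a. The bound is
required only for values that S attains, because the failure bounds hold only for nonempty active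
sets. -/
theorem measureReal_mixture_le {Ω ι : Type*} [Fintype ι] {m₁ m₂ m₀ : MeasurableSpace Ω}
    {μ : Measure Ω} [IsProbabilityMeasure μ] (hm₁ : m₁ ≤ m₀) (hind : Indep m₁ m₂ μ) {S : Ω → ι}
    (hS : ∀ a, MeasurableSet[m₁] {ω | S ω = a}) {F : ι → Set Ω}
    (hF : ∀ a, MeasurableSet[m₂] (F a)) {p : ℝ} (hp : ∀ ω, μ.real (F (S ω)) ≤ p) :
    μ.real {ω | ω ∈ F (S ω)} ≤ p := by
  have hset : {ω | ω ∈ F (S ω)} = ⋃ a ∈ (Finset.univ : Finset ι), {ω | S ω = a} ∩ F a := by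
    ext; simp
  have hone : ∑ a, μ.real {ω | S ω = a} = 1 := by
    have h := measureReal_biUnion_finset (μ := μ) (s := (Finset.univ : Finset ι))
      (f := fun a => {ω | S ω = a})
      (fun a _ b _ hab => Set.disjoint_left.2 fun ω ha hb => hab (ha.symm.trans hb))
      fun a _ => hm₁ _ (hS a)
    rw [← h]
    have : ⋃ a ∈ (Finset.univ : Finset ι), {ω | S ω = a} = Set.univ := by ext; simp
    rw [this, probReal_univ]
  rw [hset]
  calc _ ≤ ∑ a, μ.real ({ω | S ω = a} ∩ F a) := measureReal_biUnion_finset_le _ _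
    _ ≤ ∑ a, μ.real {ω | S ω = a} * p := by
      refine Finset.sum_le_sum fun a _ => ?_
      have h := (Indep_iff m₁ m₂ μ).1 hind _ _ (hS a) (hF a)
      rw [measureReal_def, h, ENNReal.toReal_mul, ← measureReal_def, ← measureReal_def]
      rcases Set.eq_empty_or_nonempty {ω | S ω = a} with he | ⟨ω, hω⟩
      · simp [he]
      · refine mul_le_mul_of_nonneg_left ?_ measureReal_nonneg
        have := hp ω
        rwa [show S ω = a from hω] at this
    _ = p := by rw [← Finset.sum_mul, hone, one_mul]

/-! ### Noise of disjoint sets of rounds -/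

/-- The σ-algebra generated by the noise of the rounds in `S`. -/
@[reducible] def noiseSigma (K : ℕ) (S : Set ℕ) : MeasurableSpace (ℕ × Fin K → ℝ) :=
  ⨆ p ∈ {p : ℕ × Fin K | p.1 ∈ S}, MeasurableSpace.comap (fun η => η p) inferInstance

theorem noiseSigma_le (S : Set ℕ) : noiseSigma K S ≤ MeasurableSpace.pi :=
  iSup₂_le fun p _ => (measurable_pi_apply p).comap_le

theorem measurable_noiseSigma {S : Set ℕ} {t : ℕ} (ht : t ∈ S) (k : Fin K) :
    Measurable[noiseSigma K S] fun η : ℕ × Fin K → ℝ => η (t, k) :=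
  measurable_iff_comap_le.2 (le_iSup₂_of_le (t, k) ht le_rfl)

theorem indep_noiseSigma (M : Environment d K) {S S' : Set ℕ} (h : Disjoint S S') :
    Indep (noiseSigma K S) (noiseSigma K S') M.noiseLaw := by
  have h1 : iIndepFun (fun (i : ℕ × Fin K) (η : ℕ × Fin K → ℝ) => η i) M.noiseLaw :=
    iIndepFun_infinitePi (X := fun _ x => x) fun _ => measurable_id
  refine indep_iSup_of_disjoint (fun p => (measurable_pi_apply p).comap_le) h1.iIndep ?_
  exact Set.disjoint_left.2 fun p hp hp' => Set.disjoint_left.1 h hp hp'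

theorem measurable_reward {S : Set ℕ} (M : Environment d K) (arms : Fin K → E d) {t : ℕ}
    (ht : t ∈ S) (k : Fin K) : Measurable[noiseSigma K S] fun η => M.reward arms η t k := by
  have := measurable_noiseSigma ht k
  unfold Environment.reward
  exact Measurable.const_add this _

/-! ### Failure events of the batches -/

variable (D : DesignRule) (c cβ : ℝ) (T : ℕ) (ρ : ℝ) (arms : Fin K → E d)

/-- In batch `i + 1`, some active arm is estimated with an error above the accuracy. -/
def BadEstimate (θ : E d) (Y : ℕ → Fin K → ℝ) (i : ℕ) (A : Finset (Fin K)) (t : ℕ) : Prop :=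
  ∃ a ∈ A, epsTilde c cβ d K T ρ (i + 1) <
    |inner ℝ (arms a) (batchEstimate D c cβ T ρ arms Y i A t) - inner ℝ θ (arms a)|

/-- Some batch has a bad estimate. -/
def Fails (θ : E d) (ξ : Seed) (Y : ℕ → Fin K → ℝ) : (b i : ℕ) → Finset (Fin K) → ℕ → Prop
  | 0, _, _, _ => False
  | b + 1, i, A, t =>
      ¬ T - t < (batchList D c cβ T ρ arms i A).length ∧
        (BadEstimate D c cβ T ρ arms θ Y i A t ∨
          Fails θ ξ Y b (i + 1) (batchSurvivors D c cβ T ρ arms ξ Y i A t)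
            (t + (batchList D c cβ T ρ arms i A).length))

theorem measurableSet_badEstimate {Ω : Type*} {mΩ : MeasurableSpace Ω} (θ : E d)
    {Y : Ω → ℕ → Fin K → ℝ} {i t : ℕ} (A : Finset (Fin K))
    (hY : ∀ s, t ≤ s → ∀ k, Measurable fun ω => Y ω s k) :
    MeasurableSet {ω | BadEstimate D c cβ T ρ arms θ (Y ω) i A t} := by
  have hm := measurable_batchEstimate D c cβ T ρ arms (Y := Y) (t := t) i A fun s _ => hY s
  have : {ω | BadEstimate D c cβ T ρ arms θ (Y ω) i A t} =
      ⋃ a ∈ A, {ω | epsTilde c cβ d K T ρ (i + 1) <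
        |inner ℝ (arms a) (batchEstimate D c cβ T ρ arms (Y ω) i A t) - inner ℝ θ (arms a)|} := by
    ext; simp [BadEstimate]
  rw [this]
  refine Finset.measurableSet_biUnion _ fun a _ => measurableSet_lt measurable_const ?_
  have h2 : Measurable fun ω => inner ℝ (arms a) (batchEstimate D c cβ T ρ arms (Y ω) i A t) -
    inner ℝ θ (arms a) := by fun_prop
  exact continuous_abs.measurable.comp h2

theorem measurableSet_fails {Ω : Type*} {mΩ : MeasurableSpace Ω} (θ : E d) {ξ : Ω → Seed}
    {Y : Ω → ℕ → Fin K → ℝ} (hξ : ∀ i, Measurable fun ω => ξ ω i) (b i : ℕ) (A : Finset (Fin K))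
    (t : ℕ) (hY : ∀ s, t ≤ s → ∀ k, Measurable fun ω => Y ω s k) :
    MeasurableSet {ω | Fails D c cβ T ρ arms θ (ξ ω) (Y ω) b i A t} := by
  induction b generalizing i A t with
  | zero => simp [Fails]
  | succ b ih =>
    simp only [Fails]
    by_cases hlen : T - t < (batchList D c cβ T ρ arms i A).length
    · simp [hlen]
    · simp only [hlen, not_false_eq_true, true_and]
      refine (measurableSet_badEstimate D c cβ T ρ arms θ A hY).union ?_
      have h := measurable_of_finite_cases (β := Prop)
        (measurableSet_batchSurvivors_eq D c cβ T ρ arms (hξ i) A · fun s _ => hY s)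
        (F := fun A' ω => Fails D c cβ T ρ arms θ (ξ ω) (Y ω) b (i + 1) A'
            (t + (batchList D c cβ T ρ arms i A).length))
        fun A' => measurableSet_setOfPred.1 (ih (i + 1) A' _ fun s hs => hY s (by omega))
      exact measurableSet_setOfPred.2 h

/-- All the design multisets used in the first `n` batches are valid. -/
def ValidBatches (c₁ c₂ : ℝ) (n : ℕ) : Prop :=
  ∀ i < n, ∀ A : Finset (Fin K), A.Nonempty →
    0 < epsTilde c cβ d K T ρ (i + 1) ∧
    IsDesignMultiset c₁ c₂ arms A (epsTilde c cβ d K T ρ (i + 1)) (delta K T)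
      (batchList D c cβ T ρ arms i A)

variable {D c cβ T ρ arms}

theorem ofFn_batchList (i : ℕ) (A : Finset (Fin K)) :
    List.ofFn (fun s : Fin (batchList D c cβ T ρ arms i A).length =>
      arms (batchList D c cβ T ρ arms i A)[s]) = (batchList D c cβ T ρ arms i A).map arms := by
  refine List.ext_getElem (by simp) fun j _ _ => by simp

theorem noiseLaw_badEstimate_le {c₁ c₂ : ℝ} {n : ℕ}
    (hD : ValidBatches D c cβ T ρ arms c₁ c₂ n) (hδ : 0 < delta K T) (hδ1 : delta K T < 2)
    (M : Environment d K) {i : ℕ} (hi : i < n) {A : Finset (Fin K)} (hA : A.Nonempty) (t : ℕ) :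
    M.noiseLaw.real {η | BadEstimate D c cβ T ρ arms M.θ (M.reward arms η) i A t} ≤
      K * delta K T := by
  obtain ⟨hε, hV⟩ := hD i hi A hA
  have hset : {η | BadEstimate D c cβ T ρ arms M.θ (M.reward arms η) i A t} =
      ⋃ a ∈ A, {η | epsTilde c cβ d K T ρ (i + 1) <
        |inner ℝ (arms a) (batchEstimate D c cβ T ρ arms (M.reward arms η) i A t) -
          inner ℝ M.θ (arms a)|} := by
    ext; simp [BadEstimate]
  rw [hset]
  calc _ ≤ ∑ a ∈ A, _ := measureReal_biUnion_finset_le _ _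
    _ ≤ ∑ a ∈ A, delta K T := by
      refine Finset.sum_le_sum fun a ha => ?_
      have hinv := hV.design a ha
      rw [← ofFn_batchList] at hinv
      have hlog : 0 < Real.log (2 / delta K T) :=
        Real.log_pos (by rwa [lt_div_iff₀ hδ, one_mul])
      have h := noiseLaw_abs_sum_gt_le M
        (p := fun s : Fin (batchList D c cβ T ρ arms i A).length =>
          (t + (s : ℕ), (batchList D c cβ T ρ arms i A)[s]))
        -- Pulls in different rounds use different noise variables, even when they pull the same
        -- arm.
        (fun s s' h => Fin.ext (by simpa using congrArg Prod.fst h)) _ hε hδ hδ1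
        (sum_sq_coeff_le (by positivity) hinv)
      refine le_trans (le_of_eq ?_) h
      congr 1
      ext η
      simp only [Set.mem_ofPred_eq]
      rw [← inner_lse_sub hinv]
      rfl
    _ ≤ K * delta K T := by
      rw [Finset.sum_const, nsmul_eq_mul]
      refine mul_le_mul_of_nonneg_right ?_ hδ.le
      exact_mod_cast (Finset.card_le_univ A).trans_eq (Fintype.card_fin K)

theorem eps_nonneg (c : ℝ) (d K T i : ℕ) : 0 ≤ eps c d K T i := Real.sqrt_nonneg _

theorem epsTilde_nonneg (c cβ : ℝ) (d K T : ℕ) (ρ : ℝ) (i : ℕ) : 0 ≤ epsTilde c cβ d K T ρ i :=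
  Real.sqrt_nonneg _

theorem le_threshold (c : ℝ) (T d K : ℕ) (ξ : Seed) (i : ℕ) :
    eps c d K T (i + 1) / 2 ≤ threshold c T d K ξ i :=
  le_add_of_nonneg_right (mul_nonneg (ξ i).2.1 (by linarith [eps_nonneg c d K T (i + 1)]))

theorem threshold_le (c : ℝ) (T d K : ℕ) (ξ : Seed) (i : ℕ) :
    threshold c T d K ξ i ≤ eps c d K T (i + 1) := by
  have h := eps_nonneg c d K T (i + 1)
  have h1 := mul_le_mul_of_nonneg_right (ξ i).2.2 (by linarith : 0 ≤ eps c d K T (i + 1) / 2)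
  unfold threshold
  linarith

/-- The arm with the largest estimate is never removed, however bad the estimates are. Hence designs
are only ever requested for nonempty sets. -/
theorem survivors_nonempty {A : Finset (Fin K)} (hA : A.Nonempty) (θ : E d) {εt εb : ℝ}
    (h : 0 ≤ εt + εb) : (survivors arms A θ εt εb).Nonempty := by
  classical
  obtain ⟨a, ha, hmax⟩ := A.exists_max_image (fun a => inner ℝ (arms a) θ) hA
  refine ⟨a, Finset.mem_filter.2 ⟨ha, ?_⟩⟩
  rintro ⟨b, hb, hlt⟩
  have := hmax b hb
  linarith

theorem batchSurvivors_nonempty (ξ : Seed) (Y : ℕ → Fin K → ℝ) (i : ℕ) {A : Finset (Fin K)}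
    (hA : A.Nonempty) (t : ℕ) : (batchSurvivors D c cβ T ρ arms ξ Y i A t).Nonempty :=
  survivors_nonempty hA _ (by
    have := le_threshold c T d K ξ i
    have := eps_nonneg c d K T (i + 1)
    have := epsTilde_nonneg c cβ d K T ρ (i + 1)
    linarith)

/-- The end t' of the batch depends only on i, A and t, not on the rewards. The survivors are a
function of the noise before t', and failure of the later batches, for each given active set, is a
function of the noise from t' on. So the two parts are independent and the failure probabilities add
up, by at most K δ per batch. The seed is fixed throughout. -/
theorem noiseLaw_fails_le {c₁ c₂ : ℝ} {n : ℕ}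
    (hD : ValidBatches D c cβ T ρ arms c₁ c₂ n) (hδ : 0 < delta K T) (hδ1 : delta K T < 2)
    (M : Environment d K) (ξ : Seed) {b i : ℕ} (hi : i + b ≤ n) {A : Finset (Fin K)}
    (hA : A.Nonempty) (t : ℕ) :
    M.noiseLaw.real {η | Fails D c cβ T ρ arms M.θ ξ (M.reward arms η) b i A t} ≤
      b * (K * delta K T) := by
  induction b generalizing i A t with
  | zero => simp [Fails]
  | succ b ih =>
    simp only [Fails]
    by_cases hlen : T - t < (batchList D c cβ T ρ arms i A).length
    · simp only [hlen, not_true_eq_false, false_and, Set.ofPred_false, measureReal_empty]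
      positivity
    simp only [hlen, not_false_eq_true, true_and]
    set t' := t + (batchList D c cβ T ρ arms i A).length with ht'
    have h1 := noiseLaw_badEstimate_le hD hδ hδ1 M (by omega : i < n) hA t
    have hdisj : Disjoint {s : ℕ | s < t'} {s : ℕ | t' ≤ s} :=
      Set.disjoint_left.2 fun s (h : s < t') (h' : t' ≤ s) => not_le.2 h h'
    have h2 := measureReal_mixture_le (noiseSigma_le (K := K) _) (indep_noiseSigma M hdisj)
      (S := fun η => batchSurvivors D c cβ T ρ arms ξ (M.reward arms η) i A t)
      (F := fun A' => {η | Fails D c cβ T ρ arms M.θ ξ (M.reward arms η) b (i + 1) A' t'})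
      (p := b * (K * delta K T))
      (fun A' => measurableSet_batchSurvivors_eq (mΩ := noiseSigma K {s : ℕ | s < t'})
        D c cβ T ρ arms (ξ := fun _ => ξ) (Y := fun η => M.reward arms η)
        (@measurable_const _ _ _ (noiseSigma K {s : ℕ | s < t'}) _) A A'
        fun s hs _ k => measurable_reward (S := {s : ℕ | s < t'}) M arms hs k)
      (fun A' => measurableSet_fails (mΩ := noiseSigma K {s : ℕ | t' ≤ s})
        D c cβ T ρ arms M.θ (ξ := fun _ => ξ) (Y := fun η => M.reward arms η)
        (fun _ => @measurable_const _ _ _ (noiseSigma K {s : ℕ | t' ≤ s}) _) b (i + 1) A' t'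
        fun s hs k => measurable_reward (S := {s : ℕ | t' ≤ s}) M arms hs k)
      (fun η => ih (by omega) (batchSurvivors_nonempty ξ _ i hA t) t')
    calc _ ≤ _ := measureReal_union_le _ _
      _ ≤ K * delta K T + b * (K * delta K T) := add_le_add h1 h2
      _ = _ := by push_cast; ring

end Concentration

/-! ## Executions without bad estimates -/

section GoodExecutions

variable {d K : ℕ}

/-- The gap between the mean rewards of the arms `k₀` and `a`. -/
def gap (θ : E d) (arms : Fin K → E d) (k₀ a : Fin K) : ℝ :=
  inner ℝ θ (arms k₀) - inner ℝ θ (arms a)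

theorem gap_nonneg {θ : E d} {arms : Fin K → E d} {k₀ : Fin K}
    (hk₀ : ∀ a, inner ℝ θ (arms a) ≤ inner ℝ θ (arms k₀)) (a : Fin K) : 0 ≤ gap θ arms k₀ a :=
  sub_nonneg.2 (hk₀ a)

theorem gap_le_two {θ : E d} (hθ : ‖θ‖ ≤ 1) {arms : Fin K → E d} (harms : ∀ k, ‖arms k‖ ≤ 1)
    (k₀ a : Fin K) : gap θ arms k₀ a ≤ 2 := by
  have h : ∀ k, |inner ℝ θ (arms k)| ≤ 1 := fun k =>
    (abs_real_inner_le_norm _ _).trans (mul_le_one₀ hθ (norm_nonneg _) (harms k))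
  have h1 := abs_le.1 (h k₀)
  have h2 := abs_le.1 (h a)
  unfold gap
  linarith

theorem firstArm_mem [NeZero K] {A : Finset (Fin K)} (hA : A.Nonempty) : firstArm A ∈ A := by
  rw [firstArm, dif_pos hA]
  exact A.min'_mem hA

variable {D : DesignRule} {c cβ : ℝ} {T : ℕ} {ρ : ℝ} {arms : Fin K → E d} {θ : E d} {k₀ : Fin K}

theorem abs_le_of_not_badEstimate {Y : ℕ → Fin K → ℝ} {i t : ℕ} {A : Finset (Fin K)}
    (h : ¬ BadEstimate D c cβ T ρ arms θ Y i A t) {a : Fin K} (ha : a ∈ A) :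
    |inner ℝ (arms a) (batchEstimate D c cβ T ρ arms Y i A t) - inner ℝ θ (arms a)| ≤
      epsTilde c cβ d K T ρ (i + 1) := by
  by_contra h'
  exact h ⟨a, ha, not_le.1 h'⟩

/-- The ε̃ in the elimination test absorbs the error of the arm itself, so only the error of its
competitor costs an ε̃. -/
theorem mem_batchSurvivors_of_le (hk₀ : ∀ a, inner ℝ θ (arms a) ≤ inner ℝ θ (arms k₀))
    {ξ : Seed} {Y : ℕ → Fin K → ℝ} {i t : ℕ} {A : Finset (Fin K)}
    (h : ¬ BadEstimate D c cβ T ρ arms θ Y i A t) {a : Fin K} (ha : a ∈ A)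
    (hle : gap θ arms k₀ a + epsTilde c cβ d K T ρ (i + 1) ≤ threshold c T d K ξ i) :
    a ∈ batchSurvivors D c cβ T ρ arms ξ Y i A t := by
  classical
  refine Finset.mem_filter.2 ⟨ha, ?_⟩
  rintro ⟨b, hb, hlt⟩
  have h1 := abs_le.1 (abs_le_of_not_badEstimate h ha)
  have h2 := abs_le.1 (abs_le_of_not_badEstimate h hb)
  have h3 := hk₀ b
  unfold gap at hle
  linarith

/-- The best arm acts as the competitor: two estimation errors and the ε̃ of the test add up to 3
ε̃. -/
theorem gap_le_of_mem_batchSurvivors {ξ : Seed} {Y : ℕ → Fin K → ℝ} {i t : ℕ}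
    {A : Finset (Fin K)} (h : ¬ BadEstimate D c cβ T ρ arms θ Y i A t) (hA : k₀ ∈ A) {a : Fin K}
    (ha : a ∈ batchSurvivors D c cβ T ρ arms ξ Y i A t) :
    gap θ arms k₀ a ≤ threshold c T d K ξ i + 3 * epsTilde c cβ d K T ρ (i + 1) := by
  classical
  obtain ⟨haA, hno⟩ := Finset.mem_filter.1 ha
  have h1 := abs_le.1 (abs_le_of_not_badEstimate h haA)
  have h2 := abs_le.1 (abs_le_of_not_badEstimate h hA)
  have h3 : ¬ inner ℝ (arms a) (batchEstimate D c cβ T ρ arms Y i A t) +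
      epsTilde c cβ d K T ρ (i + 1) <
      inner ℝ (arms k₀) (batchEstimate D c cβ T ρ arms Y i A t) - threshold c T d K ξ i :=
    fun h => hno ⟨k₀, hA, h⟩
  unfold gap
  linarith

theorem best_mem_batchSurvivors (hk₀ : ∀ a, inner ℝ θ (arms a) ≤ inner ℝ θ (arms k₀))
    {ξ : Seed} {Y : ℕ → Fin K → ℝ} {i t : ℕ} {A : Finset (Fin K)}
    (h : ¬ BadEstimate D c cβ T ρ arms θ Y i A t) (hA : k₀ ∈ A)
    (hε : 4 * epsTilde c cβ d K T ρ (i + 1) ≤ eps c d K T (i + 1)) :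
    k₀ ∈ batchSurvivors D c cβ T ρ arms ξ Y i A t := by
  refine mem_batchSurvivors_of_le hk₀ h hA ?_
  have h1 := le_threshold c T d K ξ i
  have h2 := epsTilde_nonneg c cβ d K T ρ (i + 1)
  unfold gap
  linarith

/-- The threshold of batch `i + 1` is close to the gap of the arm `a`. -/
def NearThreshold (c cβ : ℝ) (T : ℕ) (ρ : ℝ) (arms : Fin K → E d) (θ : E d) (k₀ : Fin K)
    (ξ : Seed) (i : ℕ) (a : Fin K) : Prop :=
  gap θ arms k₀ a - 3 * epsTilde c cβ d K T ρ (i + 1) ≤ threshold c T d K ξ i ∧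
    threshold c T d K ξ i < gap θ arms k₀ a + epsTilde c cβ d K T ρ (i + 1)

/-- The criterion on the right involves the active set, the gap and the seed but no rewards, so any
two executions without bad estimates apply the same one. -/
theorem mem_batchSurvivors_iff (hk₀ : ∀ a, inner ℝ θ (arms a) ≤ inner ℝ θ (arms k₀))
    {ξ : Seed} {Y : ℕ → Fin K → ℝ} {i t : ℕ} {A : Finset (Fin K)}
    (h : ¬ BadEstimate D c cβ T ρ arms θ Y i A t) (hA : k₀ ∈ A) {a : Fin K}
    (hnear : ¬ NearThreshold c cβ T ρ arms θ k₀ ξ i a) :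
    a ∈ batchSurvivors D c cβ T ρ arms ξ Y i A t ↔ a ∈ A ∧
      gap θ arms k₀ a + epsTilde c cβ d K T ρ (i + 1) ≤ threshold c T d K ξ i := by
  classical
  refine ⟨fun ha => ⟨(Finset.mem_filter.1 ha).1, ?_⟩,
    fun ha => mem_batchSurvivors_of_le hk₀ h ha.1 ha.2⟩
  by_contra hlt
  refine hnear ⟨?_, not_le.1 hlt⟩
  have := gap_le_of_mem_batchSurvivors h hA ha
  linarith

/-- The design multiset, and with it the end of the batch, is a function of the active set.
Executions with equal survivors therefore also remain synchronised in time. -/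
theorem batchArm_eq_of_not_fails [NeZero K]
    (hk₀ : ∀ a, inner ℝ θ (arms a) ≤ inner ℝ θ (arms k₀)) {n : ℕ}
    (hε : ∀ i < n, 4 * epsTilde c cβ d K T ρ (i + 1) ≤ eps c d K T (i + 1))
    {ξ : Seed} {Y Y' : ℕ → Fin K → ℝ}
    (hnear : ∀ i < n, ∀ a, ¬ NearThreshold c cβ T ρ arms θ k₀ ξ i a)
    {b i : ℕ} (hi : i + b ≤ n) {A : Finset (Fin K)} (hA : k₀ ∈ A) (t s : ℕ)
    (h : ¬ Fails D c cβ T ρ arms θ ξ Y b i A t) (h' : ¬ Fails D c cβ T ρ arms θ ξ Y' b i A t) :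
    batchArm D c cβ T ρ arms ξ Y b i A t s = batchArm D c cβ T ρ arms ξ Y' b i A t s := by
  induction b generalizing i A t with
  | zero => rfl
  | succ b ih =>
    simp only [batchArm]
    simp only [Fails, not_and, not_or] at h h'
    split_ifs with h1 h2
    · rfl
    · rfl
    · obtain ⟨hb, hf⟩ := h h1
      obtain ⟨hb', hf'⟩ := h' h1
      have hS : batchSurvivors D c cβ T ρ arms ξ Y i A t =
          batchSurvivors D c cβ T ρ arms ξ Y' i A t := by
        ext a
        rw [mem_batchSurvivors_iff hk₀ hb hA (hnear i (by omega) a),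
          mem_batchSurvivors_iff hk₀ hb' hA (hnear i (by omega) a)]
      rw [← hS] at hf' ⊢
      exact ih (by omega) (best_mem_batchSurvivors hk₀ hb hA (hε i (by omega))) _ hf hf'

/-- `G i` bounds the gaps after i batches and `H i` the size of batch i + 1. If a batch does not
fit, fewer rounds remain than it has pulls, so committing to one active arm costs no more than the
charge `H i * G i` for the batch itself. -/
theorem sum_gap_le_of_not_fails [NeZero K]
    (hk₀ : ∀ a, inner ℝ θ (arms a) ≤ inner ℝ θ (arms k₀)) {c₁ c₂ : ℝ} {n : ℕ}
    (hD : ValidBatches D c cβ T ρ arms c₁ c₂ n)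
    (hε : ∀ i < n, 4 * epsTilde c cβ d K T ρ (i + 1) ≤ eps c d K T (i + 1))
    {G H : ℕ → ℝ} (hG : ∀ i, 0 ≤ G i) (hGε : ∀ i, 2 * eps c d K T (i + 1) ≤ G (i + 1))
    (hH : ∀ i < n, ∀ A : Finset (Fin K), A.Nonempty →
      ((batchList D c cβ T ρ arms i A).length : ℝ) ≤ H i)
    {ξ : Seed} {Y : ℕ → Fin K → ℝ} {b i : ℕ} (hi : i + b ≤ n) {A : Finset (Fin K)} (hA : k₀ ∈ A)
    (hgap : ∀ a ∈ A, gap θ arms k₀ a ≤ G i) {t : ℕ} (ht : t ≤ T)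
    (h : ¬ Fails D c cβ T ρ arms θ ξ Y b i A t) :
    ∑ s ∈ Finset.Ico t T, gap θ arms k₀ (batchArm D c cβ T ρ arms ξ Y b i A t s) ≤
      ∑ j ∈ Finset.range b, H (i + j) * G (i + j) + T * G (i + b) := by
  have hHnn : ∀ i < n, 0 ≤ H i := fun i hi =>
    (Nat.cast_nonneg _).trans (hH i hi {k₀} (Finset.singleton_nonempty _))
  induction b generalizing i A t with
  | zero =>
    simp only [batchArm, Finset.range_zero, Finset.sum_empty, zero_add, add_zero]
    rw [Finset.sum_const, Nat.card_Ico, nsmul_eq_mul]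
    refine mul_le_mul ?_ (hgap _ (firstArm_mem ⟨_, hA⟩)) (gap_nonneg hk₀ _) (by positivity)
    exact_mod_cast Nat.sub_le T t
  | succ b ih =>
    have hrest : 0 ≤ ∑ j ∈ Finset.range b, H (i + (j + 1)) * G (i + (j + 1)) + T * G (i + (b + 1)) :=
      add_nonneg (Finset.sum_nonneg fun j hj => mul_nonneg
        (hHnn _ (by have := Finset.mem_range.1 hj; omega)) (hG _))
        (mul_nonneg (by positivity) (hG _))
    have hHi := hH i (by omega) A ⟨_, hA⟩
    rw [Finset.sum_range_succ', add_zero]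
    simp only [batchArm]
    simp only [Fails, not_and, not_or] at h
    by_cases h1 : T - t < (batchList D c cβ T ρ arms i A).length
    · simp only [h1, if_true]
      rw [Finset.sum_const, Nat.card_Ico, nsmul_eq_mul]
      have h2 : ((T - t : ℕ) : ℝ) ≤ H i := le_trans (by exact_mod_cast h1.le) hHi
      have h3 := mul_le_mul h2 (hgap _ (firstArm_mem ⟨_, hA⟩)) (gap_nonneg hk₀ _)
        (hHnn i (by omega))
      linarith
    · simp only [h1, if_false]
      obtain ⟨hb, hf⟩ := h h1
      set t' := t + (batchList D c cβ T ρ arms i A).length with ht'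
      have htT : t' ≤ T := by omega
      rw [← Finset.sum_Ico_consecutive _ (by omega : t ≤ t') htT]
      have hfirst : ∑ s ∈ Finset.Ico t t', gap θ arms k₀
          (if h : s - t < (batchList D c cβ T ρ arms i A).length then
            (batchList D c cβ T ρ arms i A)[s - t]
          else batchArm D c cβ T ρ arms ξ Y b (i + 1)
            (batchSurvivors D c cβ T ρ arms ξ Y i A t) t' s) ≤ H i * G i := by
        calc _ ≤ ∑ s ∈ Finset.Ico t t', G i := by
              refine Finset.sum_le_sum fun s hs => ?_
              have hs' := Finset.mem_Ico.1 hs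
              rw [dif_pos (by omega)]
              exact hgap _ ((hD i (by omega) A ⟨_, hA⟩).2.mem_active _ (List.getElem_mem _))
          _ = ((batchList D c cβ T ρ arms i A).length : ℝ) * G i := by
              rw [Finset.sum_const, Nat.card_Ico, nsmul_eq_mul, ht', Nat.add_sub_cancel_left]
          _ ≤ _ := mul_le_mul_of_nonneg_right hHi (hG i)
      have hsecond : ∑ s ∈ Finset.Ico t' T, gap θ arms k₀
          (if h : s - t < (batchList D c cβ T ρ arms i A).length then
            (batchList D c cβ T ρ arms i A)[s - t]
          else batchArm D c cβ T ρ arms ξ Y b (i + 1)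
            (batchSurvivors D c cβ T ρ arms ξ Y i A t) t' s) ≤
          ∑ j ∈ Finset.range b, H (i + 1 + j) * G (i + 1 + j) + T * G (i + 1 + b) := by
        refine le_trans (le_of_eq (Finset.sum_congr rfl fun s hs => ?_))
          (ih (by omega) (best_mem_batchSurvivors hk₀ hb hA (hε i (by omega))) ?_ htT hf)
        · have hs' := Finset.mem_Ico.1 hs
          rw [dif_neg (by omega)]
        -- The gap is at most ε̄ + 3 ε̃ ≤ ε + 3ε/4 ≤ 2 ε.
        · intro a ha
          have h2 := gap_le_of_mem_batchSurvivors hb hA ha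
          have h3 := hε i (by omega)
          have h4 := threshold_le c T d K ξ i
          have h5 := hGε i
          have h6 := epsTilde_nonneg c cβ d K T ρ (i + 1)
          linarith
      have e : ∀ j, i + 1 + j = i + (j + 1) := fun j => by omega
      simp only [e] at hsecond
      linarith

end GoodExecutions

/-! ## The parameters of the algorithm -/

section Parameters

theorem three_le_of_two_le_numBatches {T : ℕ} (h : 2 ≤ numBatches T) : 3 ≤ T := by
  by_contra hT
  have h1 : (1 : ℝ) < Real.log T := by
    have := Nat.lt_ceil.1 (h : 1 < ⌈Real.log T⌉₊)
    exact_mod_cast this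
  have h2 : Real.log T ≤ Real.log 2 := by
    rcases Nat.eq_zero_or_pos T with rfl | hpos
    · simpa using Real.log_nonneg one_le_two
    · exact Real.log_le_log (by exact_mod_cast hpos) (by exact_mod_cast (by omega : T ≤ 2))
  linarith [Real.log_two_lt_d9]

variable {T : ℕ}

theorem growth_eq_exp (hB : 2 ≤ numBatches T) :
    growth 1 T = Real.exp (Real.log T / numBatches T) := by
  have hT := three_le_of_two_le_numBatches hB
  have : (0 : ℝ) < T := by exact_mod_cast (by omega : 0 < T)
  rw [growth, div_one, Real.rpow_def_of_pos this, mul_one_div]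

/-- Rounding up gives B - 1 < log T, so log T / B > 1 - 1/B ≥ 1/2. -/
theorem exp_half_le_growth (hB : 2 ≤ numBatches T) : Real.exp (1 / 2) ≤ growth 1 T := by
  rw [growth_eq_exp hB, Real.exp_le_exp]
  have h1 : ((numBatches T - 1 : ℕ) : ℝ) < Real.log T :=
    Nat.lt_ceil.1 (by unfold numBatches at hB ⊢; omega)
  rw [Nat.cast_sub (by omega)] at h1
  have h2 : (2 : ℝ) ≤ numBatches T := by exact_mod_cast hB
  push_cast at h1
  rw [div_le_div_iff₀ (by norm_num) (by linarith)]
  linarith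

theorem growth_le_three (hB : 2 ≤ numBatches T) : growth 1 T ≤ 3 := by
  rw [growth_eq_exp hB]
  have h2 : (2 : ℝ) ≤ numBatches T := by exact_mod_cast hB
  have h1 : Real.log T / numBatches T ≤ 1 := (div_le_one (by linarith)).2 (Nat.le_ceil _)
  exact (Real.exp_le_exp.2 h1).trans (by linarith [Real.exp_one_lt_d9])

theorem five_fourths_le_sqrt_growth (hB : 2 ≤ numBatches T) : 5 / 4 ≤ √(growth 1 T) := by
  refine Real.le_sqrt_of_sq_le ?_
  have h1 : Real.exp (1 / 2) = Real.exp (1 / 4) ^ 2 := by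
    rw [← Real.exp_nat_mul]; norm_num
  have h2 := Real.add_one_le_exp (1 / 4)
  have h3 : (5 / 4 : ℝ) ^ 2 ≤ Real.exp (1 / 4) ^ 2 :=
    pow_le_pow_left₀ (by norm_num) (by linarith) 2
  exact (h3.trans_eq h1.symm).trans (exp_half_le_growth hB)

theorem one_le_growth (hB : 2 ≤ numBatches T) : 1 ≤ growth 1 T :=
  (Real.one_le_exp (by norm_num)).trans (exp_half_le_growth hB)

theorem seven_lt_growth_pow_four (hB : 2 ≤ numBatches T) : 7 < growth 1 T ^ 4 := by
  have h1 : Real.exp (1 / 2) ^ 4 = Real.exp 1 ^ 2 := by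
    rw [← Real.exp_nat_mul, ← Real.exp_nat_mul]; norm_num
  have h2 := pow_le_pow_left₀ (Real.exp_pos _).le (exp_half_le_growth hB) 4
  have h3 : (2.7 : ℝ) ^ 2 ≤ Real.exp 1 ^ 2 :=
    pow_le_pow_left₀ (by norm_num) (by linarith [Real.exp_one_gt_d9]) 2
  rw [h1] at h2
  linarith [h3.trans h2]

theorem growth_pow_numBatches (hB : 2 ≤ numBatches T) : growth 1 T ^ numBatches T = T := by
  have hT := three_le_of_two_le_numBatches hB
  have h0 : (0 : ℝ) < T := by exact_mod_cast (by omega : 0 < T)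
  rw [growth_eq_exp hB, ← Real.exp_nat_mul, mul_div_cancel₀ _ (by positivity), Real.exp_log h0]

theorem numBatches_sub_one_le (hB : 2 ≤ numBatches T) : ((numBatches T - 1 : ℕ) : ℝ) ≤ T := by
  have h1 : ((numBatches T - 1 : ℕ) : ℝ) < Real.log T :=
    Nat.lt_ceil.1 (by unfold numBatches at hB ⊢; omega)
  exact h1.le.trans (Real.log_le_self (by positivity))

variable {d K : ℕ} {ρ : ℝ}

theorem one_le_sq_div_sq (hK : 1 ≤ K) (hρ : 0 < ρ) (hρ1 : ρ ≤ 1) : 1 ≤ (K : ℝ) ^ 2 / ρ ^ 2 := by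
  have h1 : (1 : ℝ) ≤ K := by exact_mod_cast hK
  rw [le_div_iff₀ (by positivity), one_mul]
  exact pow_le_pow_left₀ hρ.le (hρ1.trans h1) 2

theorem blowup_le (hK : 1 ≤ K) (hρ : 0 < ρ) (hρ1 : ρ ≤ 1) :
    (blowup 5000 K ρ : ℝ) ≤ 5000 * ((K : ℝ) ^ 2 / ρ ^ 2) := by
  have h := one_le_sq_div_sq hK hρ hρ1
  rw [blowup, max_eq_left (by linarith)]
  exact Nat.floor_le (by positivity)

/-- Rounding down loses at most 1, which the difference of 5000 and 4096 = 64² covers since K²/ρ² ≥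
1. -/
theorem le_blowup (hK : 1 ≤ K) (hρ : 0 < ρ) (hρ1 : ρ ≤ 1) :
    4096 * ((K : ℝ) ^ 2 / ρ ^ 2) ≤ blowup 5000 K ρ := by
  have h := one_le_sq_div_sq hK hρ hρ1
  rw [blowup, max_eq_left (by linarith)]
  have := Nat.lt_floor_add_one (5000 * ((K : ℝ) ^ 2 / ρ ^ 2))
  linarith

theorem le_sqrt_blowup (hK : 1 ≤ K) (hρ : 0 < ρ) (hρ1 : ρ ≤ 1) :
    64 * (K / ρ) ≤ √(blowup 5000 K ρ : ℝ) := by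
  refine Real.le_sqrt_of_sq_le (le_trans (le_of_eq ?_) (le_blowup hK hρ hρ1))
  ring

theorem sixtyfour_le_sqrt_blowup (hK : 1 ≤ K) (hρ : 0 < ρ) (hρ1 : ρ ≤ 1) :
    64 ≤ √(blowup 5000 K ρ : ℝ) := by
  refine le_trans ?_ (le_sqrt_blowup hK hρ hρ1)
  have h1 : (1 : ℝ) ≤ K := by exact_mod_cast hK
  have : 1 ≤ K / ρ := by rw [le_div_iff₀ hρ]; linarith
  linarith

/-- The logarithmic factor `log (K T²)`. -/
def logFactor (K T : ℕ) : ℝ := Real.log ((K : ℝ) * (T : ℝ) ^ 2)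

theorem nine_le_mul_sq (hK : 1 ≤ K) (hT : 3 ≤ T) : 9 ≤ (K : ℝ) * (T : ℝ) ^ 2 := by
  have h1 : (1 : ℝ) ≤ K := by exact_mod_cast hK
  have h2 : (3 : ℝ) ≤ T := by exact_mod_cast hT
  nlinarith

theorem one_le_logFactor (hK : 1 ≤ K) (hT : 3 ≤ T) : 1 ≤ logFactor K T := by
  rw [logFactor, Real.le_log_iff_exp_le (by linarith [nine_le_mul_sq hK hT])]
  linarith [Real.exp_one_lt_d9, nine_le_mul_sq hK hT]

theorem logFactor_le (hK : 1 ≤ K) (hT : 3 ≤ T) :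
    logFactor K T ≤ 2 * Real.log ((K : ℝ) * T) := by
  have h1 : (1 : ℝ) ≤ K := by exact_mod_cast hK
  have h2 : (3 : ℝ) ≤ T := by exact_mod_cast hT
  have h3 : 2 * Real.log ((K : ℝ) * T) = Real.log (((K : ℝ) * T) ^ 2) := by
    rw [Real.log_pow]; norm_num
  rw [h3, logFactor]
  refine Real.log_le_log (by positivity) ?_
  nlinarith [sq_nonneg (T : ℝ)]

theorem delta_pos (hK : 1 ≤ K) (hT : 3 ≤ T) : 0 < delta K T := by
  have := nine_le_mul_sq hK hT
  unfold delta
  positivity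

theorem delta_le_half (hK : 1 ≤ K) (hT : 3 ≤ T) : delta K T ≤ 1 / 2 := by
  have := nine_le_mul_sq hK hT
  exact one_div_le_one_div_of_le two_pos (by linarith)

theorem mul_delta (hK : 1 ≤ K) : K * delta K T = 1 / (T : ℝ) ^ 2 := by
  have h1 : (1 : ℝ) ≤ K := by exact_mod_cast hK
  unfold delta
  by_cases hT : (T : ℝ) = 0
  · simp [hT]
  · field_simp

theorem log_one_div_delta (K T : ℕ) : Real.log (1 / delta K T) = logFactor K T := by
  rw [delta, one_div_one_div, logFactor]

theorem eps_eq (hB : 2 ≤ numBatches T) (d K i : ℕ) :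
    eps 1 d K T i = √(d * logFactor K T) / √(growth 1 T) ^ i := by
  have h := one_le_growth hB
  rw [eps, ← logFactor, Real.sqrt_div' _ (by positivity)]
  congr 1
  refine (Real.sqrt_eq_iff_mul_self_eq (by positivity) (by positivity)).2 ?_
  rw [← mul_pow, Real.mul_self_sqrt (by positivity)]

theorem epsTilde_eq (cβ : ℝ) (d K T : ℕ) (ρ : ℝ) (i : ℕ) :
    epsTilde 1 cβ d K T ρ i = eps 1 d K T i / √(blowup cβ K ρ : ℝ) := by
  rw [epsTilde, eps, ← Real.sqrt_div' _ (by positivity), div_div, mul_comm (growth 1 T ^ i)]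

theorem eps_pos (hB : 2 ≤ numBatches T) (hd : 1 ≤ d) (hK : 1 ≤ K) (i : ℕ) :
    0 < eps 1 d K T i := by
  have h1 := one_le_logFactor hK (three_le_of_two_le_numBatches hB)
  have h2 := five_fourths_le_sqrt_growth hB
  have h3 : (1 : ℝ) ≤ d := by exact_mod_cast hd
  rw [eps_eq hB]
  positivity

theorem mul_epsTilde_le (hK : 1 ≤ K) (hρ : 0 < ρ) (hρ1 : ρ ≤ 1) (d T i : ℕ) :
    64 * epsTilde 1 5000 d K T ρ i ≤ eps 1 d K T i := by
  have h1 := sixtyfour_le_sqrt_blowup hK hρ hρ1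
  rw [epsTilde_eq, ← mul_div_assoc, div_le_iff₀ (by linarith), mul_comm]
  exact mul_le_mul_of_nonneg_left h1 (eps_nonneg _ _ _ _ _)

theorem mul_log_div_epsTilde_sq (hB : 2 ≤ numBatches T) (hd : 1 ≤ d) (hK : 1 ≤ K) (hρ : 0 < ρ)
    (hρ1 : ρ ≤ 1) (i : ℕ) :
    d * Real.log (1 / delta K T) / epsTilde 1 5000 d K T ρ i ^ 2 =
      blowup 5000 K ρ * growth 1 T ^ i := by
  have h1 := one_le_logFactor hK (three_le_of_two_le_numBatches hB)
  have h2 := one_le_growth hB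
  have h3 : (1 : ℝ) ≤ d := by exact_mod_cast hd
  have h4 : 0 < (blowup 5000 K ρ : ℝ) := by
    have := le_blowup hK hρ hρ1
    have := one_le_sq_div_sq hK hρ hρ1
    linarith
  rw [log_one_div_delta, epsTilde, ← logFactor, Real.sq_sqrt (by positivity)]
  field_simp

/-- For the accuracy of batch i + 1 the size condition of the design rule reads |A| ≤ β q^(i+1), and
it holds because K ≤ β and q ≥ 1. -/
theorem validBatches (hd : 1 ≤ d) (hK : 1 ≤ K) (hρ : 0 < ρ) (hρ1 : ρ ≤ 1)
    {arms : Fin K → E d} (harms : ∀ k, ‖arms k‖ ≤ 1) (T : ℕ) :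
    ValidBatches designRule 1 5000 T ρ arms 16 17 (numBatches T - 1) := by
  intro i hi A hA
  have hB : 2 ≤ numBatches T := by omega
  have hT := three_le_of_two_le_numBatches hB
  have hpos : 0 < epsTilde 1 5000 d K T ρ (i + 1) := by
    rw [epsTilde_eq]
    exact div_pos (eps_pos hB hd hK _) (by linarith [sixtyfour_le_sqrt_blowup hK hρ hρ1])
  refine ⟨hpos, designRule_isValid d K arms A _ _ hd harms hA hpos (delta_pos hK hT)
    (delta_le_half hK hT) ?_⟩
  rw [mul_log_div_epsTilde_sq hB hd hK hρ hρ1]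
  have h1 : (A.card : ℝ) ≤ K := by
    exact_mod_cast (Finset.card_le_univ A).trans_eq (Fintype.card_fin K)
  have h2 : (1 : ℝ) ≤ K := by exact_mod_cast hK
  have h3 : (K : ℝ) ≤ blowup 5000 K ρ := by
    refine le_trans ?_ (le_blowup hK hρ hρ1)
    have h4 : (K : ℝ) ^ 2 ≤ (K : ℝ) ^ 2 / ρ ^ 2 :=
      le_div_self (by positivity) (by positivity) (pow_le_one₀ hρ.le hρ1)
    nlinarith
  exact (h1.trans h3).trans (le_mul_of_one_le_right (by positivity) (one_le_pow₀ (one_le_growth hB)))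

theorem length_batchList_le (hd : 1 ≤ d) (hK : 1 ≤ K) (hρ : 0 < ρ) (hρ1 : ρ ≤ 1)
    {arms : Fin K → E d} (harms : ∀ k, ‖arms k‖ ≤ 1) {i : ℕ} (hi : i < numBatches T - 1)
    {A : Finset (Fin K)} (hA : A.Nonempty) :
    ((batchList designRule 1 5000 T ρ arms i A).length : ℝ) ≤
      17 * (blowup 5000 K ρ * growth 1 T ^ (i + 1)) := by
  rw [← mul_log_div_epsTilde_sq (by omega) hd hK hρ hρ1]
  exact (validBatches hd hK hρ hρ1 harms T i hi A hA).2.length_le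

theorem le_length_batchList (hd : 1 ≤ d) (hK : 1 ≤ K) (hρ : 0 < ρ) (hρ1 : ρ ≤ 1)
    {arms : Fin K → E d} (harms : ∀ k, ‖arms k‖ ≤ 1) {i : ℕ} (hi : i < numBatches T - 1)
    {A : Finset (Fin K)} (hA : A.Nonempty) :
    16 * (blowup 5000 K ρ * growth 1 T ^ (i + 1)) ≤
      ((batchList designRule 1 5000 T ρ arms i A).length : ℝ) := by
  rw [← mul_log_div_epsTilde_sq (by omega) hd hK hρ hρ1]
  exact (validBatches hd hK hρ hρ1 harms T i hi A hA).2.le_length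

/-! ### Summing the regret over the batches -/

/-- An upper bound for the gaps of the arms that are active after `i` batches. -/
def gapBound (d K T : ℕ) : ℕ → ℝ
  | 0 => 2
  | i + 1 => 2 * eps 1 d K T (i + 1)

/-- Put s = √q and P = √(d log(KT²)). A batch contributes at most 17 β q^(j+1) · 2P/s^j = 34 β q P
s^j. With ratio s ≥ 5/4 the geometric sum is at most 4 s^n, and q ≤ 3, so the batches give 34 · 3 ·
4 = 408. As s^(n+1) = √T and s ≤ 2, the final rounds add 2 s P √T ≤ 4 P √T. -/
theorem regret_sum_le (hB : 2 ≤ numBatches T) (hd : 1 ≤ d) (hK : 1 ≤ K) (hρ : 0 < ρ)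
    (hρ1 : ρ ≤ 1) :
    ∑ j ∈ Finset.range (numBatches T - 1),
        17 * (blowup 5000 K ρ * growth 1 T ^ (j + 1)) * gapBound d K T j +
      T * gapBound d K T (numBatches T - 1) ≤
    412 * blowup 5000 K ρ * √(d * logFactor K T * T) := by
  have hT := three_le_of_two_le_numBatches hB
  have hL := one_le_logFactor hK hT
  have hq3 := growth_le_three hB
  have hs := five_fourths_le_sqrt_growth hB
  have hd1 : (1 : ℝ) ≤ d := by exact_mod_cast hd
  have hT0 : (3 : ℝ) ≤ T := by exact_mod_cast hT
  have hβ : 1 ≤ (blowup 5000 K ρ : ℝ) := by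
    have := le_blowup hK hρ hρ1
    have := one_le_sq_div_sq hK hρ hρ1
    linarith
  have hqT := growth_pow_numBatches hB
  have hq0 := one_le_growth hB
  set β : ℝ := (blowup 5000 K ρ : ℝ)
  set q := growth 1 T with hq
  set s := √q with hsdef
  set n := numBatches T - 1 with hn
  have hn1 : numBatches T = n + 1 := by omega
  have hq2 : q = s ^ 2 := (Real.sq_sqrt (by linarith)).symm
  set P := √(d * logFactor K T) with hP
  have hP1 : 1 ≤ P := Real.one_le_sqrt.2 (by nlinarith)
  have hsT : s ^ (n + 1) = √T := by
    rw [← hqT, hn1, hq2, ← pow_mul, mul_comm 2, pow_mul, Real.sqrt_sq (by positivity)]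
  -- For j = 0 the trivial bound 2 fits the pattern because P ≥ 1.
  have hgb : ∀ j, gapBound d K T j ≤ 2 * (P / s ^ j) := by
    intro j
    cases j with
    | zero => simp only [gapBound, pow_zero, div_one]; linarith
    | succ j => rw [gapBound, eps_eq hB]
  have hterm : ∀ j ∈ Finset.range n,
      17 * (β * q ^ (j + 1)) * gapBound d K T j ≤ 34 * β * q * P * s ^ j := by
    intro j _
    calc 17 * (β * q ^ (j + 1)) * gapBound d K T j ≤ 17 * (β * q ^ (j + 1)) * (2 * (P / s ^ j)) :=
          mul_le_mul_of_nonneg_left (hgb j) (by positivity)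
      _ = 34 * β * q * P * (q ^ j / s ^ j) := by ring
      _ = 34 * β * q * P * s ^ j := by
        congr 1
        rw [hq2, ← pow_mul, mul_comm 2 j, pow_mul, sq, mul_div_assoc, div_self (by positivity),
          mul_one]
  have hgeom : ∑ j ∈ Finset.range n, s ^ j ≤ 4 * s ^ n := by
    have h1 := geom_sum_mul s n
    have h2 : 0 ≤ ∑ j ∈ Finset.range n, s ^ j := Finset.sum_nonneg fun j _ => by positivity
    nlinarith
  have hsn : s ^ n ≤ √T := by
    rw [← hsT]
    exact pow_le_pow_right₀ (by linarith) (by omega)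
  have hsum : ∑ j ∈ Finset.range n, 17 * (β * q ^ (j + 1)) * gapBound d K T j ≤
      408 * β * (P * √T) := by
    calc _ ≤ ∑ j ∈ Finset.range n, 34 * β * q * P * s ^ j := Finset.sum_le_sum hterm
      _ = 34 * β * q * P * ∑ j ∈ Finset.range n, s ^ j := by rw [Finset.mul_sum]
      _ ≤ 34 * β * 3 * P * (4 * √T) := by
        refine mul_le_mul ?_ (hgeom.trans (by linarith))
          (Finset.sum_nonneg fun j _ => by positivity) (by positivity)
        gcongr
      _ = _ := by ring
  have hlast : T * gapBound d K T n ≤ 4 * β * (P * √T) := by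
    have hs2 : s ≤ 2 := Real.sqrt_le_iff.2 ⟨by norm_num, by linarith⟩
    have hTT : (T : ℝ) = √T * (s ^ n * s) := by
      rw [← pow_succ, hsT, Real.mul_self_sqrt (by positivity)]
    calc T * gapBound d K T n ≤ T * (2 * (P / s ^ n)) :=
          mul_le_mul_of_nonneg_left (hgb n) (by positivity)
      _ = √T * (s ^ n * s) * (2 * (P / s ^ n)) := by rw [← hTT]
      _ = 2 * s * (P * √T) := by
        field_simp
      _ ≤ 4 * β * (P * √T) := by
        refine mul_le_mul_of_nonneg_right ?_ (by positivity)
        nlinarith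
  rw [Real.sqrt_mul (by positivity), ← hP]
  linarith

/-- Over four batches ε shrinks by q² > 5/2, whereas the two bounds on g / ε differ only by the
factor 51/23 < 5/2. The constants are 1/2 - 1/48 and 1 + 3/48: a threshold in [ε/2, ε] whose window
contains it needs a gap in this range, with room to spare as ε̃ ≤ ε/64. -/
theorem card_near_le (hB : 2 ≤ numBatches T) (hd : 1 ≤ d) (hK : 1 ≤ K) (g : ℝ) (n : ℕ) :
    ((Finset.range n).filter fun i => 23 / 48 * eps 1 d K T (i + 1) ≤ g ∧
      g ≤ 51 / 48 * eps 1 d K T (i + 1)).card ≤ 4 := by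
  set F := (Finset.range n).filter fun i => 23 / 48 * eps 1 d K T (i + 1) ≤ g ∧
      g ≤ 51 / 48 * eps 1 d K T (i + 1) with hF
  rcases F.eq_empty_or_nonempty with he | hne
  · simp [he]
  set i₀ := F.min' hne
  have h0 := (Finset.mem_filter.1 (F.min'_mem hne)).2
  have hsub : F ⊆ Finset.Ico i₀ (i₀ + 4) := by
    intro i hi
    refine Finset.mem_Ico.2 ⟨F.min'_le i hi, ?_⟩
    by_contra hlt
    have h1 := (Finset.mem_filter.1 hi).2
    have hpos := eps_pos hB hd hK (T := T) (i + 1)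
    have hs := five_fourths_le_sqrt_growth hB
    have hq4 := seven_lt_growth_pow_four hB
    have hs4 : 5 / 2 < √(growth 1 T) ^ 4 := by
      refine lt_of_pow_lt_pow_left₀ 2 (by positivity) ?_
      rw [← pow_mul, mul_comm, pow_mul, Real.sq_sqrt (by linarith [one_le_growth hB])]
      linarith
    have h2 : √(growth 1 T) ^ 4 * eps 1 d K T (i + 1) ≤ eps 1 d K T (i₀ + 1) := by
      rw [eps_eq hB, eps_eq hB, mul_div_left_comm]
      rw [div_eq_mul_inv]
      refine mul_le_mul_of_nonneg_left ?_ (Real.sqrt_nonneg _)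
      rw [← div_eq_mul_inv, div_le_iff₀ (by positivity), inv_mul_eq_div,
        le_div_iff₀ (by positivity), ← pow_add]
      exact pow_le_pow_right₀ (by linarith) (by omega)
    nlinarith
  exact (Finset.card_le_card hsub).trans (by simp)

end Parameters

/-! ## Reproducibility and regret -/

section ReproducibilityAndRegret

theorem measureReal_prod_le {α β : Type*} [MeasurableSpace α] [MeasurableSpace β] {μ : Measure α}
    {ν : Measure β} [IsProbabilityMeasure μ] [IsProbabilityMeasure ν] {s : Set (α × β)}
    (hs : MeasurableSet s) {p : ℝ} (hp : ∀ x, ν.real (Prod.mk x ⁻¹' s) ≤ p) :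
    (μ.prod ν).real s ≤ p := by
  have hp0 : 0 ≤ p := by
    obtain ⟨x⟩ : Nonempty α := nonempty_of_isProbabilityMeasure μ
    exact measureReal_nonneg.trans (hp x)
  rw [measureReal_def, Measure.prod_apply hs]
  refine ENNReal.toReal_le_of_le_ofReal hp0 ?_
  calc ∫⁻ x, ν (Prod.mk x ⁻¹' s) ∂μ ≤ ∫⁻ _, ENNReal.ofReal p ∂μ := by
        refine lintegral_mono fun x => ?_
        rw [← ofReal_measureReal]
        exact ENNReal.ofReal_le_ofReal (hp x)
    _ = ENNReal.ofReal p := by simp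

theorem seedLaw_mem_Ico_le (i : ℕ) (a b : ℝ) :
    seedLaw.real {ξ | a ≤ (ξ i : ℝ) ∧ (ξ i : ℝ) < b} ≤ max (b - a) 0 := by
  have hmp : MeasurePreserving (fun ξ : Seed => ξ i) seedLaw volume :=
    measurePreserving_eval_infinitePi (fun _ : ℕ => (volume : Measure unitInterval)) i
  have hset : {ξ : Seed | a ≤ (ξ i : ℝ) ∧ (ξ i : ℝ) < b} =
      (fun ξ : Seed => ξ i) ⁻¹' (Subtype.val ⁻¹' Set.Ico a b) := rfl
  have hm : MeasurableSet ((Subtype.val : unitInterval → ℝ) ⁻¹' Set.Ico a b) :=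
    measurable_subtype_coe measurableSet_Ico
  rw [hset, measureReal_def, hmp.measure_preimage hm.nullMeasurableSet,
    volume_preimage_coe measurableSet_Icc.nullMeasurableSet measurableSet_Ico]
  refine ENNReal.toReal_le_of_le_ofReal (le_max_right _ _) ?_
  calc volume (Set.Ico a b ∩ Set.Icc 0 1) ≤ volume (Set.Ico a b) :=
        measure_mono Set.inter_subset_left
    _ = ENNReal.ofReal (b - a) := Real.volume_Ico
    _ ≤ _ := ENNReal.ofReal_le_ofReal (le_max_left _ _)

variable {d K T : ℕ} {ρ : ℝ} {arms : Fin K → E d}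

/-- The window has length 4 ε̃ and the threshold is uniform on an interval of length ε/2, which
gives 8 ε̃/ε = 8/√β. For a gap of another scale the window misses the interval. -/
theorem seedLaw_nearThreshold_le (hB : 2 ≤ numBatches T) (hd : 1 ≤ d) (hK : 1 ≤ K) (hρ : 0 < ρ)
    (hρ1 : ρ ≤ 1) (θ : E d) (k₀ a : Fin K) (i : ℕ) :
    seedLaw.real {ξ | NearThreshold 1 5000 T ρ arms θ k₀ ξ i a} ≤
      if 23 / 48 * eps 1 d K T (i + 1) ≤ gap θ arms k₀ a ∧
        gap θ arms k₀ a ≤ 51 / 48 * eps 1 d K T (i + 1) then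
        8 / √(blowup 5000 K ρ : ℝ) else 0 := by
  have hε := eps_pos hB hd hK (T := T) (i + 1)
  have hεt := mul_epsTilde_le hK hρ hρ1 d T (i + 1)
  have hβ := sixtyfour_le_sqrt_blowup hK hρ hρ1
  split_ifs with h
  · set g := gap θ arms k₀ a
    set e := eps 1 d K T (i + 1) with he
    set et := epsTilde 1 5000 d K T ρ (i + 1) with het
    have hset : {ξ : Seed | NearThreshold 1 5000 T ρ arms θ k₀ ξ i a} =
        {ξ | (g - 3 * et - e / 2) / (e / 2) ≤ (ξ i : ℝ) ∧
          (ξ i : ℝ) < (g + et - e / 2) / (e / 2)} := by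
      ext ξ
      simp only [NearThreshold, threshold, ← he, ← het, Set.mem_ofPred_eq]
      rw [div_le_iff₀ (by linarith), lt_div_iff₀ (by linarith)]
      constructor <;> rintro ⟨h1, h2⟩ <;> constructor <;> linarith
    rw [hset]
    refine (seedLaw_mem_Ico_le i _ _).trans (max_le (le_of_eq ?_) (by positivity))
    rw [het, epsTilde_eq, ← he]
    field_simp
    ring
  · have hset : {ξ : Seed | NearThreshold 1 5000 T ρ arms θ k₀ ξ i a} = ∅ := by
      refine Set.eq_empty_of_forall_notMem fun ξ hξ => h ?_
      obtain ⟨h1, h2⟩ := hξ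
      have h3 := le_threshold 1 T d K ξ i
      have h4 := threshold_le 1 T d K ξ i
      constructor <;> linarith
    rw [hset, measureReal_empty]

/-- K arms with at most four dangerous batches each give 32 K / √β, and √β ≥ 64 K / ρ. The number n
of batches does not enter. -/
theorem seedLaw_exists_nearThreshold_le (hB : 2 ≤ numBatches T) (hd : 1 ≤ d) (hK : 1 ≤ K)
    (hρ : 0 < ρ) (hρ1 : ρ ≤ 1) (θ : E d) (k₀ : Fin K) (n : ℕ) :
    seedLaw.real {ξ | ∃ i < n, ∃ a, NearThreshold 1 5000 T ρ arms θ k₀ ξ i a} ≤ ρ / 2 := by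
  have hset : {ξ : Seed | ∃ i < n, ∃ a, NearThreshold 1 5000 T ρ arms θ k₀ ξ i a} =
      ⋃ a ∈ (Finset.univ : Finset (Fin K)), ⋃ i ∈ Finset.range n,
        {ξ | NearThreshold 1 5000 T ρ arms θ k₀ ξ i a} := by
    ext ξ
    simp only [Set.mem_ofPred_eq, Set.mem_iUnion, Finset.mem_univ, Finset.mem_range]
    constructor
    · rintro ⟨i, hi, a, h⟩; exact ⟨a, trivial, i, hi, h⟩
    · rintro ⟨a, -, i, hi, h⟩; exact ⟨i, hi, a, h⟩
  have hβ := le_sqrt_blowup hK hρ hρ1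
  have hβ' := sixtyfour_le_sqrt_blowup hK hρ hρ1
  have hK0 : (1 : ℝ) ≤ K := by exact_mod_cast hK
  rw [hset]
  calc _ ≤ ∑ a : Fin K, seedLaw.real (⋃ i ∈ Finset.range n,
        {ξ | NearThreshold 1 5000 T ρ arms θ k₀ ξ i a}) := measureReal_biUnion_finset_le _ _
    _ ≤ ∑ a : Fin K, 4 * (8 / √(blowup 5000 K ρ : ℝ)) := by
      refine Finset.sum_le_sum fun a _ => (measureReal_biUnion_finset_le _ _).trans ?_
      refine (Finset.sum_le_sum fun i _ =>
        seedLaw_nearThreshold_le hB hd hK hρ hρ1 θ k₀ a i).trans ?_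
      rw [← Finset.sum_filter, Finset.sum_const, nsmul_eq_mul]
      refine mul_le_mul_of_nonneg_right ?_ (by positivity)
      exact_mod_cast card_near_le hB hd hK (gap θ arms k₀ a) n
    _ = 32 * K / √(blowup 5000 K ρ : ℝ) := by
      rw [Finset.sum_const, Finset.card_univ, Fintype.card_fin, nsmul_eq_mul]
      ring
    _ ≤ ρ / 2 := by
      rw [div_le_iff₀ (by linarith)]
      calc 32 * (K : ℝ) = ρ / 2 * (64 * (K / ρ)) := by field_simp; norm_num
        _ ≤ _ := mul_le_mul_of_nonneg_left hβ (by positivity)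

theorem measurableSet_nearThreshold (c cβ : ℝ) (T : ℕ) (ρ : ℝ) (arms : Fin K → E d) (θ : E d)
    (k₀ : Fin K) (n : ℕ) :
    MeasurableSet {ξ | ∃ i < n, ∃ a, NearThreshold c cβ T ρ arms θ k₀ ξ i a} := by
  have : {ξ : Seed | ∃ i < n, ∃ a, NearThreshold c cβ T ρ arms θ k₀ ξ i a} =
      ⋃ i ∈ Finset.range n, ⋃ a, {ξ | NearThreshold c cβ T ρ arms θ k₀ ξ i a} := by
    ext ξ
    simp
  rw [this]
  refine Finset.measurableSet_biUnion _ fun i _ => MeasurableSet.iUnion fun a => ?_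
  have hm : Measurable fun ξ : Seed => threshold c T d K ξ i := by
    unfold threshold
    fun_prop
  exact (measurableSet_le measurable_const hm).inter (measurableSet_lt hm measurable_const)

/-! ### Proof of reproducibility -/

theorem exists_best_arm [NeZero K] (θ : E d) (arms : Fin K → E d) :
    ∃ k₀, ∀ a, inner ℝ θ (arms a) ≤ inner ℝ θ (arms k₀) :=
  Finite.exists_max fun a => inner ℝ θ (arms a)

/-- There are B - 1 ≤ T batches, each failing with probability at most K δ = 1/T². -/
theorem noiseLaw_fails_le_inv [NeZero K] (hB : 2 ≤ numBatches T) (hd : 1 ≤ d) (hρ : 0 < ρ)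
    (hρ1 : ρ ≤ 1) (harms : ∀ k, ‖arms k‖ ≤ 1) (M : Environment d K) (ξ : Seed) :
    M.noiseLaw.real {η | Fails designRule 1 5000 T ρ arms M.θ ξ (M.reward arms η)
      (numBatches T - 1) 0 Finset.univ 0} ≤ 1 / T := by
  have hK : 1 ≤ K := Nat.one_le_iff_ne_zero.2 (NeZero.ne K)
  have hT := three_le_of_two_le_numBatches hB
  have hT0 : (3 : ℝ) ≤ T := by exact_mod_cast hT
  have h := noiseLaw_fails_le (validBatches hd hK hρ hρ1 harms T) (delta_pos hK hT)
    (by linarith [delta_le_half hK hT]) M ξ (b := numBatches T - 1) (i := 0) (by omega)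
    (A := Finset.univ) Finset.univ_nonempty 0
  refine h.trans ?_
  rw [mul_delta hK]
  calc ((numBatches T - 1 : ℕ) : ℝ) * (1 / (T : ℝ) ^ 2) ≤ T * (1 / (T : ℝ) ^ 2) :=
        mul_le_mul_of_nonneg_right (numBatches_sub_one_le hB) (by positivity)
    _ = 1 / T := by field_simp

theorem measurable_reward_seed {Ω : Type*} {mΩ : MeasurableSpace Ω} (M : Environment d K)
    (arms : Fin K → E d) {f : Ω → (ℕ × Fin K → ℝ)} (hf : Measurable f) (s : ℕ) (k : Fin K) :
    Measurable fun ω => M.reward arms (f ω) s k := by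
  unfold Environment.reward
  exact Measurable.const_add ((measurable_pi_apply _).comp hf) _

/-- The budget ρ is split into ρ/2 for a threshold near a gap and 1/T ≤ ρ/4 for bad estimates in
each of the two executions. Without estimation batches the arms do not depend on the rewards and
nothing has to be paid. -/
theorem isReproducible_batchedElimination [NeZero K] (hd : 1 ≤ d) (hρ : 0 < ρ) (hρ1 : ρ ≤ 1)
    (harms : ∀ k, ‖arms k‖ ≤ 1) :
    (batchedElimination designRule 1 5000 T ρ arms).IsReproducible arms T ρ := by
  intro M
  have hK : 1 ≤ K := Nat.one_le_iff_ne_zero.2 (NeZero.ne K)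
  simp only [arm_batchedElimination]
  set P := seedLaw.prod (M.noiseLaw.prod M.noiseLaw)
  have htriv : (∀ (ξ : Seed) (Y Y' : ℕ → Fin K → ℝ) (t : ℕ),
      batchArm designRule 1 5000 T ρ arms ξ Y (numBatches T - 1) 0 Finset.univ 0 t =
      batchArm designRule 1 5000 T ρ arms ξ Y' (numBatches T - 1) 0 Finset.univ 0 t) →
      ENNReal.ofReal (1 - ρ) ≤ P {p | ∀ t < T,
        batchArm designRule 1 5000 T ρ arms p.1 (M.reward arms p.2.1) (numBatches T - 1) 0
          Finset.univ 0 t =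
        batchArm designRule 1 5000 T ρ arms p.1 (M.reward arms p.2.2) (numBatches T - 1) 0
          Finset.univ 0 t} := by
    intro h
    have : {p : Seed × (ℕ × Fin K → ℝ) × (ℕ × Fin K → ℝ) | ∀ t < T,
        batchArm designRule 1 5000 T ρ arms p.1 (M.reward arms p.2.1) (numBatches T - 1) 0
          Finset.univ 0 t =
        batchArm designRule 1 5000 T ρ arms p.1 (M.reward arms p.2.2) (numBatches T - 1) 0
          Finset.univ 0 t} = Set.univ := Set.eq_univ_of_forall fun p t _ => h _ _ _ t
    rw [this, measure_univ]
    exact ENNReal.ofReal_le_one.2 (by linarith)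
  by_cases hB : 2 ≤ numBatches T
  swap
  · refine htriv fun ξ Y Y' t => ?_
    rw [show numBatches T - 1 = 0 by omega]
    rfl
  by_cases hlen : T - 0 < (batchList designRule 1 5000 T ρ arms 0 Finset.univ).length
  · refine htriv fun ξ Y Y' t => ?_
    obtain ⟨n, hn⟩ : ∃ n, numBatches T - 1 = n + 1 := ⟨numBatches T - 2, by omega⟩
    simp only [hn, batchArm, hlen, if_true]
  have hT := three_le_of_two_le_numBatches hB
  have hT0 : (3 : ℝ) ≤ T := by exact_mod_cast hT
  -- The first batch has at least 16 β q pulls and fits into the T rounds, so T ≥ β ≥ 4096 K²/ρ² ≥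
  -- 4/ρ.
  have hTρ : 2 * (1 / (T : ℝ)) ≤ ρ / 2 := by
    have h1 := le_length_batchList hd hK hρ hρ1 harms (i := 0) (T := T) (by omega)
      (A := Finset.univ) Finset.univ_nonempty
    have h2 : ((batchList designRule 1 5000 T ρ arms 0 Finset.univ).length : ℝ) ≤ T := by
      exact_mod_cast (by omega :
        (batchList designRule 1 5000 T ρ arms 0 Finset.univ).length ≤ T)
    have h3 := one_le_growth hB
    have h4 := le_blowup hK hρ hρ1
    have h5 : 1 / ρ ≤ (K : ℝ) ^ 2 / ρ ^ 2 := by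
      have hK1 : (1 : ℝ) ≤ K := by exact_mod_cast hK
      rw [div_le_div_iff₀ hρ (by positivity), one_mul, sq ρ]
      exact mul_le_mul_of_nonneg_right (hρ1.trans (one_le_pow₀ hK1)) hρ.le
    rw [pow_one] at h1
    have h6 : (blowup 5000 K ρ : ℝ) ≤ blowup 5000 K ρ * growth 1 T :=
      le_mul_of_one_le_right (by positivity) h3
    have h7 : 4 / ρ ≤ T := by
      have : 4 / ρ = 4 * (1 / ρ) := by ring
      linarith [div_nonneg zero_le_one hρ.le]
    rw [div_le_iff₀ hρ] at h7
    rw [mul_one_div, div_le_div_iff₀ (by linarith) two_pos]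
    linarith
  obtain ⟨k₀, hk₀⟩ := exists_best_arm M.θ arms
  set n := numBatches T - 1 with hn
  set A₁ : Set (Seed × (ℕ × Fin K → ℝ) × (ℕ × Fin K → ℝ)) :=
    {p | ∃ i < n, ∃ a, NearThreshold 1 5000 T ρ arms M.θ k₀ p.1 i a} with hA₁
  set A₂ : Set (Seed × (ℕ × Fin K → ℝ) × (ℕ × Fin K → ℝ)) :=
    {p | Fails designRule 1 5000 T ρ arms M.θ p.1 (M.reward arms p.2.1) n 0 Finset.univ 0}
    with hA₂
  set A₃ : Set (Seed × (ℕ × Fin K → ℝ) × (ℕ × Fin K → ℝ)) :=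
    {p | Fails designRule 1 5000 T ρ arms M.θ p.1 (M.reward arms p.2.2) n 0 Finset.univ 0}
    with hA₃
  have hP₁ : P.real A₁ ≤ ρ / 2 := by
    have hmp : MeasurePreserving Prod.fst P seedLaw := measurePreserving_fst
    have h1 := hmp.measure_preimage
      (measurableSet_nearThreshold 1 5000 T ρ arms M.θ k₀ n).nullMeasurableSet
    rw [measureReal_def]
    have h2 := seedLaw_exists_nearThreshold_le (arms := arms) hB hd hK hρ hρ1 M.θ k₀ n
    rw [measureReal_def, ← h1] at h2
    exact h2
  have hP₂ : P.real A₂ ≤ 1 / T := by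
    refine measureReal_prod_le (measurableSet_fails designRule 1 5000 T ρ arms M.θ
      (fun i => by fun_prop) n 0 _ 0
      fun s _ k => measurable_reward_seed M arms (by fun_prop) s k) fun ξ => ?_
    have hmp : MeasurePreserving Prod.fst (M.noiseLaw.prod M.noiseLaw) M.noiseLaw :=
      measurePreserving_fst
    have h1 := hmp.measure_preimage (measurableSet_fails designRule 1 5000 T ρ arms M.θ
      (ξ := fun _ => ξ) (Y := fun η => M.reward arms η)
      (fun i => by fun_prop) n 0 Finset.univ 0
      fun s _ k => measurable_reward_seed M arms measurable_id s k).nullMeasurableSet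
    have h2 := noiseLaw_fails_le_inv hB hd hρ hρ1 harms M ξ
    rw [measureReal_def, ← h1] at h2
    exact h2
  have hP₃ : P.real A₃ ≤ 1 / T := by
    refine measureReal_prod_le (measurableSet_fails designRule 1 5000 T ρ arms M.θ
      (fun i => by fun_prop) n 0 _ 0
      fun s _ k => measurable_reward_seed M arms (by fun_prop) s k) fun ξ => ?_
    have hmp : MeasurePreserving Prod.snd (M.noiseLaw.prod M.noiseLaw) M.noiseLaw :=
      measurePreserving_snd
    have h1 := hmp.measure_preimage (measurableSet_fails designRule 1 5000 T ρ arms M.θ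
      (ξ := fun _ => ξ) (Y := fun η => M.reward arms η)
      (fun i => by fun_prop) n 0 Finset.univ 0
      fun s _ k => measurable_reward_seed M arms measurable_id s k).nullMeasurableSet
    have h2 := noiseLaw_fails_le_inv hB hd hρ hρ1 harms M ξ
    rw [measureReal_def, ← h1] at h2
    exact h2
  set G : Set (Seed × (ℕ × Fin K → ℝ) × (ℕ × Fin K → ℝ)) := {p | ∀ t < T,
        batchArm designRule 1 5000 T ρ arms p.1 (M.reward arms p.2.1) n 0 Finset.univ 0 t =
        batchArm designRule 1 5000 T ρ arms p.1 (M.reward arms p.2.2) n 0 Finset.univ 0 t}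
  have hcover : Set.univ ⊆ G ∪ (A₁ ∪ (A₂ ∪ A₃)) := by
    intro p _
    by_contra hp
    simp only [Set.mem_union, not_or] at hp
    obtain ⟨hG, h1, h2, h3⟩ := hp
    refine hG fun t _ => batchArm_eq_of_not_fails hk₀ (n := n) (fun i _ => ?_)
      (fun i hi a ha => h1 ⟨i, hi, a, ha⟩) (by omega) (Finset.mem_univ _) 0 t h2 h3
    have := mul_epsTilde_le hK hρ hρ1 d T (i + 1)
    linarith [epsTilde_nonneg 1 5000 d K T ρ (i + 1)]
  have h1 : 1 ≤ P.real G + (P.real A₁ + (P.real A₂ + P.real A₃)) := by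
    calc (1 : ℝ) = P.real Set.univ := probReal_univ.symm
      _ ≤ P.real (G ∪ (A₁ ∪ (A₂ ∪ A₃))) := measureReal_mono hcover
      _ ≤ P.real G + P.real (A₁ ∪ (A₂ ∪ A₃)) := measureReal_union_le _ _
      _ ≤ P.real G + (P.real A₁ + P.real (A₂ ∪ A₃)) :=
        add_le_add le_rfl (measureReal_union_le _ _)
      _ ≤ _ := add_le_add le_rfl (add_le_add le_rfl (measureReal_union_le _ _))
  rw [← ofReal_measureReal]
  exact ENNReal.ofReal_le_ofReal (by linarith)

/-! ### Proof of the regret bound -/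

theorem expectedRegret_eq_integral [NeZero K] {π : Policy K} (M : Environment d K) {k₀ : Fin K}
    (hk₀ : ∀ a, inner ℝ M.θ (arms a) ≤ inner ℝ M.θ (arms k₀))
    (hπ : ∀ t, Measurable fun p : Seed × (ℕ × Fin K → ℝ) => π.arm p.1 (M.reward arms p.2) t) :
    Integrable (fun p : Seed × (ℕ × Fin K → ℝ) => ∑ t ∈ Finset.range T,
      gap M.θ arms k₀ (π.arm p.1 (M.reward arms p.2) t)) (seedLaw.prod M.noiseLaw) ∧
    π.expectedRegret arms T M = ∫ p : Seed × (ℕ × Fin K → ℝ), ∑ t ∈ Finset.range T,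
      gap M.θ arms k₀ (π.arm p.1 (M.reward arms p.2) t) ∂(seedLaw.prod M.noiseLaw) := by
  have hint : ∀ (f : Fin K → ℝ) (t : ℕ), Integrable (fun p : Seed × (ℕ × Fin K → ℝ) =>
      f (π.arm p.1 (M.reward arms p.2) t)) (seedLaw.prod M.noiseLaw) := fun f t =>
    Integrable.of_bound ((measurable_of_finite f).comp (hπ t)).aestronglyMeasurable
      (∑ a, ‖f a‖) (Filter.Eventually.of_forall fun p =>
        Finset.single_le_sum (f := fun a => ‖f a‖) (fun a _ => norm_nonneg _) (Finset.mem_univ _))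
  refine ⟨integrable_finsetSum _ fun t _ => hint _ t, ?_⟩
  have hsup : ⨆ k, inner ℝ M.θ (arms k) = inner ℝ M.θ (arms k₀) :=
    le_antisymm (ciSup_le hk₀) (le_ciSup (f := fun k => inner ℝ M.θ (arms k)) (Set.finite_range _).bddAbove k₀)
  rw [Policy.expectedRegret, hsup,
    integral_finsetSum _ fun t _ => hint (fun a => inner ℝ M.θ (arms a)) t,
    integral_finsetSum _ fun t _ => hint (gap M.θ arms k₀) t]
  simp only [gap]
  simp_rw [integral_sub (integrable_const _) (hint (fun a => inner ℝ M.θ (arms a)) _)]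
  simp

theorem expectedRegret_batchedElimination_le [NeZero K] (hd : 1 ≤ d) (hρ : 0 < ρ) (hρ1 : ρ ≤ 1)
    (harms : ∀ k, ‖arms k‖ ≤ 1) (M : Environment d K) :
    (batchedElimination designRule 1 5000 T ρ arms).expectedRegret arms T M ≤
      5000000 * ((K : ℝ) ^ 2 / ρ ^ 2) * √(d * T * Real.log (K * T)) := by
  have hK : 1 ≤ K := Nat.one_le_iff_ne_zero.2 (NeZero.ne K)
  have hK1 : (1 : ℝ) ≤ K := by exact_mod_cast hK
  have hd1 : (1 : ℝ) ≤ d := by exact_mod_cast hd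
  obtain ⟨k₀, hk₀⟩ := exists_best_arm M.θ arms
  have hmeas : ∀ t, Measurable fun p : Seed × (ℕ × Fin K → ℝ) =>
      (batchedElimination designRule 1 5000 T ρ arms).arm p.1 (M.reward arms p.2) t := by
    intro t
    simp only [arm_batchedElimination]
    exact measurable_batchArm designRule 1 5000 T ρ arms (fun i => by fun_prop)
      (fun s k => measurable_reward_seed M arms measurable_snd s k) _ _ _ _ _
  obtain ⟨hint, heq⟩ := expectedRegret_eq_integral (T := T) M hk₀ hmeas
  have hKρ := one_le_sq_div_sq hK hρ hρ1
  rw [heq]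
  have hcrude : ∀ p : Seed × (ℕ × Fin K → ℝ), ∑ t ∈ Finset.range T, gap M.θ arms k₀
      ((batchedElimination designRule 1 5000 T ρ arms).arm p.1 (M.reward arms p.2) t) ≤
      2 * T := fun p => by
    refine (Finset.sum_le_sum fun t _ => gap_le_two M.norm_θ_le harms k₀ _).trans_eq ?_
    rw [Finset.sum_const, Finset.card_range, nsmul_eq_mul, mul_comm]
  by_cases hB : 2 ≤ numBatches T
  · have hT := three_le_of_two_le_numBatches hB
    have hT0 : (3 : ℝ) ≤ T := by exact_mod_cast hT
    set n := numBatches T - 1 with hn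
    set F : Set (Seed × (ℕ × Fin K → ℝ)) :=
      {p | Fails designRule 1 5000 T ρ arms M.θ p.1 (M.reward arms p.2) n 0 Finset.univ 0}
      with hF
    have hFm : MeasurableSet F := measurableSet_fails designRule 1 5000 T ρ arms M.θ
      (fun i => by fun_prop) n 0 _ 0
      fun s _ k => measurable_reward_seed M arms measurable_snd s k
    have hFP : (seedLaw.prod M.noiseLaw).real F ≤ 1 / T :=
      measureReal_prod_le hFm fun ξ => noiseLaw_fails_le_inv hB hd hρ hρ1 harms M ξ
    set R := 412 * blowup 5000 K ρ * √(d * logFactor K T * T) with hR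
    have hR0 : 0 ≤ R := by positivity
    have hbound : ∀ p : Seed × (ℕ × Fin K → ℝ), ∑ t ∈ Finset.range T, gap M.θ arms k₀
        ((batchedElimination designRule 1 5000 T ρ arms).arm p.1 (M.reward arms p.2) t) ≤
        R + F.indicator (fun _ => 2 * (T : ℝ)) p := by
      intro p
      by_cases hp : p ∈ F
      · rw [Set.indicator_of_mem hp]
        exact (hcrude p).trans (le_add_of_nonneg_left hR0)
      · rw [Set.indicator_of_notMem hp, add_zero]
        simp only [arm_batchedElimination]
        have h := sum_gap_le_of_not_fails hk₀ (validBatches hd hK hρ hρ1 harms T)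
          (fun i _ => by
            have := mul_epsTilde_le hK hρ hρ1 d T (i + 1)
            linarith [epsTilde_nonneg 1 5000 d K T ρ (i + 1)])
          (G := gapBound d K T) (fun i => by
            cases i with
            | zero => exact zero_le_two
            | succ i => exact mul_nonneg zero_le_two (eps_nonneg _ _ _ _ _))
          (fun i => le_rfl)
          (fun i hi A hA => length_batchList_le hd hK hρ hρ1 harms hi hA)
          (b := n) (i := 0) (by omega) (Finset.mem_univ k₀)
          (fun a _ => gap_le_two M.norm_θ_le harms k₀ a) (Nat.zero_le T) hp
        rw [← Finset.range_eq_Ico] at h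
        simp only [zero_add] at h
        exact h.trans (regret_sum_le hB hd hK hρ hρ1)
    have hi2 : Integrable (fun p => R + F.indicator (fun _ => 2 * (T : ℝ)) p)
        (seedLaw.prod M.noiseLaw) :=
      (integrable_const R).add ((integrable_const _).indicator hFm)
    calc _ ≤ ∫ p, R + F.indicator (fun _ => 2 * (T : ℝ)) p ∂(seedLaw.prod M.noiseLaw) :=
          integral_mono hint hi2 hbound
      _ = R + (seedLaw.prod M.noiseLaw).real F * (2 * T) := by
          rw [integral_add (integrable_const R) ((integrable_const _).indicator hFm),
            integral_indicator_const _ hFm]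
          simp
      -- Failure costs at most 2T and has probability at most 1/T, which adds a mere 2 to the
      -- regret.
      _ ≤ R + 1 / T * (2 * T) := by gcongr
      _ = R + 2 := by field_simp
      _ ≤ _ := by
        have hβ := blowup_le hK hρ hρ1
        have hL := logFactor_le hK hT
        have hL1 := one_le_logFactor hK hT
        have hs : √(d * logFactor K T * T) ≤ 2 * √(d * T * Real.log (K * T)) := by
          refine Real.sqrt_le_iff.2 ⟨by positivity, ?_⟩
          have hlog : 0 ≤ Real.log ((K : ℝ) * T) := by linarith
          rw [mul_pow, Real.sq_sqrt (by positivity)]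
          have : 0 ≤ (d : ℝ) * T := by positivity
          nlinarith
        have hs1 : 1 ≤ √(d * logFactor K T * T) := by
          refine Real.one_le_sqrt.2 ?_
          have : 1 ≤ (d : ℝ) * logFactor K T := one_le_mul_of_one_le_of_one_le hd1 hL1
          nlinarith
        set S := √(d * T * Real.log (K * T))
        have hS : 0 ≤ S := Real.sqrt_nonneg _
        set X := (K : ℝ) ^ 2 / ρ ^ 2
        -- The additive 2 is absorbed because 1 ≤ √(d log(KT²) T) ≤ 2S. Altogether the factor is 412
        -- · 5000 · 2 = 4120000, plus 4.
        calc R + 2 ≤ 412 * (5000 * X) * (2 * S) + 2 * (2 * S) := by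
              rw [hR]
              gcongr
              linarith
          _ ≤ 5000000 * X * S := by nlinarith
  · have hT2 : T ≤ 2 := by
      by_contra hT
      refine hB ?_
      have h1 : 1 < Real.log T := by
        rw [Real.lt_log_iff_exp_lt (by exact_mod_cast (by omega : 0 < T))]
        have : (3 : ℝ) ≤ T := by exact_mod_cast (by omega : 3 ≤ T)
        linarith [Real.exp_one_lt_d9]
      exact Nat.lt_ceil.2 (by exact_mod_cast h1)
    rcases Nat.eq_zero_or_pos T with rfl | hTpos
    · simp
    have hT1 : (1 : ℝ) ≤ T := by exact_mod_cast hTpos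
    have hT2' : (T : ℝ) ≤ 2 := by exact_mod_cast hT2
    -- For K = T = 1 the claimed bound is 0, so the crude estimate 2T is not enough; but with a
    -- single arm all gaps vanish.
    by_cases hKone : K = 1
    · subst hKone
      have hz : ∀ a, gap M.θ arms k₀ a = 0 := fun a => by
        rw [Subsingleton.elim a k₀, gap, sub_self]
      simp only [hz, Finset.sum_const_zero, integral_zero]
      positivity
    · have hK2 : (2 : ℝ) ≤ K := by exact_mod_cast (by omega : 2 ≤ K)
      have hlog : 1 / 2 ≤ Real.log (K * T) := by
        have : Real.log 2 ≤ Real.log (K * T) := Real.log_le_log two_pos (by nlinarith)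
        linarith [Real.log_two_gt_d9]
      have hs : 1 / 2 ≤ √(d * T * Real.log (K * T)) := by
        refine Real.le_sqrt_of_sq_le ?_
        have : 1 ≤ (d : ℝ) * T := one_le_mul_of_one_le_of_one_le hd1 hT1
        nlinarith
      calc _ ≤ ∫ _, (2 * T : ℝ) ∂(seedLaw.prod M.noiseLaw) :=
            integral_mono hint (integrable_const _) hcrude
        _ = 2 * T := by simp
        _ ≤ 5000000 * 1 * (1 / 2) := by linarith
        _ ≤ _ := by gcongr

end ReproducibilityAndRegret

/-! ## Reasoning about programs -/

section ProgramLogic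

/-- A bound for the number of steps of a program in which every loop is iterated at most `Z`
times whenever it is entered. -/
def Prog.bound {R : Type*} [Semiring R] (Z : R) : Prog → R
  | .skip => 1
  | .setVar _ e => e.cost + 1
  | .setNat _ i e => i.cost + e.cost + 1
  | .setReal _ i j e => i.cost + j.cost + e.cost + 1
  | .rand _ i j => i.cost + j.cost + 1
  | .pull k _ i j => k.cost + i.cost + j.cost + 1
  | .seq P Q => P.bound Z + Q.bound Z + 1
  | .ite b P Q => b.cost + P.bound Z + Q.bound Z + 1
  | .while b P => (Z + 1) * (b.cost + P.bound Z + 1)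

/-- The bound is a semiring expression in Z. It can thus be formed once with a polynomial for Z and
evaluated at every input afterwards. -/
theorem Prog.map_bound {R S : Type*} [Semiring R] [Semiring S] (f : R →+* S) (Z : R) (P : Prog) :
    f (P.bound Z) = P.bound (f Z) := by
  induction P <;> simp_all [Prog.bound]

theorem Prog.bound_nonneg {Z : ℝ} (hZ : 0 ≤ Z) (P : Prog) : 0 ≤ P.bound Z := by
  induction P <;> simp only [Prog.bound] <;> positivity

theorem Prog.bound_mono {Z Z' : ℝ} (hZ : 0 ≤ Z) (h : Z ≤ Z') :
    ∀ P : Prog, P.bound Z ≤ P.bound Z'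
  | .skip | .setVar _ _ | .setNat _ _ _ | .setReal _ _ _ _ | .rand _ _ _ | .pull _ _ _ _ => le_rfl
  | .seq P Q => by
    have := P.bound_mono hZ h
    have := Q.bound_mono hZ h
    simp only [Prog.bound]
    linarith
  | .ite b P Q => by
    have := P.bound_mono hZ h
    have := Q.bound_mono hZ h
    simp only [Prog.bound]
    linarith
  | .while b P => by
    simp only [Prog.bound]
    have := P.bound_mono hZ h
    have := P.bound_nonneg hZ
    have : 0 ≤ Z' := hZ.trans h
    gcongr

/-- With loops of at most `Z` iterations, the program `P` started in `s` halts in a state that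
satisfies `Q`. -/
def Runs (ξ : Seed) (Y : ℕ → ℕ → ℝ) (Z : ℕ) (P : Prog) (s : State) (Q : State → Prop) : Prop :=
  ∃ s' n, Exec ξ Y P s s' n ∧ n ≤ P.bound Z ∧ Q s'

variable {ξ : Seed} {Y : ℕ → ℕ → ℝ} {Z : ℕ}

theorem Runs.mono {P : Prog} {s : State} {Q Q' : State → Prop} (h : Runs ξ Y Z P s Q)
    (hQ : ∀ s', Q s' → Q' s') : Runs ξ Y Z P s Q' := by
  obtain ⟨s', n, hE, hn, hq⟩ := h
  exact ⟨s', n, hE, hn, hQ s' hq⟩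

theorem runs_setVar {x : ℕ} {e : NExp} {s : State} {Q : State → Prop}
    (h : Q (s.setVar x (e.eval s))) : Runs ξ Y Z (.setVar x e) s Q :=
  ⟨_, _, .setVar s x e, by simp [Prog.bound], h⟩

theorem runs_setNat {a : ℕ} {i e : NExp} {s : State} {Q : State → Prop}
    (h : Q (s.setNat a (i.eval s) (e.eval s))) : Runs ξ Y Z (.setNat a i e) s Q :=
  ⟨_, _, .setNat s a i e, by simp [Prog.bound], h⟩

theorem runs_setReal {a : ℕ} {i j : NExp} {e : RExp} {s : State} {Q : State → Prop}
    (h : Q (s.setReal a (i.eval s) (j.eval s) (e.eval s))) : Runs ξ Y Z (.setReal a i j e) s Q :=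
  ⟨_, _, .setReal s a i j e, by simp [Prog.bound], h⟩

theorem runs_rand {a : ℕ} {i j : NExp} {s : State} {Q : State → Prop}
    (h : Q { s.setReal a (i.eval s) (j.eval s) (ξ s.used : ℝ) with used := s.used + 1 }) :
    Runs ξ Y Z (.rand a i j) s Q :=
  ⟨_, _, .rand s a i j, by simp [Prog.bound], h⟩

theorem runs_pull {k : NExp} {a : ℕ} {i j : NExp} {s : State} {Q : State → Prop}
    (h : Q { s.setReal a (i.eval s) (j.eval s) (Y s.pulls.length (k.eval s)) with
      pulls := s.pulls ++ [k.eval s] }) :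
    Runs ξ Y Z (.pull k a i j) s Q :=
  ⟨_, _, .pull s k a i j, by simp [Prog.bound], h⟩

theorem runs_seq {P₁ P₂ : Prog} {s : State} {Q : State → Prop}
    (h : Runs ξ Y Z P₁ s fun s' => Runs ξ Y Z P₂ s' Q) : Runs ξ Y Z (.seq P₁ P₂) s Q := by
  obtain ⟨s', n, hE, hn, s'', m, hE', hm, hq⟩ := h
  exact ⟨s'', _, .seq hE hE', by simp only [Prog.bound] at *; omega, hq⟩

theorem runs_ite_true {b : BExp} {P₁ P₂ : Prog} {s : State} {Q : State → Prop} (hb : b.eval s)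
    (h : Runs ξ Y Z P₁ s Q) : Runs ξ Y Z (.ite b P₁ P₂) s Q := by
  obtain ⟨s', n, hE, hn, hq⟩ := h
  exact ⟨s', _, .ite_true hb hE, by simp only [Prog.bound, Nat.cast_id] at *; omega, hq⟩

theorem runs_ite_false {b : BExp} {P₁ P₂ : Prog} {s : State} {Q : State → Prop} (hb : ¬ b.eval s)
    (h : Runs ξ Y Z P₂ s Q) : Runs ξ Y Z (.ite b P₁ P₂) s Q := by
  obtain ⟨s', n, hE, hn, hq⟩ := h
  exact ⟨s', _, .ite_false hb hE, by simp only [Prog.bound, Nat.cast_id] at *; omega, hq⟩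

/-- The invariant is indexed by the number of completed iterations and has to force j < Z while the
guard holds. The induction is on the iterations still allowed, k = Z - j. -/
theorem runs_while {b : BExp} {P : Prog} {s : State} (I : ℕ → State → Prop) (h0 : I 0 s)
    (hstep : ∀ j s', I j s' → b.eval s' → j < Z ∧ Runs ξ Y Z P s' (I (j + 1))) :
    Runs ξ Y Z (.while b P) s fun s' => (∃ j, I j s') ∧ ¬ b.eval s' := by
  have key : ∀ k j s', j + k = Z → I j s' → ∃ s'' n, Exec ξ Y (.while b P) s' s'' n ∧
      n ≤ (k + 1) * (b.cost + P.bound Z + 1) ∧ (∃ j, I j s'') ∧ ¬ b.eval s'' := by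
    intro k
    induction k with
    | zero =>
      intro j s' hj hI
      by_cases hb : b.eval s'
      · have := (hstep j s' hI hb).1
        omega
      · exact ⟨s', _, .while_false hb, by rw [zero_add, one_mul]; omega, ⟨j, hI⟩, hb⟩
    | succ k ih =>
      intro j s' hj hI
      rw [add_mul, one_mul]
      by_cases hb : b.eval s'
      · obtain ⟨hjZ, s₁, n, hE, hn, hI'⟩ := hstep j s' hI hb
        obtain ⟨s₂, m, hE', hm, hq⟩ := ih (j + 1) s₁ (by omega) hI'
        exact ⟨s₂, _, .while_true hb hE hE', by omega, hq⟩
      · exact ⟨s', _, .while_false hb, by omega, ⟨j, hI⟩, hb⟩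
  obtain ⟨s', n, hE, hn, hq⟩ := key Z 0 s (by omega) h0
  exact ⟨s', n, hE, by simpa [Prog.bound] using hn, hq⟩

/-! ### Framing -/

/-- The variables that a program may change. -/
def Prog.vars : Prog → List ℕ
  | .setVar x _ => [x]
  | .seq P Q => P.vars ++ Q.vars
  | .ite _ P Q => P.vars ++ Q.vars
  | .while _ P => P.vars
  | _ => []

/-- The arrays of natural numbers that a program may change. -/
def Prog.natArrays : Prog → List ℕ
  | .setNat a _ _ => [a]
  | .seq P Q => P.natArrays ++ Q.natArrays
  | .ite _ P Q => P.natArrays ++ Q.natArrays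
  | .while _ P => P.natArrays
  | _ => []

/-- The arrays of reals that a program may change. -/
def Prog.realArrays : Prog → List ℕ
  | .setReal a _ _ _ => [a]
  | .rand a _ _ => [a]
  | .pull _ a _ _ => [a]
  | .seq P Q => P.realArrays ++ Q.realArrays
  | .ite _ P Q => P.realArrays ++ Q.realArrays
  | .while _ P => P.realArrays
  | _ => []

/-- The program contains no `rand`. -/
def Prog.randFree : Prog → Bool
  | .rand _ _ _ => false
  | .seq P Q => P.randFree && Q.randFree
  | .ite _ P Q => P.randFree && Q.randFree
  | .while _ P => P.randFree
  | _ => true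

/-- The program contains no `pull`. -/
def Prog.pullFree : Prog → Bool
  | .pull _ _ _ _ => false
  | .seq P Q => P.pullFree && Q.pullFree
  | .ite _ P Q => P.pullFree && Q.pullFree
  | .while _ P => P.pullFree
  | _ => true

/-- The states `s` and `s'` differ only in places that `P` may change. -/
structure Frame (P : Prog) (s s' : State) : Prop where
  nvar : ∀ x, x ∉ P.vars → s'.nvar x = s.nvar x
  narr : ∀ a, a ∉ P.natArrays → s'.narr a = s.narr a
  rarr : ∀ a, a ∉ P.realArrays → s'.rarr a = s.rarr a
  used : P.randFree = true → s'.used = s.used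
  pulls : P.pullFree = true → s'.pulls = s.pulls

/-- The places a program may change are read off its syntax. For concrete programs, preservation of
a variable or array becomes a matter of `decide`. -/
theorem Exec.frame {P : Prog} {s s' : State} {n : ℕ} (h : Exec ξ Y P s s' n) : Frame P s s' := by
  induction h with
  | skip s => exact ⟨fun _ _ => rfl, fun _ _ => rfl, fun _ _ => rfl, fun _ => rfl, fun _ => rfl⟩
  | setVar s x e =>
    refine ⟨fun y hy => ?_, fun _ _ => rfl, fun _ _ => rfl, fun _ => rfl, fun _ => rfl⟩
    exact Function.update_of_ne (by simpa [Prog.vars] using hy) _ _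
  | setNat s a i e =>
    refine ⟨fun _ _ => rfl, fun b hb => ?_, fun _ _ => rfl, fun _ => rfl, fun _ => rfl⟩
    exact Function.update_of_ne (by simpa [Prog.natArrays] using hb) _ _
  | setReal s a i j e =>
    refine ⟨fun _ _ => rfl, fun _ _ => rfl, fun b hb => ?_, fun _ => rfl, fun _ => rfl⟩
    exact Function.update_of_ne (by simpa [Prog.realArrays] using hb) _ _
  | rand s a i j =>
    refine ⟨fun _ _ => rfl, fun _ _ => rfl, fun b hb => ?_, by simp [Prog.randFree], fun _ => rfl⟩
    exact Function.update_of_ne (by simpa [Prog.realArrays] using hb) _ _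
  | pull s k a i j =>
    refine ⟨fun _ _ => rfl, fun _ _ => rfl, fun b hb => ?_, fun _ => rfl, by simp [Prog.pullFree]⟩
    exact Function.update_of_ne (by simpa [Prog.realArrays] using hb) _ _
  | seq _ _ ih ih' =>
    constructor <;>
      simp only [Prog.vars, Prog.natArrays, Prog.realArrays, Prog.randFree, Prog.pullFree,
        List.mem_append, not_or, Bool.and_eq_true]
    · exact fun x hx => (ih'.nvar x hx.2).trans (ih.nvar x hx.1)
    · exact fun x hx => (ih'.narr x hx.2).trans (ih.narr x hx.1)
    · exact fun x hx => (ih'.rarr x hx.2).trans (ih.rarr x hx.1)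
    · exact fun h => (ih'.used h.2).trans (ih.used h.1)
    · exact fun h => (ih'.pulls h.2).trans (ih.pulls h.1)
  | ite_true _ _ ih =>
    constructor <;>
      simp only [Prog.vars, Prog.natArrays, Prog.realArrays, Prog.randFree, Prog.pullFree,
        List.mem_append, not_or, Bool.and_eq_true]
    · exact fun x hx => ih.nvar x hx.1
    · exact fun x hx => ih.narr x hx.1
    · exact fun x hx => ih.rarr x hx.1
    · exact fun h => ih.used h.1
    · exact fun h => ih.pulls h.1
  | ite_false _ _ ih =>
    constructor <;>
      simp only [Prog.vars, Prog.natArrays, Prog.realArrays, Prog.randFree, Prog.pullFree,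
        List.mem_append, not_or, Bool.and_eq_true]
    · exact fun x hx => ih.nvar x hx.2
    · exact fun x hx => ih.narr x hx.2
    · exact fun x hx => ih.rarr x hx.2
    · exact fun h => ih.used h.2
    · exact fun h => ih.pulls h.2
  | while_false _ =>
    exact ⟨fun _ _ => rfl, fun _ _ => rfl, fun _ _ => rfl, fun _ => rfl, fun _ => rfl⟩
  | while_true _ _ _ ih ih' =>
    exact ⟨fun x hx => (ih'.nvar x hx).trans (ih.nvar x hx),
      fun x hx => (ih'.narr x hx).trans (ih.narr x hx),
      fun x hx => (ih'.rarr x hx).trans (ih.rarr x hx),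
      fun h => (ih'.used h).trans (ih.used h), fun h => (ih'.pulls h).trans (ih.pulls h)⟩

theorem Runs.frame {P : Prog} {s : State} {Q : State → Prop} (h : Runs ξ Y Z P s Q) :
    Runs ξ Y Z P s fun s' => Frame P s s' ∧ Q s' := by
  obtain ⟨s', n, hE, hn, hq⟩ := h
  exact ⟨s', n, hE, hn, hE.frame, hq⟩

/-! ### Counting loops -/

/-- `for x = 0, …, b - 1 do P`. -/
def forLoop (x : ℕ) (b : NExp) (P : Prog) : Prog :=
  .seq (.setVar x (.const 0))
    (.while (.nlt (.var x) b) (.seq P (.setVar x (.add (.var x) (.const 1)))))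

theorem Frame.refl (P : Prog) (s : State) : Frame P s s :=
  ⟨fun _ _ => rfl, fun _ _ => rfl, fun _ _ => rfl, fun _ => rfl, fun _ => rfl⟩

/-- The invariant of a counting loop may use that everything which the loop does not change is as
it was in the beginning. -/
theorem runs_forLoop {x : ℕ} {b : NExp} {P : Prog} {s : State} {N : ℕ} (hN : N ≤ Z)
    (hx : x ∉ P.vars) (hb : ∀ s', Frame (forLoop x b P) s s' → b.eval s' = N)
    (I : ℕ → State → Prop) (hI : ∀ j s' v, I j s' → I j (s'.setVar x v)) (h0 : I 0 s)
    (hstep : ∀ j s', j < N → Frame (forLoop x b P) s s' → s'.nvar x = j → I j s' →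
      Runs ξ Y Z P s' (I (j + 1))) :
    Runs ξ Y Z (forLoop x b P) s (I N) := by
  have hset : ∀ s' v, Frame (forLoop x b P) s s' → Frame (forLoop x b P) s (s'.setVar x v) := by
    intro s' v h
    refine ⟨fun y hy => ?_, h.narr, h.rarr, h.used, h.pulls⟩
    rw [← h.nvar y hy]
    refine Function.update_of_ne ?_ _ _
    simp only [forLoop, Prog.vars, List.mem_append, List.mem_singleton, not_or] at hy
    exact hy.1
  refine runs_seq (runs_setVar ?_)
  refine (runs_while (fun j s' => Frame (forLoop x b P) s s' ∧ s'.nvar x = j ∧ j ≤ N ∧ I j s')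
    ⟨hset s _ (Frame.refl _ s), by simp [State.setVar, NExp.eval], Nat.zero_le N, hI _ _ _ h0⟩
    ?_).mono ?_
  · rintro j s' ⟨hF, hj, hjN, hIj⟩ hlt
    have hlt' : j < N := by
      rw [← hj, ← hb s' hF]
      exact hlt
    refine ⟨by omega, runs_seq ?_⟩
    refine (hstep j s' hlt' hF hj hIj).frame.mono ?_
    rintro s'' ⟨hF', hI'⟩
    have hxj : s''.nvar x = j := by rw [hF'.nvar x hx, hj]
    refine runs_setVar ⟨hset _ _ ⟨fun y hy => ?_, fun a ha => ?_, fun a ha => ?_, fun h => ?_,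
      fun h => ?_⟩, ?_, hlt', hI _ _ _ hI'⟩
    · rw [← hF.nvar y hy]
      refine hF'.nvar y fun h => hy ?_
      simp [forLoop, Prog.vars, h]
    · rw [← hF.narr a ha]
      refine hF'.narr a fun h => ha ?_
      simp [forLoop, Prog.natArrays, h]
    · rw [← hF.rarr a ha]
      refine hF'.rarr a fun h => ha ?_
      simp [forLoop, Prog.realArrays, h]
    · rw [← hF.used h]
      refine hF'.used ?_
      simpa [forLoop, Prog.randFree] using h
    · rw [← hF.pulls h]
      refine hF'.pulls ?_
      simpa [forLoop, Prog.pullFree] using h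
    · simp [State.setVar, NExp.eval, hxj]
  · rintro s' ⟨⟨j, hF, hj, hjN, hIj⟩, hlt⟩
    have : ¬ j < N := by
      rw [← hj, ← hb s' hF]
      exact hlt
    rwa [show N = j by omega]

/-! ### Filling a matrix -/

/-- `out[i][j] := f` for all `i < n` and `j < m`, where `f` may use the sum of the values of `e`
for `l < p`, which is in the array `9`. The variables `10`, `11` and `12` contain `i`, `j` and
`l`. -/
def fill (out : ℕ) (n m p : NExp) (e f : RExp) : Prog :=
  forLoop 10 n <| forLoop 11 m <|
    .seq (.setReal 9 (.const 0) (.const 0) (.const 0)) <|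
    .seq (forLoop 12 p
      (.setReal 9 (.const 0) (.const 0) (.add (.get 9 (.const 0) (.const 0)) e)))
    (.setReal out (.var 10) (.var 11) f)

/-- The states agree outside of the places that `fill out` changes. -/
structure FillFrame (out : ℕ) (s s' : State) : Prop where
  nvar : ∀ x, x ≠ 10 → x ≠ 11 → x ≠ 12 → s'.nvar x = s.nvar x
  narr : s'.narr = s.narr
  rarr : ∀ a, a ≠ 9 → a ≠ out → s'.rarr a = s.rarr a
  used : s'.used = s.used
  pulls : s'.pulls = s.pulls

theorem FillFrame.trans {out : ℕ} {s s' s'' : State} (h : FillFrame out s s')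
    (h' : FillFrame out s' s'') : FillFrame out s s'' :=
  ⟨fun x h1 h2 h3 => (h'.nvar x h1 h2 h3).trans (h.nvar x h1 h2 h3), h'.narr.trans h.narr,
    fun a h1 h2 => (h'.rarr a h1 h2).trans (h.rarr a h1 h2), h'.used.trans h.used,
    h'.pulls.trans h.pulls⟩

theorem fillFrame_of_frame {P : Prog} {out : ℕ} {s s' : State} (h : Frame P s s')
    (h1 : P.vars ⊆ [10, 11, 12]) (h2 : P.natArrays = []) (h3 : P.realArrays ⊆ [9, out])
    (h4 : P.randFree = true) (h5 : P.pullFree = true) : FillFrame out s s' := by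
  refine ⟨fun x hx1 hx2 hx3 => h.nvar x fun hx => ?_, funext fun a => h.narr a (by simp [h2]),
    fun a ha1 ha2 => h.rarr a fun ha => ?_, h.used h4, h.pulls h5⟩
  · have := h1 hx
    simp_all
  · have := h3 ha
    simp_all

/-- While `e` and `f` are evaluated for a cell of `out`, that cell still has its original value. So
`f` may update `out` in place, as needed for the generalised inverse and the weights. Array 9 is the
accumulator, hence `out ≠ 9`. -/
theorem runs_fill {s : State} {out : ℕ} {n m p : NExp} {e f : RExp} {N M P : ℕ} (hN : N ≤ Z)
    (hM : M ≤ Z) (hP : P ≤ Z) (hout : out ≠ 9) (g : ℕ → ℕ → ℕ → ℝ) (F : ℕ → ℕ → ℝ)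
    (hn : ∀ s', FillFrame out s s' → n.eval s' = N)
    (hm : ∀ s', FillFrame out s s' → m.eval s' = M)
    (hp : ∀ s', FillFrame out s s' → p.eval s' = P)
    (he : ∀ s' i j l, i < N → j < M → l < P → FillFrame out s s' → s'.nvar 10 = i →
      s'.nvar 11 = j → s'.nvar 12 = l → s'.rarr out i j = s.rarr out i j → e.eval s' = g i j l)
    (hf : ∀ s' i j, i < N → j < M → FillFrame out s s' → s'.nvar 10 = i → s'.nvar 11 = j →
      s'.rarr out i j = s.rarr out i j → s'.rarr 9 0 0 = ∑ l ∈ Finset.range P, g i j l →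
      f.eval s' = F i j) :
    Runs ξ Y Z (fill out n m p e f) s fun s' => FillFrame out s s' ∧
      ∀ i < N, ∀ j < M, s'.rarr out i j = F i j := by
  have hupd : ∀ (s' : State) (i j i' j' : ℕ) (v : ℝ), (s'.setReal out i j v).rarr out i' j' =
      if i' = i ∧ j' = j then v else s'.rarr out i' j' := by
    intro s' i j i' j' v
    simp only [State.setReal, Function.update_self]
    by_cases h1 : i' = i
    · subst h1
      by_cases h2 : j' = j
      · subst h2; simp
      · simp [h2]
    · simp [h1]
  -- The last clause, that rows not yet reached are unchanged, is only needed to carry the loop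
  -- invariants.
  have hframe : Runs ξ Y Z (fill out n m p e f) s fun s' => FillFrame out s s' ∧
      (∀ i < N, ∀ j < M, s'.rarr out i j = F i j) ∧
        ∀ i j, N ≤ i → s'.rarr out i j = s.rarr out i j := by
    refine (runs_forLoop (s := s) hN (by simp [forLoop, Prog.vars])
      (fun s' h => hn s' (fillFrame_of_frame h (by simp [forLoop, Prog.vars])
        (by simp [forLoop, Prog.natArrays]) (by simp [forLoop, Prog.realArrays])
        (by simp [forLoop, Prog.randFree]) (by simp [forLoop, Prog.pullFree])))
      (fun i s' => (∀ i' < i, ∀ j < M, s'.rarr out i' j = F i' j) ∧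
        ∀ i' j, i ≤ i' → s'.rarr out i' j = s.rarr out i' j)
      (fun _ _ _ h => h) ⟨by simp, fun _ _ _ => rfl⟩ ?_).frame.mono ?_
    swap
    · rintro s' ⟨hF, h⟩
      exact ⟨fillFrame_of_frame hF (by simp [forLoop, Prog.vars])
        (by simp [forLoop, Prog.natArrays]) (by simp [forLoop, Prog.realArrays])
        (by simp [forLoop, Prog.randFree]) (by simp [forLoop, Prog.pullFree]), h⟩
    intro i s₁ hi hF₁ hi₁ hI₁
    have hF₁' : FillFrame out s s₁ := fillFrame_of_frame hF₁ (by simp [forLoop, Prog.vars])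
        (by simp [forLoop, Prog.natArrays]) (by simp [forLoop, Prog.realArrays])
        (by simp [forLoop, Prog.randFree]) (by simp [forLoop, Prog.pullFree])
    refine (runs_forLoop (s := s₁) hM (by simp [forLoop, Prog.vars])
      (fun s' h => hm s' (hF₁'.trans (fillFrame_of_frame h (by simp [forLoop, Prog.vars])
        (by simp [forLoop, Prog.natArrays]) (by simp [forLoop, Prog.realArrays])
        (by simp [forLoop, Prog.randFree]) (by simp [forLoop, Prog.pullFree]))))
      (fun j s' => (∀ i' < i, ∀ j < M, s'.rarr out i' j = F i' j) ∧
        (∀ j' < j, s'.rarr out i j' = F i j') ∧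
        (∀ j', j ≤ j' → s'.rarr out i j' = s.rarr out i j') ∧
        ∀ i' j, i + 1 ≤ i' → s'.rarr out i' j = s.rarr out i' j)
      (fun _ _ _ h => h) ⟨hI₁.1, by simp, fun j' _ => hI₁.2 i j' le_rfl,
        fun i' j h => hI₁.2 i' j (by omega)⟩ ?_).mono ?_
    swap
    · rintro s' ⟨h1, h2, -, h3⟩
      refine ⟨fun i' hi' j hj => ?_, h3⟩
      rcases Nat.lt_succ_iff_lt_or_eq.1 hi' with h | rfl
      · exact h1 i' h j hj
      · exact h2 j hj
    intro j s₂ hj hF₂ hj₂ hI₂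
    have hF₂' : FillFrame out s s₂ := hF₁'.trans (fillFrame_of_frame hF₂
        (by simp [forLoop, Prog.vars])
        (by simp [forLoop, Prog.natArrays]) (by simp [forLoop, Prog.realArrays])
        (by simp [forLoop, Prog.randFree]) (by simp [forLoop, Prog.pullFree]))
    have hi₂ : s₂.nvar 10 = i := by
      rw [hF₂.nvar 10 (by simp [forLoop, Prog.vars]), hi₁]
    refine runs_seq (runs_setReal (runs_seq ?_))
    set s₃ := s₂.setReal 9 (NExp.eval s₂ (.const 0)) (NExp.eval s₂ (.const 0))
      (RExp.eval s₂ (.const 0)) with hs₃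
    have hF₃' : FillFrame out s s₃ := hF₂'.trans
      ⟨fun _ _ _ _ => rfl, rfl, fun a ha _ => Function.update_of_ne ha _ _, rfl, rfl⟩
    have hout₃ : s₃.rarr out = s₂.rarr out := Function.update_of_ne hout _ _
    have hsum : ∀ (s' : State) (v : ℝ), (s'.setReal 9 0 0 v).rarr 9 0 0 = v := fun s' v => by
      simp [State.setReal]
    have hfr : ∀ s', Frame (forLoop 12 p (.setReal 9 (.const 0) (.const 0)
        (.add (.get 9 (.const 0) (.const 0)) e))) s₃ s' →
        FillFrame out s s' ∧ s'.nvar 10 = i ∧ s'.nvar 11 = j ∧ s'.rarr out = s₂.rarr out := by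
      intro s' h
      refine ⟨hF₃'.trans (fillFrame_of_frame h (by simp [forLoop, Prog.vars])
        (by simp [forLoop, Prog.natArrays]) (by simp [forLoop, Prog.realArrays])
        (by simp [forLoop, Prog.randFree]) (by simp [forLoop, Prog.pullFree])), ?_, ?_, ?_⟩
      · rw [h.nvar 10 (by simp [forLoop, Prog.vars])]; exact hi₂
      · rw [h.nvar 11 (by simp [forLoop, Prog.vars])]; exact hj₂
      · rw [h.rarr out (by simp [forLoop, Prog.realArrays, hout]), hout₃]
    have hcell : s₂.rarr out i j = s.rarr out i j := hI₂.2.2.1 j le_rfl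
    refine (runs_forLoop (s := s₃) hP (by simp [Prog.vars]) (fun s' h => hp s' (hfr s' h).1)
      (fun l s' => s'.rarr 9 0 0 = ∑ l ∈ Finset.range l, g i j l)
      (fun _ _ _ h => h) (by rw [hs₃]; exact (hsum _ _).trans (by simp [RExp.eval])) ?_).frame.mono ?_
    · intro l s₄ hl hF₄ hl₄ hI₄
      obtain ⟨h1, h2, h3, h4⟩ := hfr s₄ hF₄
      refine runs_setReal ?_
      change (s₄.setReal 9 0 0 (s₄.rarr 9 0 0 + e.eval s₄)).rarr 9 0 0 = _
      rw [hsum, hI₄, Finset.sum_range_succ,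
        he s₄ i j l hi hj hl h1 h2 h3 hl₄ (by rw [h4]; exact hcell)]
    · rintro s₅ ⟨hF₅, hsum₅⟩
      obtain ⟨h1, h2, h3, h4⟩ := hfr s₅ hF₅
      refine runs_setReal ?_
      rw [hf s₅ i j hi hj h1 h2 h3 (by rw [h4]; exact hcell) hsum₅]
      simp only [NExp.eval, h2, h3, hupd, h4]
      refine ⟨fun i' hi' j' hj' => ?_, fun j' hj' => ?_, fun j' hj' => ?_, fun i' j' hi' => ?_⟩
      · rw [if_neg (by omega)]
        exact hI₂.1 i' hi' j' hj'
      · split_ifs with h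
        · rw [h.2]
        · exact hI₂.2.1 j' (by simp only [true_and] at h; omega)
      · rw [if_neg (by omega)]
        exact hI₂.2.2.1 j' (by omega)
      · rw [if_neg (by omega)]
        exact hI₂.2.2.2 i' j' hi'
  exact hframe.mono fun s' h => ⟨h.1, h.2.1⟩

end ProgramLogic

/-! ## Programs for the linear algebra -/

section LinearAlgebraPrograms

variable {ξ : Seed} {Y : ℕ → ℕ → ℝ} {Z : ℕ}

theorem State.nvar_setVar_self (s : State) (x v : ℕ) : (s.setVar x v).nvar x = v :=
  Function.update_self _ _ _

theorem State.nvar_setVar_of_ne (s : State) {x y : ℕ} (h : y ≠ x) (v : ℕ) :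
    (s.setVar x v).nvar y = s.nvar y :=
  Function.update_of_ne h _ _

theorem runs_fill_fin {s : State} {out : ℕ} {n m p : NExp} {e f : RExp} {N M P : ℕ} (hN : N ≤ Z)
    (hM : M ≤ Z) (hP : P ≤ Z) (hout : out ≠ 9) (g : Fin N → Fin M → Fin P → ℝ)
    (F : Fin N → Fin M → ℝ)
    (hn : ∀ s', FillFrame out s s' → n.eval s' = N)
    (hm : ∀ s', FillFrame out s s' → m.eval s' = M)
    (hp : ∀ s', FillFrame out s s' → p.eval s' = P)
    (he : ∀ s' (i : Fin N) (j : Fin M) (l : Fin P), FillFrame out s s' → s'.nvar 10 = i →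
      s'.nvar 11 = j → s'.nvar 12 = l → s'.rarr out i j = s.rarr out i j → e.eval s' = g i j l)
    (hf : ∀ s' (i : Fin N) (j : Fin M), FillFrame out s s' → s'.nvar 10 = i → s'.nvar 11 = j →
      s'.rarr out i j = s.rarr out i j → s'.rarr 9 0 0 = ∑ l, g i j l → f.eval s' = F i j) :
    Runs ξ Y Z (fill out n m p e f) s fun s' => FillFrame out s s' ∧
      ∀ (i : Fin N) (j : Fin M), s'.rarr out i j = F i j := by
  refine (runs_fill hN hM hP hout
    (fun i j l => if h : i < N ∧ j < M ∧ l < P then g ⟨i, h.1⟩ ⟨j, h.2.1⟩ ⟨l, h.2.2⟩ else 0)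
    (fun i j => if h : i < N ∧ j < M then F ⟨i, h.1⟩ ⟨j, h.2⟩ else 0) hn hm hp ?_ ?_).mono ?_
  · intro s' i j l hi hj hl hF h1 h2 h3 h4
    rw [dif_pos ⟨hi, hj, hl⟩]
    exact he s' ⟨i, hi⟩ ⟨j, hj⟩ ⟨l, hl⟩ hF h1 h2 h3 h4
  · intro s' i j hi hj hF h1 h2 h3 h4
    rw [dif_pos ⟨hi, hj⟩]
    refine hf s' ⟨i, hi⟩ ⟨j, hj⟩ hF h1 h2 h3 ?_
    rw [h4, Finset.sum_range]
    exact Finset.sum_congr rfl fun l _ => dif_pos ⟨hi, hj, l.2⟩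
  · rintro s' ⟨hF, h⟩
    refine ⟨hF, fun i j => ?_⟩
    rw [h i i.2 j j.2, dif_pos ⟨i.2, j.2⟩]

/-- `y := min {x < n | b}`, and `y := n` if there is no such `x`. -/
def findFirst (x y : ℕ) (n : NExp) (b : BExp) : Prog :=
  .seq (.setVar y n)
    (forLoop x n (.ite (.and (.not (.nlt (.var y) n)) b) (.setVar y (.var x)) .skip))

/-- The value K of `y` means that nothing was found so far. The loop visits all indices, but only
the first hit is recorded, since afterwards `y < K`. -/
theorem runs_findFirst {s : State} {x y K : ℕ} {n : NExp} {b : BExp} (hxy : x ≠ y) (hK : K ≤ Z)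
    (S : Finset (Fin K)) (hn : ∀ s', Frame (findFirst x y n b) s s' → n.eval s' = K)
    (hb : ∀ s' (k : Fin K), Frame (findFirst x y n b) s s' → s'.nvar x = k →
      (b.eval s' ↔ k ∈ S)) :
    Runs ξ Y Z (findFirst x y n b) s fun s' =>
      s'.nvar y = if h : S.Nonempty then ((S.min' h : Fin K) : ℕ) else K := by
  have hfr : ∀ s', Frame (forLoop x n
      (.ite (.and (.not (.nlt (.var y) n)) b) (.setVar y (.var x)) .skip))
      (s.setVar y (n.eval s)) s' → Frame (findFirst x y n b) s s' := by
    intro s' h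
    refine ⟨fun z hz => ?_, h.narr, h.rarr, h.used, h.pulls⟩
    simp only [findFirst, forLoop, Prog.vars, List.mem_append, List.mem_singleton, not_or] at hz
    rw [h.nvar z (by simp [forLoop, Prog.vars, hz])]
    exact Function.update_of_ne hz.1 _ _
  refine runs_seq (runs_setVar ?_)
  refine (runs_forLoop (s := s.setVar y (n.eval s)) hK (by simpa [Prog.vars] using hxy)
    (fun s' h => hn s' (hfr s' h))
    (fun j s' => (s'.nvar y = K ∧ ∀ k : Fin K, (k : ℕ) < j → k ∉ S) ∨
      ∃ k : Fin K, s'.nvar y = k ∧ k ∈ S ∧ ∀ l ∈ S, k ≤ l) ?_ ?_ ?_).mono ?_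
  · intro j s' v h
    have : (s'.setVar x v).nvar y = s'.nvar y := Function.update_of_ne hxy.symm _ _
    rwa [this]
  · refine Or.inl ⟨?_, by simp⟩
    rw [← hn s (Frame.refl _ s)]
    exact Function.update_self _ _ _
  · intro j s' hj hF hxj hI
    have hF' := hfr s' hF
    have hN : n.eval s' = K := hn s' hF'
    have hB := hb s' ⟨j, hj⟩ hF' hxj
    by_cases ht : BExp.eval s' (.and (.not (.nlt (.var y) n)) b)
    · refine runs_ite_true ht (runs_setVar (Or.inr ⟨⟨j, hj⟩, ?_, hB.1 ht.2, fun l hl => ?_⟩))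
      · exact (Function.update_self _ _ _).trans hxj
      · rcases hI with ⟨-, h⟩ | ⟨k, hk, -⟩
        · by_contra hlt
          exact h l (Fin.lt_def.1 (not_le.1 hlt)) hl
        · refine absurd ?_ ht.1
          simp [BExp.eval, NExp.eval, hk, hN]
    · refine runs_ite_false ht ⟨s', 1, .skip s', by simp [Prog.bound], ?_⟩
      rcases hI with ⟨h1, h2⟩ | h
      · refine Or.inl ⟨h1, fun k hk hkS => ?_⟩
        rcases Nat.lt_succ_iff_lt_or_eq.1 hk with h | h
        · exact h2 k h hkS
        · have : k = ⟨j, hj⟩ := Fin.ext h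
          exact ht ⟨by simp [BExp.eval, NExp.eval, h1, hN], hB.2 (this ▸ hkS)⟩
      · exact Or.inr h
  · rintro s' (⟨h1, h2⟩ | ⟨k, h1, h2, h3⟩)
    · rw [dif_neg, h1]
      rintro ⟨k, hk⟩
      exact h2 k k.2 hk
    · rw [dif_pos ⟨k, h2⟩, h1]
      exact congrArg Fin.val (le_antisymm (Finset.le_min' _ _ _ h3) (Finset.min'_le _ _ h2))

/-- The real number in the cell `[0][0]` of an array. -/
def RExp.scalar (a : ℕ) : RExp := .get a (.const 0) (.const 0)

/-- The entry of an array whose indices are in the variables `x` and `y`. -/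
def RExp.entry (a x y : ℕ) : RExp := .get a (.var x) (.var y)

/-- The entry in the first column of an array whose row is in the variable `x`. -/
def RExp.coord (a x : ℕ) : RExp := .get a (.var x) (.const 0)

/-- `1` if the variables `x` and `y` are equal; if they differ, some number at most `0`. -/
def RExp.kronecker (x y : ℕ) : RExp :=
  .ofNat (.sub (.const 1) (.add (.sub (.var x) (.var y)) (.sub (.var y) (.var x))))

theorem RExp.eval_kronecker (s : State) (x y : ℕ) :
    (RExp.kronecker x y).eval s = if s.nvar x = s.nvar y then 1 else 0 := by
  simp only [kronecker, RExp.eval, NExp.eval]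
  split_ifs with h
  · simp [h]
  · rw [Nat.cast_eq_zero]
    omega

/-- The matrix in the array `4` is symmetric positive semidefinite; computes its generalised
inverse in the array `5`. -/
def ginvProg : Prog :=
  .seq (fill 5 (.var 0) (.var 0) (.const 0) (.const 0) (.const 0)) <|
  forLoop 14 (.var 0) <|
  .seq (fill 6 (.var 0) (.const 1) (.var 0) (.mul (.entry 5 10 12) (.entry 4 12 14))
    (.sub (.kronecker 10 14) (.scalar 9))) <|
  .seq (fill 7 (.const 1) (.const 1) (.var 0) (.mul (.coord 6 12) (.entry 4 12 14))
    (.scalar 9)) <|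
  .ite (.and (.not (.rlt (.scalar 7) (.const 0))) (.not (.rlt (.const 0) (.scalar 7)))) .skip <|
  fill 5 (.var 0) (.var 0) (.const 0) (.const 0)
    (.add (.entry 5 10 11) (.div (.mul (.coord 6 10) (.coord 6 11)) (.scalar 7)))

theorem runs_skip {s : State} {Q : State → Prop} (h : Q s) : Runs ξ Y Z .skip s Q :=
  ⟨s, 1, .skip s, by simp [Prog.bound], h⟩

/-- Array 5 holds the current iterate `ginvIter V l`, array 6 the direction f and array 7 the pivot.
-/
theorem runs_ginvProg {s : State} {d : ℕ} (hd : s.nvar 0 = d) (hdZ : d ≤ Z) (hZ : 1 ≤ Z)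
    (V : Matrix (Fin d) (Fin d) ℝ) (hV : ∀ i j : Fin d, s.rarr 4 i j = V i j) :
    Runs ξ Y Z ginvProg s fun s' => ∀ i j : Fin d, s'.rarr 5 i j = ginv V i j := by
  refine runs_seq ((runs_fill_fin hdZ hdZ (Nat.zero_le Z) (by decide) (fun _ _ _ => 0) (fun _ _ => 0)
    ?_ ?_ ?_ ?_ ?_).mono ?_)
  · exact fun s' h => (h.nvar 0 (by decide) (by decide) (by decide)).trans hd
  · exact fun s' h => (h.nvar 0 (by decide) (by decide) (by decide)).trans hd
  · exact fun _ _ => rfl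
  · exact fun _ _ _ l => l.elim0
  · simp [RExp.eval]
  rintro s₁ ⟨hF₁, h₁⟩
  have hd₁ : s₁.nvar 0 = d := (hF₁.nvar 0 (by decide) (by decide) (by decide)).trans hd
  have hV₁ : ∀ i j : Fin d, s₁.rarr 4 i j = V i j := by
    rw [hF₁.rarr 4 (by decide) (by decide)]
    exact hV
  refine runs_forLoop (b := .var 0) hdZ (by decide)
    (fun s' h => (h.nvar 0 (by decide)).trans hd₁)
    (fun l s' => ∀ i j : Fin d, s'.rarr 5 i j = ginvIter V l i j) (fun _ _ _ h => h) h₁ ?_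
  intro l s₂ hl hF₂ hl₂ h₂
  have hd₂ : s₂.nvar 0 = d := (hF₂.nvar 0 (by decide)).trans hd₁
  have hV₂ : ∀ i j : Fin d, s₂.rarr 4 i j = V i j := by
    rw [hF₂.rarr 4 (by decide)]
    exact hV₁
  set M := ginvIter V l with hM
  have hstep : ginvIter V (l + 1) = ginvStep V M ⟨l, hl⟩ := by
    rw [ginvIter, dif_pos hl]
  refine runs_seq ((runs_fill_fin hdZ hZ hdZ (by decide)
    (fun i _ k => M i k * V k ⟨l, hl⟩) (fun i _ => ginvDir V M ⟨l, hl⟩ i) ?_ ?_ ?_ ?_ ?_).mono ?_)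
  · exact fun s' h => (h.nvar 0 (by decide) (by decide) (by decide)).trans hd₂
  · exact fun _ _ => rfl
  · exact fun s' h => (h.nvar 0 (by decide) (by decide) (by decide)).trans hd₂
  · intro s' i j k h hi hj hk _
    have h14 := (h.nvar 14 (by decide) (by decide) (by decide)).trans hl₂
    simp only [RExp.eval, NExp.eval, RExp.entry, hi, hk, h14]
    rw [h.rarr 5 (by decide) (by decide), h.rarr 4 (by decide) (by decide), h₂]
    exact congrArg _ (hV₂ k ⟨l, hl⟩)
  · intro s' i j h hi hj _ hsum
    have h14 := (h.nvar 14 (by decide) (by decide) (by decide)).trans hl₂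
    simp only [RExp.eval, NExp.eval, RExp.scalar, RExp.eval_kronecker, hi, h14, hsum]
    simp [ginvDir, Matrix.mulVec, dotProduct, Pi.single_apply, Fin.ext_iff]
  rintro s₃ ⟨hF₃, h₃⟩
  have hd₃ : s₃.nvar 0 = d := (hF₃.nvar 0 (by decide) (by decide) (by decide)).trans hd₂
  have hl₃ : s₃.nvar 14 = l := (hF₃.nvar 14 (by decide) (by decide) (by decide)).trans hl₂
  have hV₃ : ∀ i j : Fin d, s₃.rarr 4 i j = V i j := by
    rw [hF₃.rarr 4 (by decide) (by decide)]
    exact hV₂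
  have hM₃ : ∀ i j : Fin d, s₃.rarr 5 i j = M i j := by
    rw [hF₃.rarr 5 (by decide) (by decide)]
    exact h₂
  have h₃' : ∀ i : Fin d, s₃.rarr 6 i 0 = ginvDir V M ⟨l, hl⟩ i := fun i => h₃ i 0
  refine runs_seq ((runs_fill_fin (N := 1) (M := 1) (P := d) hZ hZ hdZ (by decide)
    (fun _ _ k => ginvDir V M ⟨l, hl⟩ k * V k ⟨l, hl⟩)
    (fun _ _ => ginvDir V M ⟨l, hl⟩ ⬝ᵥ V.col ⟨l, hl⟩) ?_ ?_ ?_ ?_ ?_).mono ?_)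
  · exact fun _ _ => rfl
  · exact fun _ _ => rfl
  · exact fun s' h => (h.nvar 0 (by decide) (by decide) (by decide)).trans hd₃
  · intro s' i j k h hi hj hk _
    have h14 := (h.nvar 14 (by decide) (by decide) (by decide)).trans hl₃
    simp only [RExp.eval, NExp.eval, RExp.entry, RExp.coord, hk, h14]
    rw [h.rarr 6 (by decide) (by decide), h.rarr 4 (by decide) (by decide), h₃']
    exact congrArg _ (hV₃ k ⟨l, hl⟩)
  · intro s' i j h hi hj _ hsum
    simp only [RExp.eval, NExp.eval, RExp.scalar, hsum]
    simp [dotProduct]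
  rintro s₄ ⟨hF₄, h₄⟩
  have hd₄ : s₄.nvar 0 = d := (hF₄.nvar 0 (by decide) (by decide) (by decide)).trans hd₃
  have hM₄ : ∀ i j : Fin d, s₄.rarr 5 i j = M i j := by
    rw [hF₄.rarr 5 (by decide) (by decide)]
    exact hM₃
  have h6₄ : ∀ i : Fin d, s₄.rarr 6 i 0 = ginvDir V M ⟨l, hl⟩ i := by
    rw [hF₄.rarr 6 (by decide) (by decide)]
    exact h₃'
  have h7₄ : s₄.rarr 7 0 0 = ginvDir V M ⟨l, hl⟩ ⬝ᵥ V.col ⟨l, hl⟩ := h₄ 0 0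
  rw [hstep]
  by_cases h0 : ginvDir V M ⟨l, hl⟩ ⬝ᵥ V.col ⟨l, hl⟩ = 0
  · refine runs_ite_true ?_ (runs_skip fun i j => ?_)
    · simp [BExp.eval, RExp.eval, NExp.eval, RExp.scalar, h7₄, h0]
    · simp [ginvStep, h0, hM₄]
  · refine runs_ite_false ?_ ((runs_fill_fin hdZ hdZ (Nat.zero_le Z) (by decide)
      (fun _ _ _ => 0) (fun i j => ginvStep V M ⟨l, hl⟩ i j) ?_ ?_ ?_ ?_ ?_).mono fun _ h => h.2)
    · simp only [BExp.eval, RExp.eval, NExp.eval, RExp.scalar, h7₄, Rat.cast_zero, not_and, not_lt,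
        not_le]
      exact fun h => lt_of_le_of_ne h (Ne.symm h0)
    · exact fun s' h => (h.nvar 0 (by decide) (by decide) (by decide)).trans hd₄
    · exact fun s' h => (h.nvar 0 (by decide) (by decide) (by decide)).trans hd₄
    · exact fun _ _ => rfl
    · exact fun _ _ _ l => l.elim0
    · intro s' i j h hi hj hcell _
      simp only [RExp.eval, NExp.eval, RExp.entry, RExp.coord, RExp.scalar, hi, hj, hcell]
      rw [h.rarr 6 (by decide) (by decide), h.rarr 7 (by decide) (by decide), hM₄, h6₄, h6₄, h7₄]
      simp [ginvStep, Matrix.vecMulVec_apply, div_eq_inv_mul]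

end LinearAlgebraPrograms

/-! ## The program for the design weights -/

section WeightsProgram

variable {ξ : Seed} {Y : ℕ → ℕ → ℝ} {Z d K : ℕ}

/-- The variables `0` and `1` and the array `1` contain the vectors `v`. -/
structure Loaded (v : Fin K → Fin d → ℝ) (s : State) : Prop where
  dim : s.nvar 0 = d
  card : s.nvar 1 = K
  vec : ∀ (k : Fin K) (j : Fin d), s.rarr 1 k j = v k j

theorem Loaded.of_fillFrame {v : Fin K → Fin d → ℝ} {out : ℕ} {s s' : State} (h : Loaded v s)
    (hF : FillFrame out s s') (hout : 1 ≠ out) : Loaded v s' :=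
  ⟨(hF.nvar 0 (by decide) (by decide) (by decide)).trans h.dim,
    (hF.nvar 1 (by decide) (by decide) (by decide)).trans h.card,
    by rw [hF.rarr 1 (by decide) hout]; exact h.vec⟩

theorem Loaded.of_frame {v : Fin K → Fin d → ℝ} {P : Prog} {s s' : State} (h : Loaded v s)
    (hF : Frame P s s') (h0 : 0 ∉ P.vars) (h1 : 1 ∉ P.vars) (ha : 1 ∉ P.realArrays) :
    Loaded v s' :=
  ⟨(hF.nvar 0 h0).trans h.dim, (hF.nvar 1 h1).trans h.card,
    by rw [hF.rarr 1 ha]; exact h.vec⟩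

/-- The first column of the array `a` contains the indicator function of `A`. -/
def StoresSet (a : ℕ) (A : Finset (Fin K)) (s : State) : Prop :=
  ∀ k : Fin K, s.rarr a k 0 = if k ∈ A then 1 else 0

theorem StoresSet.of_rarr {a : ℕ} {A : Finset (Fin K)} {s s' : State} (h : StoresSet a A s)
    (h' : s'.rarr a = s.rarr a) : StoresSet a A s' := by
  unfold StoresSet
  rw [h']
  exact h

/-- For the matrix `V` in the array `4`, the vectors `V⁻¹ v k` are written to the rows of the array
`10`. -/
def dualProg : Prog :=
  .seq ginvProg <|
  fill 10 (.var 1) (.var 0) (.var 0) (.mul (.entry 5 11 12) (.entry 1 10 12)) (.scalar 9)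

theorem runs_dualProg {s : State} {v : Fin K → Fin d → ℝ} (hv : Loaded v s) (hdZ : d ≤ Z)
    (hKZ : K ≤ Z) (hZ : 1 ≤ Z) (V : Matrix (Fin d) (Fin d) ℝ)
    (hV : ∀ i j : Fin d, s.rarr 4 i j = V i j) :
    Runs ξ Y Z dualProg s fun s' => ∀ (k : Fin K) (i : Fin d),
      s'.rarr 10 k i = (ginv V).mulVec (v k) i := by
  refine runs_seq ((runs_ginvProg hv.dim hdZ hZ V hV).frame.mono ?_)
  rintro s₂ ⟨hF₂, h₂⟩
  have hv₂ := hv.of_frame hF₂ (by decide) (by decide) (by decide)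
  refine (runs_fill_fin hKZ hdZ hdZ (by decide) (fun k i j => ginv V i j * v k j)
    (fun k i => (ginv V).mulVec (v k) i) ?_ ?_ ?_ ?_ ?_).mono fun _ h => h.2
  · exact fun s' h => (hv₂.of_fillFrame h (by decide)).card
  · exact fun s' h => (hv₂.of_fillFrame h (by decide)).dim
  · exact fun s' h => (hv₂.of_fillFrame h (by decide)).dim
  · intro s' k i j h hk hi hj _
    simp only [RExp.eval, NExp.eval, RExp.entry, hi, hj, hk]
    rw [h.rarr 5 (by decide) (by decide), h.rarr 1 (by decide) (by decide), h₂, hv₂.vec]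
  · intro s' k i h hk hi _ hsum
    exact hsum

/-- The leverages of the arms, for the weights in the array `3`, are written to the array `8`. -/
def leverageProg : Prog :=
  .seq (fill 4 (.var 0) (.var 0) (.var 1)
    (.mul (.mul (.coord 3 12) (.entry 1 12 10)) (.entry 1 12 11)) (.scalar 9)) <|
  .seq dualProg <|
  fill 8 (.var 1) (.const 1) (.var 0) (.mul (.entry 1 10 12) (.entry 10 10 12)) (.scalar 9)

theorem runs_leverageProg {s : State} {v : Fin K → Fin d → ℝ} (hv : Loaded v s) (hdZ : d ≤ Z)
    (hKZ : K ≤ Z) (hZ : 1 ≤ Z) (w : Fin K → ℝ) (hw : ∀ k : Fin K, s.rarr 3 k 0 = w k) :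
    Runs ξ Y Z leverageProg s fun s' => ∀ k : Fin K, s'.rarr 8 k 0 = leverage v w (v k) := by
  refine runs_seq ((runs_fill_fin hdZ hdZ hKZ (by decide) (fun i j k => w k * v k i * v k j)
    (fun i j => infoMatrix v w i j) ?_ ?_ ?_ ?_ ?_).mono ?_)
  · exact fun s' h => (hv.of_fillFrame h (by decide)).dim
  · exact fun s' h => (hv.of_fillFrame h (by decide)).dim
  · exact fun s' h => (hv.of_fillFrame h (by decide)).card
  · intro s' i j k h hi hj hk _
    simp only [RExp.eval, NExp.eval, RExp.entry, RExp.coord, hi, hj, hk]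
    rw [h.rarr 3 (by decide) (by decide), h.rarr 1 (by decide) (by decide), hw, hv.vec, hv.vec]
  · intro s' i j h hi hj _ hsum
    exact hsum.trans (infoMatrix_apply v w i j).symm
  rintro s₁ ⟨hF₁, h₁⟩
  have hv₁ := hv.of_fillFrame hF₁ (by decide)
  refine runs_seq ((runs_dualProg hv₁ hdZ hKZ hZ (infoMatrix v w) h₁).frame.mono ?_)
  rintro s₃ ⟨hF₃, h₃⟩
  have hv₃ := hv₁.of_frame hF₃ (by decide) (by decide) (by decide)
  refine (runs_fill_fin hKZ hZ hdZ (by decide)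
    (fun k _ i => v k i * (ginv (infoMatrix v w)).mulVec (v k) i)
    (fun k _ => leverage v w (v k)) ?_ ?_ ?_ ?_ ?_).mono fun s' h k => h.2 k 0
  · exact fun s' h => (hv₃.of_fillFrame h (by decide)).card
  · exact fun _ _ => rfl
  · exact fun s' h => (hv₃.of_fillFrame h (by decide)).dim
  · intro s' k i j h hk hi hj _
    simp only [RExp.eval, NExp.eval, RExp.entry, hj, hk]
    rw [h.rarr 10 (by decide) (by decide), h.rarr 1 (by decide) (by decide), h₃, hv₃.vec]
  · intro s' k i h hk hi _ hsum
    exact hsum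

/-- The step size `1 / (2 d)`. -/
def RExp.stepSize : RExp := .div (.const 1) (.mul (.const 2) (.ofNat (.var 0)))

/-- One step of the Frank-Wolfe algorithm on the weights in the array `3`. -/
def weightStepProg : Prog :=
  .seq leverageProg <|
  .seq (findFirst 16 17 (.var 1) (.and (.rlt (.const 0) (.coord 2 16))
    (.rlt (.mul (.const 4) (.ofNat (.var 0))) (.coord 8 16)))) <|
  .ite (.nlt (.var 17) (.var 1))
    (.seq (fill 3 (.var 1) (.const 1) (.const 0) (.const 0)
        (.mul (.sub (.const 1) .stepSize) (.coord 3 10)))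
      (.setReal 3 (.var 17) (.const 0) (.add (.coord 3 17) .stepSize)))
    .skip

/-- All weights are first scaled in place, then the selected arm receives 1/(2d). If no arm is in
excess, the search leaves K in variable 17 and the weights stay as they are. -/
theorem runs_weightStepProg {s : State} {v : Fin K → Fin d → ℝ} (hv : Loaded v s)
    {A : Finset (Fin K)} (hA : StoresSet 2 A s) (hdZ : d ≤ Z)
    (hKZ : K ≤ Z) (hZ : 1 ≤ Z) (w : Fin K → ℝ) (hw : ∀ k : Fin K, s.rarr 3 k 0 = w k) :
    Runs ξ Y Z weightStepProg s fun s' => ∀ k : Fin K, s'.rarr 3 k 0 = weightStep v A w k := by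
  refine runs_seq ((runs_leverageProg hv hdZ hKZ hZ w hw).frame.mono ?_)
  rintro s₁ ⟨hF₁, h₁⟩
  have hv₁ := hv.of_frame hF₁ (by decide) (by decide) (by decide)
  have hA₁ : StoresSet 2 A s₁ := by
    unfold StoresSet
    rw [hF₁.rarr 2 (by decide)]
    exact hA
  have hw₁ : ∀ k : Fin K, s₁.rarr 3 k 0 = w k := by
    rw [hF₁.rarr 3 (by decide)]
    exact hw
  refine runs_seq ((runs_findFirst (n := .var 1) (by decide) hKZ (excess v A w)
    (fun s' h => (hv₁.of_frame h (by decide) (by decide) (by decide)).card) ?_).frame.mono ?_)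
  · intro s' k h hk
    simp only [BExp.eval, RExp.eval, NExp.eval, RExp.coord, hk]
    rw [h.rarr 2 (by decide), h.rarr 8 (by decide), h.nvar 0 (by decide), hA₁ k, h₁, hv₁.dim]
    by_cases hkA : k ∈ A <;> simp [excess, hkA]
  rintro s₂ ⟨hF₂, h₂⟩
  have hv₂ := hv₁.of_frame hF₂ (by decide) (by decide) (by decide)
  have hw₂ : ∀ k : Fin K, s₂.rarr 3 k 0 = w k := by
    rw [hF₂.rarr 3 (by decide)]
    exact hw₁
  unfold weightStep
  by_cases hne : (excess v A w).Nonempty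
  · rw [dif_pos hne] at h₂ ⊢
    set m := (excess v A w).min' hne
    refine runs_ite_true ?_ (runs_seq ((runs_fill_fin hKZ hZ (Nat.zero_le Z) (by decide)
      (fun _ _ _ => 0) (fun k _ => (1 - 1 / (2 * d : ℝ)) * w k) ?_ ?_ ?_ ?_ ?_).mono ?_))
    · simp [BExp.eval, NExp.eval, h₂, hv₂.card]
    · exact fun s' h => (hv₂.of_fillFrame h (by decide)).card
    · exact fun _ _ => rfl
    · exact fun _ _ => rfl
    · exact fun _ _ _ l => l.elim0
    · intro s' k j h hk hj hcell _
      have hj0 : (j : ℕ) = 0 := by omega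
      rw [hj0] at hcell
      simp [RExp.eval, NExp.eval, RExp.coord, RExp.stepSize, hk, hcell, hw₂,
        (hv₂.of_fillFrame h (by decide)).dim]
    rintro s₃ ⟨hF₃, h₃⟩
    have hv₃ := hv₂.of_fillFrame hF₃ (by decide)
    have h17 : s₃.nvar 17 = m := (hF₃.nvar 17 (by decide) (by decide) (by decide)).trans h₂
    have h₃' : ∀ k : Fin K, s₃.rarr 3 k 0 = (1 - 1 / (2 * d : ℝ)) * w k := fun k => h₃ k 0
    refine runs_setReal fun k => ?_
    simp only [State.setReal, RExp.eval, NExp.eval, RExp.coord, RExp.stepSize, h17, hv₃.dim, h₃',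
      Function.update_self]
    by_cases hkm : k = m
    · subst hkm
      simp
    · have : (k : ℕ) ≠ m := fun h => hkm (Fin.ext h)
      simp [this, hkm, h₃']
  · rw [dif_neg hne] at h₂ ⊢
    refine runs_ite_false ?_ (runs_skip hw₂)
    simp [BExp.eval, NExp.eval, h₂, hv₂.card]

/-- The design weights for the arms in the array `2` are written to the array `3`. -/
def weightsProg : Prog :=
  .seq (fill 3 (.var 1) (.const 1) (.var 1) (.coord 2 12) (.div (.coord 2 10) (.scalar 9))) <|
  .seq (.setVar 18 (.const 0)) <|
  .seq (forLoop 13 (.var 0) (.setVar 18 (.add (.var 18) (.add (.var 1) (.var 1))))) <|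
  forLoop 13 (.var 18) weightStepProg

/-- Natural numbers cannot be multiplied on this machine, so the number 2dK of steps is accumulated
by adding 2K in a loop of length d. -/
theorem runs_weightsProg {s : State} {v : Fin K → Fin d → ℝ} (hv : Loaded v s)
    {A : Finset (Fin K)} (hA : StoresSet 2 A s) (hdZ : d ≤ Z) (hKZ : K ≤ Z) (hZ : 1 ≤ Z)
    (hdKZ : 2 * d * K ≤ Z) :
    Runs ξ Y Z weightsProg s fun s' => ∀ k : Fin K, s'.rarr 3 k 0 = designWeights v A k := by
  refine runs_seq ((runs_fill_fin hKZ hZ hKZ (by decide) (fun _ _ k => if k ∈ A then 1 else 0)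
    (fun k _ => uniformWeights A k) ?_ ?_ ?_ ?_ ?_).mono ?_)
  · exact fun s' h => (hv.of_fillFrame h (by decide)).card
  · exact fun _ _ => rfl
  · exact fun s' h => (hv.of_fillFrame h (by decide)).card
  · intro s' i j k h hi hj hk _
    simp only [RExp.eval, NExp.eval, RExp.coord, hk]
    exact hA.of_rarr (h.rarr 2 (by decide) (by decide)) k
  · intro s' k j h hk hj _ hsum
    simp only [RExp.eval, NExp.eval, RExp.coord, RExp.scalar, hk, hsum]
    rw [hA.of_rarr (h.rarr 2 (by decide) (by decide)) k]
    simp [uniformWeights, ite_div]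
  rintro s₁ ⟨hF₁, h₁⟩
  have hv₁ := hv.of_fillFrame hF₁ (by decide)
  have hA₁ := hA.of_rarr (hF₁.rarr 2 (by decide) (by decide))
  refine runs_seq (runs_setVar (runs_seq ?_))
  set s₂ := s₁.setVar 18 (NExp.eval s₁ (.const 0)) with hs₂
  have hv₂ : Loaded v s₂ := ⟨hv₁.dim, hv₁.card, hv₁.vec⟩
  refine (runs_forLoop (b := .var 0) hdZ (by decide)
    (fun s' h => (hv₂.of_frame h (by decide) (by decide) (by decide)).dim)
    (fun j s' => s'.nvar 18 = j * (2 * K)) ?_ ?_ ?_).frame.mono ?_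
  · intro j s' v h
    rw [← h]
    exact s'.nvar_setVar_of_ne (by decide) _
  · rw [zero_mul]
    exact s₁.nvar_setVar_self _ _
  · intro j s' _ hF _ hI
    have hcard := (hv₂.of_frame hF (by decide) (by decide) (by decide)).card
    refine runs_setVar ((s'.nvar_setVar_self _ _).trans ?_)
    simp only [NExp.eval, hI, hcard]
    ring
  rintro s₃ ⟨hF₃, h₃⟩
  have hv₃ := hv₂.of_frame hF₃ (by decide) (by decide) (by decide)
  have hA₃ : StoresSet 2 A s₃ :=
    StoresSet.of_rarr (s := s₂) hA₁ (hF₃.rarr 2 (by decide))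
  have hw₃ : ∀ k : Fin K, s₃.rarr 3 k 0 = uniformWeights A k := by
    rw [hF₃.rarr 3 (by decide)]
    exact fun k => h₁ k 0
  refine runs_forLoop (b := .var 18) hdKZ (by decide) ?_
    (fun n s' => ∀ k : Fin K, s'.rarr 3 k 0 = weightIter v A n k) (fun _ _ _ h => h) hw₃ ?_
  · intro s' h
    refine (h.nvar 18 (by decide)).trans (h₃.trans ?_)
    ring
  · intro n s' _ hF _ hI
    exact runs_weightStepProg (hv₃.of_frame hF (by decide) (by decide) (by decide))
      (hA₃.of_rarr (hF.rarr 2 (by decide))) hdZ hKZ hZ _ hI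

end WeightsProgram

/-! ## The program for one batch -/

section BatchProgram

variable {ξ : Seed} {Y : ℕ → ℕ → ℝ} {Z d K : ℕ}

/-- The variable `7` and the array `0` contain the length and the members of the list `L`. -/
structure StoresList (L : List (Fin K)) (s : State) : Prop where
  length : s.nvar 7 = L.length
  getElem : ∀ (j : ℕ) (h : j < L.length), s.narr 0 j = L[j]

theorem StoresList.of_frame {L : List (Fin K)} {P : Prog} {s s' : State} (h : StoresList L s)
    (hF : Frame P s s') (h7 : 7 ∉ P.vars) (ha : 0 ∉ P.natArrays) : StoresList L s' :=
  ⟨(hF.nvar 7 h7).trans h.length, by rw [hF.narr 0 ha]; exact h.getElem⟩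

theorem StoresList.of_fillFrame {L : List (Fin K)} {out : ℕ} {s s' : State} (h : StoresList L s)
    (hF : FillFrame out s s') : StoresList L s' :=
  ⟨(hF.nvar 7 (by decide) (by decide) (by decide)).trans h.length,
    by rw [hF.narr]; exact h.getElem⟩

/-- With the design weights in the array `3`, writes the list that contains each arm `k` as often
as its weight times the number in the array `27`, rounded up. -/
def listProg : Prog :=
  .seq (.setVar 7 (.const 0)) <|
  forLoop 8 (.var 1) <|
  .seq (.setVar 9 (.const 0)) <|
  .while (.rlt (.ofNat (.var 9)) (.mul (.coord 3 8) (.scalar 27))) <|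
  .seq (.setNat 0 (.var 7) (.var 8)) <|
  .seq (.setVar 7 (.add (.var 7) (.const 1))) (.setVar 9 (.add (.var 9) (.const 1)))

/-- Reals cannot be rounded on this machine either: ⌈w c⌉ is obtained as the number of increments
after which the counter is no longer below w c. -/
theorem runs_listProg {s : State} {v : Fin K → Fin d → ℝ} (hv : Loaded v s) (hKZ : K ≤ Z)
    {w : Fin K → ℝ} (hw : ∀ k : Fin K, s.rarr 3 k 0 = w k) {c : ℝ} (hc : s.rarr 27 0 0 = c)
    (hZ : ∀ k, ⌈w k * c⌉₊ ≤ Z) :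
    Runs ξ Y Z listProg s fun s' => StoresList
      ((List.finRange K).flatMap fun k => List.replicate ⌈w k * c⌉₊ k) s' := by
  set L : ℕ → List (Fin K) := fun j =>
    ((List.finRange K).take j).flatMap fun k => List.replicate ⌈w k * c⌉₊ k with hL
  have hLK : L K = (List.finRange K).flatMap fun k => List.replicate ⌈w k * c⌉₊ k := by
    rw [hL]
    simp only
    rw [List.take_of_length_le (by simp)]
  rw [← hLK]
  refine runs_seq (runs_setVar ?_)
  set s₁ := s.setVar 7 (NExp.eval s (.const 0)) with hs₁
  have hv₁ : Loaded v s₁ := ⟨hv.dim, hv.card, hv.vec⟩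
  refine runs_forLoop (b := .var 1) hKZ (by decide)
    (fun s' h => (hv₁.of_frame h (by decide) (by decide) (by decide)).card)
    (fun j s' => StoresList (L j) s') ?_ ?_ ?_
  · exact fun j s' v h => ⟨(s'.nvar_setVar_of_ne (by decide) _).trans h.length, h.getElem⟩
  · exact ⟨by simp [hs₁, s.nvar_setVar_self, hL, NExp.eval], by simp [hL]⟩
  · intro j s₂ hj hF₂ hj₂ hI
    have hLj : L (j + 1) = L j ++ List.replicate ⌈w ⟨j, hj⟩ * c⌉₊ ⟨j, hj⟩ := by
      rw [hL]
      simp only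
      rw [List.take_succ_eq_append_getElem (by simpa using hj), List.flatMap_append]
      simp
    have hw₂ : s₂.rarr 3 j 0 = w ⟨j, hj⟩ := by
      rw [hF₂.rarr 3 (by decide)]
      exact hw ⟨j, hj⟩
    have hc₂ : s₂.rarr 27 0 0 = c := by
      rw [hF₂.rarr 27 (by decide)]
      exact hc
    have heval : ∀ (s' : State) (n : ℕ), s'.nvar 9 = n → s'.nvar 8 = j → s'.rarr = s₂.rarr →
        (BExp.eval s' (.rlt (.ofNat (.var 9)) (.mul (.coord 3 8) (.scalar 27))) ↔
          n < ⌈w ⟨j, hj⟩ * c⌉₊) := by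
      intro s' n h9 h8 hr
      simp only [BExp.eval, RExp.eval, NExp.eval, RExp.coord, RExp.scalar, h8, h9, hr, hw₂, hc₂]
      exact Nat.lt_ceil.symm
    refine runs_seq (runs_setVar ((runs_while (fun n s' => s'.nvar 9 = n ∧ s'.nvar 8 = j ∧
      s'.rarr = s₂.rarr ∧ n ≤ ⌈w ⟨j, hj⟩ * c⌉₊ ∧
      StoresList (L j ++ List.replicate n ⟨j, hj⟩) s') ?_ ?_).mono ?_))
    · refine ⟨s₂.nvar_setVar_self _ _, (s₂.nvar_setVar_of_ne (by decide) _).trans hj₂, rfl,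
        Nat.zero_le _, ⟨?_, ?_⟩⟩
      · rw [s₂.nvar_setVar_of_ne (by decide)]
        simpa using hI.length
      · rw [List.replicate_zero, List.append_nil]
        exact hI.getElem
    · rintro n s' ⟨h9, h8, hr, hn, hS⟩ hb
      have hlt := (heval s' n h9 h8 hr).1 hb
      refine ⟨hlt.trans_le (hZ _), runs_seq (runs_setNat (runs_seq (runs_setVar (runs_setVar
        ⟨?_, ?_, hr, hlt, ?_, ?_⟩))))⟩
      · rw [State.nvar_setVar_self]
        simp only [NExp.eval]
        rw [State.nvar_setVar_of_ne _ (by decide)]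
        exact congrArg (· + 1) h9
      · rw [State.nvar_setVar_of_ne _ (by decide), State.nvar_setVar_of_ne _ (by decide)]
        exact h8
      · rw [State.nvar_setVar_of_ne _ (by decide), State.nvar_setVar_self]
        simp only [NExp.eval, State.setNat, hS.length]
        simp [add_assoc]
      · rw [List.replicate_succ', ← List.append_assoc]
        intro m hm
        have hlen : (L j ++ List.replicate n (⟨j, hj⟩ : Fin K)).length = s'.nvar 7 :=
          hS.length.symm
        simp only [State.setVar, State.setNat, NExp.eval, Function.update_self, h8]
        by_cases hm7 : m = s'.nvar 7
        · subst hm7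
          rw [Function.update_self, List.getElem_append_right hlen.le]
          simp
        · have hm' : m < (L j ++ List.replicate n (⟨j, hj⟩ : Fin K)).length := by
            rw [List.length_append, List.length_singleton] at hm
            omega
          rw [Function.update_of_ne hm7, List.getElem_append_left hm']
          exact hS.getElem m hm'
    · rintro s' ⟨⟨n, h9, h8, hr, hn, hS⟩, hb⟩
      rw [heval s' n h9 h8 hr] at hb
      rw [hLj]
      rwa [show n = ⌈w ⟨j, hj⟩ * c⌉₊ by omega] at hS

/-- Pulls the arms of the stored list and writes the rewards to the array `13`. -/
def pullsProg : Prog :=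
  forLoop 15 (.var 7) (.pull (.get 0 (.var 15)) 13 (.const 0) (.var 15))

theorem runs_pullsProg {s : State} {L : List (Fin K)} (hL : StoresList L s) (hZ : L.length ≤ Z) :
    Runs ξ Y Z pullsProg s fun s' => s'.pulls = s.pulls ++ L.map Fin.val ∧
      ∀ j : Fin L.length, s'.rarr 13 0 j = Y (s.pulls.length + j) L[j] := by
  refine (runs_forLoop (b := .var 7) hZ (by decide)
    (fun s' h => (hL.of_frame h (by decide) (by decide)).length)
    (fun n s' => s'.pulls = s.pulls ++ (L.take n).map Fin.val ∧
      ∀ j : Fin L.length, (j : ℕ) < n → s'.rarr 13 0 j = Y (s.pulls.length + j) L[j])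
    (fun _ _ _ h => h) (by simp) ?_).mono ?_
  · rintro n s₁ hn hF₁ h15 ⟨hp, hr⟩
    have hL₁ := hL.of_frame hF₁ (by decide) (by decide)
    refine runs_pull ⟨?_, ?_⟩
    · simp only [NExp.eval, h15, hL₁.getElem n hn, hp]
      rw [List.take_succ_eq_append_getElem hn, List.map_append, List.append_assoc]
      rfl
    · intro j hj
      simp only [State.setReal, NExp.eval, h15, hL₁.getElem n hn, hp, Function.update_self]
      by_cases hjn : (j : ℕ) = n
      · subst hjn
        rw [Function.update_self]
        simp [hn.le]
      · rw [Function.update_of_ne hjn]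
        exact hr j (by omega)
  · rintro s' ⟨hp, hr⟩
    exact ⟨by simpa using hp, fun j => hr j j.2⟩

/-- The coordinate with index in the variable `x` of the member of the stored list with index in
the variable `12`. -/
def RExp.listCoord (x : ℕ) : RExp := .get 1 (.get 0 (.var 12)) (.var x)

/-- With the rewards in the array `13`, the estimates of the means of all arms are written to the
array `16`. -/
def estimateProg : Prog :=
  .seq (fill 4 (.var 0) (.var 0) (.var 7) (.mul (.listCoord 10) (.listCoord 11)) (.scalar 9)) <|
  .seq dualProg <|
  .seq (fill 14 (.var 0) (.const 1) (.var 7)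
    (.mul (.get 13 (.const 0) (.var 12)) (.listCoord 10)) (.scalar 9)) <|
  fill 16 (.var 1) (.const 1) (.var 0) (.mul (.entry 10 10 12) (.coord 14 12)) (.scalar 9)

/-- The predictions are computed by the formula of `inner_lse`, without the estimate of the
parameter. The formula is evaluated for every arm, but it is identified with a least-squares
prediction only for active arms. -/
theorem runs_estimateProg {s : State} {arms : Fin K → E d}
    (hv : Loaded (fun k => (arms k).ofLp) s) {L : List (Fin K)} (hL : StoresList L s)
    (hdZ : d ≤ Z) (hKZ : K ≤ Z) (hZ : 1 ≤ Z) (hLZ : L.length ≤ Z) (y : Fin L.length → ℝ)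
    (hy : ∀ j : Fin L.length, s.rarr 13 0 j = y j) :
    Runs ξ Y Z estimateProg s fun s' => ∀ k : Fin K, s'.rarr 16 k 0 =
      ((ginv (gramMatrix fun j : Fin L.length => arms L[j])).mulVec (arms k).ofLp) ⬝ᵥ
        (∑ j : Fin L.length, y j • arms L[j]).ofLp := by
  set b : Fin L.length → E d := fun j => arms L[j] with hb
  have hlist : ∀ (s' : State) (j : Fin L.length) (x : ℕ) (i : Fin d),
      Loaded (fun k => (arms k).ofLp) s' → StoresList L s' → s'.nvar 12 = j → s'.nvar x = i →
        (RExp.listCoord x).eval s' = b j i := by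
    intro s' j x i hv' hL' h12 hx
    simp only [RExp.listCoord, RExp.eval, NExp.eval, h12, hx, hL'.getElem j j.2, hv'.vec]
    rfl
  refine runs_seq ((runs_fill_fin hdZ hdZ hLZ (by decide) (fun i j l => b l i * b l j)
    (fun i j => gramMatrix b i j) ?_ ?_ ?_ ?_ ?_).mono ?_)
  · exact fun s' h => (hv.of_fillFrame h (by decide)).dim
  · exact fun s' h => (hv.of_fillFrame h (by decide)).dim
  · exact fun s' h => (hL.of_fillFrame h).length
  · intro s' i j l h hi hj hl _
    have hv' := hv.of_fillFrame h (by decide)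
    have hL' := hL.of_fillFrame h
    rw [RExp.eval, hlist s' l 10 i hv' hL' hl hi, hlist s' l 11 j hv' hL' hl hj]
  · intro s' i j h hi hj _ hsum
    refine hsum.trans ?_
    simp [gramMatrix, infoMatrix_apply]
  rintro s₁ ⟨hF₁, h₁⟩
  have hv₁ := hv.of_fillFrame hF₁ (by decide)
  have hL₁ := hL.of_fillFrame hF₁
  refine runs_seq ((runs_dualProg hv₁ hdZ hKZ hZ (gramMatrix b) h₁).frame.mono ?_)
  rintro s₂ ⟨hF₂, h₂⟩
  have hv₂ := hv₁.of_frame hF₂ (by decide) (by decide) (by decide)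
  have hL₂ := hL₁.of_frame hF₂ (by decide) (by decide)
  have hy₂ : ∀ j : Fin L.length, s₂.rarr 13 0 j = y j := by
    rw [hF₂.rarr 13 (by decide), hF₁.rarr 13 (by decide) (by decide)]
    exact hy
  refine runs_seq ((runs_fill_fin hdZ hZ hLZ (by decide) (fun i _ l => y l * b l i)
    (fun i _ => (∑ j, y j • b j).ofLp i) ?_ ?_ ?_ ?_ ?_).mono ?_)
  · exact fun s' h => (hv₂.of_fillFrame h (by decide)).dim
  · exact fun _ _ => rfl
  · exact fun s' h => (hL₂.of_fillFrame h).length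
  · intro s' i j l h hi hj hl _
    rw [RExp.eval, hlist s' l 10 i (hv₂.of_fillFrame h (by decide)) (hL₂.of_fillFrame h) hl hi,
      ← hy₂]
    simp only [RExp.eval, NExp.eval, hl]
    rw [h.rarr 13 (by decide) (by decide)]
  · intro s' i j h hi hj _ hsum
    refine hsum.trans ?_
    rw [WithLp.ofLp_sum, Finset.sum_apply]
    rfl
  rintro s₃ ⟨hF₃, h₃⟩
  have hv₃ := hv₂.of_fillFrame hF₃ (by decide)
  have h₂' : ∀ (k : Fin K) (i : Fin d),
      s₃.rarr 10 k i = (ginv (gramMatrix b)).mulVec (arms k).ofLp i := by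
    rw [hF₃.rarr 10 (by decide) (by decide)]
    exact h₂
  refine (runs_fill_fin hKZ hZ hdZ (by decide)
    (fun k _ i => (ginv (gramMatrix b)).mulVec (arms k).ofLp i * (∑ j, y j • b j).ofLp i)
    (fun k _ => ((ginv (gramMatrix b)).mulVec (arms k).ofLp) ⬝ᵥ (∑ j, y j • b j).ofLp)
    ?_ ?_ ?_ ?_ ?_).mono fun s' h k => h.2 k 0
  · exact fun s' h => (hv₃.of_fillFrame h (by decide)).card
  · exact fun _ _ => rfl
  · exact fun s' h => (hv₃.of_fillFrame h (by decide)).dim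
  · intro s' k i j h hk hi hj _
    simp only [RExp.eval, NExp.eval, RExp.entry, RExp.coord, hj, hk]
    rw [h.rarr 10 (by decide) (by decide), h.rarr 14 (by decide) (by decide), h₂']
    exact congrArg _ (h₃ j 0)
  · intro s' k i h hk hi _ hsum
    exact hsum

/-- With the estimates in the array `16`, the accuracy in the array `23` and the threshold in the
array `26`, eliminates arms from the array `2`. -/
def eliminateProg : Prog :=
  .seq
    (forLoop 8 (.var 1)
      (.seq
        (findFirst 15 17 (.var 1) (.and (.rlt (.const 0) (.coord 2 15))
          (.rlt (.add (.coord 16 8) (.scalar 23)) (.sub (.coord 16 15) (.scalar 26)))))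
        (.ite (.and (.rlt (.const 0) (.coord 2 8)) (.not (.nlt (.var 17) (.var 1))))
          (.setReal 18 (.var 8) (.const 0) (.const 1))
          (.setReal 18 (.var 8) (.const 0) (.const 0)))))
    (fill 2 (.var 1) (.const 1) (.const 0) (.const 0) (.coord 18 10))

-- The survivors are collected in array 18 and copied to array 2 at the end, because all comparisons
-- must refer to the old active set. An active arm survives if the search for an arm that eliminates
-- it ends with the value K.
open Classical in
theorem runs_eliminateProg {s : State} {arms : Fin K → E d}
    (hv : Loaded (fun k => (arms k).ofLp) s) {A : Finset (Fin K)} (hA : StoresSet 2 A s)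
    (hKZ : K ≤ Z) (hZ : 1 ≤ Z) {θ : E d} {εt εb : ℝ}
    (hμ : ∀ k ∈ A, s.rarr 16 k 0 = inner ℝ (arms k) θ) (hεt : s.rarr 23 0 0 = εt)
    (hεb : s.rarr 26 0 0 = εb) :
    Runs ξ Y Z eliminateProg s fun s' => StoresSet 2 (survivors arms A θ εt εb) s' := by
  refine runs_seq ((runs_forLoop (b := .var 1) hKZ (by decide)
    (fun s' h => (hv.of_frame h (by decide) (by decide) (by decide)).card)
    (fun n s' => ∀ k : Fin K, (k : ℕ) < n →
      s'.rarr 18 k 0 = if k ∈ survivors arms A θ εt εb then 1 else 0)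
    (fun _ _ _ h => h) (by simp) ?_).frame.mono ?_)
  · intro n s₁ hn hF₁ h8 hI
    have hv₁ := hv.of_frame hF₁ (by decide) (by decide) (by decide)
    have hA₁ := hA.of_rarr (hF₁.rarr 2 (by decide))
    have hfr : ∀ a, a ≠ 18 → s₁.rarr a = s.rarr a := fun a ha =>
      hF₁.rarr a (by simp [forLoop, findFirst, Prog.realArrays, ha])
    refine runs_seq ((runs_findFirst (n := .var 1) (by decide) hKZ
      (A.filter fun b : Fin K => s.rarr 16 n 0 + εt < s.rarr 16 b 0 - εb)
      (fun s' h => (hv₁.of_frame h (by decide) (by decide) (by decide)).card) ?_).frame.mono ?_)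
    · intro s' k h hk
      have hr : s'.rarr = s₁.rarr :=
        funext fun a => h.rarr a (by simp [forLoop, findFirst, Prog.realArrays])
      simp only [BExp.eval, RExp.eval, NExp.eval, RExp.coord, RExp.scalar, hk, hr,
        (h.nvar 8 (by decide)).trans h8]
      rw [hA₁ k, hfr 16 (by decide), hfr 23 (by decide), hfr 26 (by decide), hεt, hεb]
      by_cases hkA : k ∈ A <;> simp [hkA]
    · rintro s₂ ⟨hF₂, h₂⟩
      have hv₂ := hv₁.of_frame hF₂ (by decide) (by decide) (by decide)
      have hA₂ := hA₁.of_rarr (hF₂.rarr 2 (by decide))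
      have h8₂ : s₂.nvar 8 = n := (hF₂.nvar 8 (by decide)).trans h8
      have h18 : s₂.rarr 18 = s₁.rarr 18 := hF₂.rarr 18 (by decide)
      have hcond : BExp.eval s₂ (.and (.rlt (.const 0) (.coord 2 8))
          (.not (.nlt (.var 17) (.var 1)))) ↔ (⟨n, hn⟩ : Fin K) ∈ survivors arms A θ εt εb := by
        have hact := hA₂ ⟨n, hn⟩
        simp only at hact
        simp only [BExp.eval, RExp.eval, NExp.eval, RExp.coord, h8₂, hact, h₂, hv₂.card]
        by_cases hnA : (⟨n, hn⟩ : Fin K) ∈ A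
        · have hempty : (¬ (if h : (A.filter fun b : Fin K =>
              s.rarr 16 n 0 + εt < s.rarr 16 b 0 - εb).Nonempty then
              ((Finset.min' _ h : Fin K) : ℕ) else K) < K) ↔ ¬ (A.filter fun b : Fin K =>
              s.rarr 16 n 0 + εt < s.rarr 16 b 0 - εb).Nonempty := by
            split_ifs with h
            · simp [h]
            · simp [h]
          rw [hempty]
          have hμn := hμ _ hnA
          simp only at hμn
          simp only [hnA, if_true, Rat.cast_zero, zero_lt_one, true_and, survivors,
            Finset.mem_filter, Finset.filter_nonempty_iff, hμn]
          refine not_congr (exists_congr fun b => and_congr_right fun hb => ?_)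
          rw [hμ b hb]
        · simp [hnA, survivors]
      by_cases hin : (⟨n, hn⟩ : Fin K) ∈ survivors arms A θ εt εb
      · refine runs_ite_true (hcond.2 hin) (runs_setReal fun k hk => ?_)
        simp only [State.setReal, RExp.eval, NExp.eval, h8₂, Function.update_self]
        by_cases hkn : (k : ℕ) = n
        · rw [show k = ⟨n, hn⟩ from Fin.ext hkn]
          simp [hin]
        · rw [Function.update_of_ne hkn, h18]
          exact hI k (by omega)
      · refine runs_ite_false (mt hcond.1 hin) (runs_setReal fun k hk => ?_)
        simp only [State.setReal, RExp.eval, NExp.eval, h8₂, Function.update_self]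
        by_cases hkn : (k : ℕ) = n
        · rw [show k = ⟨n, hn⟩ from Fin.ext hkn]
          simp [hin]
        · rw [Function.update_of_ne hkn, h18]
          exact hI k (by omega)
  · rintro s₁ ⟨hF₁, h₁⟩
    have hv₁ := hv.of_frame hF₁ (by decide) (by decide) (by decide)
    refine (runs_fill_fin hKZ hZ (Nat.zero_le Z) (by decide) (fun _ _ _ => 0)
      (fun k _ => if k ∈ survivors arms A θ εt εb then 1 else 0) ?_ ?_ ?_ ?_ ?_).mono
      fun s' h k => h.2 k 0
    · exact fun s' h => (hv₁.of_fillFrame h (by decide)).card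
    · exact fun _ _ => rfl
    · exact fun _ _ => rfl
    · exact fun _ _ _ l => l.elim0
    · intro s' k j h hk hj _ _
      simp only [RExp.eval, NExp.eval, RExp.coord, hk]
      rw [h.rarr 18 (by decide) (by decide)]
      exact h₁ k k.2

end BatchProgram

/-! ## The program for the algorithm -/

section MainProgram

variable {ξ : Seed} {Y : ℕ → ℕ → ℝ} {Z d K T : ℕ} {ρ : ℝ} {arms : Fin K → E d}

theorem State.scalar_setReal (s : State) (a b : ℕ) (v : ℝ) :
    (s.setReal a 0 0 v).rarr b 0 0 = if b = a then v else s.rarr b 0 0 := by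
  split_ifs with h
  · subst h
    simp [State.setReal]
  · simp [State.setReal, h]

theorem State.rarr_setReal_of_ne (s : State) {a b : ℕ} (h : b ≠ a) (i j : ℕ) (v : ℝ) :
    (s.setReal a i j v).rarr b = s.rarr b :=
  Function.update_of_ne h _ _

/-- Computes the accuracy (array `23`), the scale of the threshold (array `24`) and the factor by
which the design weights are multiplied (array `27`). -/
def scalesProg : Prog :=
  .seq (.setReal 23 (.const 0) (.const 0) (.sqrt (.div (.mul (.ofNat (.var 0)) (.scalar 20))
    (.mul (.ofNat (.var 4)) (.scalar 22))))) <|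
  .seq (.setReal 24 (.const 0) (.const 0) (.sqrt (.div (.mul (.ofNat (.var 0)) (.scalar 20))
    (.scalar 22))))
  (.setReal 27 (.const 0) (.const 0) (.mul (.const 16)
    (.div (.mul (.ofNat (.var 0)) (.scalar 20)) (.mul (.scalar 23) (.scalar 23)))))

theorem runs_scalesProg (s : State) (i : ℕ) (hd : s.nvar 0 = d) (hβ : s.nvar 4 = blowup 5000 K ρ)
    (hL : s.rarr 20 0 0 = logFactor K T) (hq : s.rarr 22 0 0 = growth 1 T ^ i) :
    Runs ξ Y Z scalesProg s fun s' => s'.rarr 23 0 0 = epsTilde 1 5000 d K T ρ i ∧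
      s'.rarr 24 0 0 = eps 1 d K T i ∧
      s'.rarr 27 0 0 =
        16 * (d * Real.log (1 / delta K T) / epsTilde 1 5000 d K T ρ i ^ 2) := by
  refine runs_seq (runs_setReal (runs_seq (runs_setReal (runs_setReal ?_))))
  simp only [RExp.eval, NExp.eval, RExp.scalar, State.scalar_setReal]
  simp only [State.setReal, hd, hβ, hL, hq, log_one_div_delta]
  norm_num [epsTilde, eps, logFactor, sq]

/-- Computes the design multiset of the coming batch. -/
def designProg : Prog := .seq scalesProg (.seq weightsProg listProg)

/-- Bounds the inner counting loop of `listProg` by the length of the whole list. -/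
theorem designCount_le_length (i : ℕ) (A : Finset (Fin K)) (k : Fin K) :
    ⌈designWeights (fun k => (arms k).ofLp) A k * (16 * (d * Real.log (1 / delta K T) /
      epsTilde 1 5000 d K T ρ (i + 1) ^ 2))⌉₊ ≤
      (batchList designRule 1 5000 T ρ arms i A).length := by
  have h := length_designRule arms A (epsTilde 1 5000 d K T ρ (i + 1)) (delta K T)
  rw [batchList, h]
  exact Finset.single_le_sum (f := fun k => designCount arms A
    (epsTilde 1 5000 d K T ρ (i + 1)) (delta K T) k) (fun _ _ => Nat.zero_le _) (Finset.mem_univ k)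

theorem runs_designProg {s : State} (hv : Loaded (fun k => (arms k).ofLp) s)
    {A : Finset (Fin K)} (hA : StoresSet 2 A s) (i : ℕ) (hβ : s.nvar 4 = blowup 5000 K ρ)
    (hlog : s.rarr 20 0 0 = logFactor K T) (hq : s.rarr 22 0 0 = growth 1 T ^ (i + 1))
    (hdZ : d ≤ Z) (hKZ : K ≤ Z) (hZ : 1 ≤ Z) (hdKZ : 2 * d * K ≤ Z)
    (hLZ : (batchList designRule 1 5000 T ρ arms i A).length ≤ Z) :
    Runs ξ Y Z designProg s fun s' =>
      StoresList (batchList designRule 1 5000 T ρ arms i A) s' ∧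
      s'.rarr 23 0 0 = epsTilde 1 5000 d K T ρ (i + 1) ∧
      s'.rarr 24 0 0 = eps 1 d K T (i + 1) := by
  refine runs_seq ((runs_scalesProg (T := T) (ρ := ρ) s (i + 1) hv.dim hβ hlog hq).frame.mono ?_)
  rintro s₁ ⟨hF₁, h23, h24, h27⟩
  have hv₁ := hv.of_frame hF₁ (by decide) (by decide) (by decide)
  have hA₁ := hA.of_rarr (hF₁.rarr 2 (by decide))
  refine runs_seq ((runs_weightsProg hv₁ hA₁ hdZ hKZ hZ hdKZ).frame.mono ?_)
  rintro s₂ ⟨hF₂, h₂⟩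
  have hv₂ := hv₁.of_frame hF₂ (by decide) (by decide) (by decide)
  refine (runs_listProg hv₂ hKZ h₂ (by rw [hF₂.rarr 27 (by decide)]; exact h27)
    fun k => (designCount_le_length i A k).trans hLZ).frame.mono ?_
  rintro s₃ ⟨hF₃, h₃⟩
  refine ⟨h₃, ?_, ?_⟩
  · rw [hF₃.rarr 23 (by decide), hF₂.rarr 23 (by decide), h23]
  · rw [hF₃.rarr 24 (by decide), hF₂.rarr 24 (by decide), h24]

/-- Pulls the arms of the design multiset, estimates the means and eliminates arms. -/
def learnProg : Prog :=
  .seq pullsProg <|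
  .seq estimateProg <|
  .seq (.rand 25 (.const 0) (.const 0)) <|
  .seq (.setReal 26 (.const 0) (.const 0) (.add (.div (.scalar 24) (.const 2))
    (.mul (.scalar 25) (.div (.scalar 24) (.const 2)))))
  eliminateProg

/-- The design property enters to identify the computed numbers with least-squares predictions on
the active arms. One random number is drawn per completed batch, so the entry read here is ξ i. -/
theorem runs_learnProg {s : State} (hv : Loaded (fun k => (arms k).ofLp) s)
    {A : Finset (Fin K)} (hA : StoresSet 2 A s) {i t : ℕ}
    (hL : StoresList (batchList designRule 1 5000 T ρ arms i A) s)
    (h23 : s.rarr 23 0 0 = epsTilde 1 5000 d K T ρ (i + 1))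
    (h24 : s.rarr 24 0 0 = eps 1 d K T (i + 1)) (hused : s.used = i) (ht : s.pulls.length = t)
    (hdes : IsDesignMultiset 16 17 arms A (epsTilde 1 5000 d K T ρ (i + 1)) (delta K T)
      (batchList designRule 1 5000 T ρ arms i A))
    (hdZ : d ≤ Z) (hKZ : K ≤ Z) (hZ : 1 ≤ Z)
    (hLZ : (batchList designRule 1 5000 T ρ arms i A).length ≤ Z) :
    Runs ξ Y Z learnProg s fun s' =>
      StoresSet 2 (batchSurvivors designRule 1 5000 T ρ arms ξ (fun t k => Y t k) i A t) s' ∧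
      s'.pulls = s.pulls ++ (batchList designRule 1 5000 T ρ arms i A).map Fin.val ∧
      s'.used = i + 1 := by
  set L := batchList designRule 1 5000 T ρ arms i A with hLdef
  refine runs_seq ((runs_pullsProg hL hLZ).frame.mono ?_)
  rintro s₁ ⟨hF₁, hp₁, hy₁⟩
  have hv₁ := hv.of_frame hF₁ (by decide) (by decide) (by decide)
  have hA₁ := hA.of_rarr (hF₁.rarr 2 (by decide))
  have hL₁ := hL.of_frame hF₁ (by decide) (by decide)
  refine runs_seq ((runs_estimateProg hv₁ hL₁ hdZ hKZ hZ hLZ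
    (fun j => Y (s.pulls.length + j) L[j]) hy₁).frame.mono ?_)
  rintro s₂ ⟨hF₂, hμ₂⟩
  have hv₂ := hv₁.of_frame hF₂ (by decide) (by decide) (by decide)
  have hA₂ := hA₁.of_rarr (hF₂.rarr 2 (by decide))
  have hused₂ : s₂.used = i := (hF₂.used (by decide)).trans ((hF₁.used (by decide)).trans hused)
  have h23₂ : s₂.rarr 23 0 0 = epsTilde 1 5000 d K T ρ (i + 1) := by
    rw [hF₂.rarr 23 (by decide), hF₁.rarr 23 (by decide), h23]
  have h24₂ : s₂.rarr 24 0 0 = eps 1 d K T (i + 1) := by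
    rw [hF₂.rarr 24 (by decide), hF₁.rarr 24 (by decide), h24]
  have hμ : ∀ k ∈ A, s₂.rarr 16 k 0 =
      inner ℝ (arms k) (batchEstimate designRule 1 5000 T ρ arms (fun t k => Y t k) i A t) := by
    intro k hk
    rw [hμ₂ k, batchEstimate]
    have hdk := hdes.design k hk
    rw [← ofFn_batchList] at hdk
    rw [inner_lse hdk, ht]
  refine runs_seq (runs_rand (runs_seq (runs_setReal ?_)))
  refine Runs.mono (Runs.frame (runs_eliminateProg (εt := epsTilde 1 5000 d K T ρ (i + 1))
    (εb := threshold 1 T d K ξ i) (arms := arms) (A := A)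
    (θ := batchEstimate designRule 1 5000 T ρ arms (fun t k => Y t k) i A t)
    ?_ ?_ hKZ hZ ?_ ?_ ?_)) ?_
  · exact ⟨hv₂.dim, hv₂.card, hv₂.vec⟩
  · exact hA₂
  · exact hμ
  · simpa [State.setReal] using h23₂
  · simp [State.setReal, RExp.eval, NExp.eval, RExp.scalar, threshold, h24₂, hused₂]
  · rintro s₃ ⟨hF₃, h₃⟩
    refine ⟨h₃, ?_, ?_⟩
    · exact (hF₃.pulls (by decide)).trans ((hF₂.pulls (by decide)).trans hp₁)
    · exact (hF₃.used (by decide)).trans (congrArg (· + 1) hused₂)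

/-- One batch: computes the design multiset, ends the loop if it does not fit into the remaining
rounds, and executes the batch otherwise. -/
def batchProg : Prog :=
  .seq designProg <|
  .ite (.nlt (.var 6) (.var 7)) (.setVar 5 (.var 3)) <|
  .seq learnProg <|
  .seq (.setVar 6 (.sub (.var 6) (.var 7))) <|
  .seq (.setVar 5 (.add (.var 5) (.const 1)))
  (.setReal 22 (.const 0) (.const 0) (.mul (.scalar 22) (.scalar 21)))

/-- The part of the invariant of the main loop that holds also after the loop is left early: `A`
is the set of active arms and `t` is the number of completed rounds. -/
structure MainInv (T : ℕ) (ρ : ℝ) (arms : Fin K → E d) (arm : ℕ → Fin K) (A : Finset (Fin K))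
    (t : ℕ) (s : State) : Prop where
  nonempty : A.Nonempty
  le : t ≤ T
  loaded : Loaded (fun k => (arms k).ofLp) s
  numBatches : s.nvar 3 = numBatches T
  remaining : s.nvar 6 = T - t
  active : StoresSet 2 A s
  pulls : s.pulls = (List.range t).map fun n => (arm n : ℕ)

/-- The invariant of the main loop after `j` iterations. -/
def LoopInv [NeZero K] (T : ℕ) (ρ : ℝ) (arms : Fin K → E d) (ξ : Seed) (Y : ℕ → Fin K → ℝ)
    (arm : ℕ → Fin K) (j : ℕ) (s : State) : Prop :=
  ∃ A t, MainInv T ρ arms arm A t s ∧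
    ((s.nvar 5 = numBatches T ∧ ∀ n, t ≤ n → arm n = firstArm A) ∨
      (s.nvar 5 = j ∧ j ≤ numBatches T - 1 ∧ s.used = j ∧ s.nvar 4 = blowup 5000 K ρ ∧
        (2 ≤ numBatches T → s.rarr 20 0 0 = logFactor K T ∧ s.rarr 21 0 0 = growth 1 T ∧
          s.rarr 22 0 0 = growth 1 T ^ (j + 1)) ∧
        ∀ n, t ≤ n → arm n =
          batchArm designRule 1 5000 T ρ arms ξ Y (numBatches T - 1 - j) j A t n))

/-- If the batch does not fit, the loop is left by setting the counter to B, which falsifies the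
guard. This is the first alternative of `LoopInv`. -/
theorem runs_batchProg [NeZero K] (hd : 1 ≤ d) (hρ : 0 < ρ) (hρ1 : ρ ≤ 1)
    (harms : ∀ k, ‖arms k‖ ≤ 1) (hdZ : d ≤ Z) (hKZ : K ≤ Z) (hdKZ : 2 * d * K ≤ Z)
    (hLZ : ∀ i < numBatches T - 1, ∀ A : Finset (Fin K), A.Nonempty →
      (batchList designRule 1 5000 T ρ arms i A).length ≤ Z)
    {arm : ℕ → Fin K} {j : ℕ} {s : State} (hs : LoopInv T ρ arms ξ (fun t k => Y t k) arm j s)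
    (hb : s.nvar 5 + 1 < s.nvar 3) :
    Runs ξ Y Z batchProg s (LoopInv T ρ arms ξ (fun t k => Y t k) arm (j + 1)) := by
  have hK : 1 ≤ K := Nat.one_le_iff_ne_zero.2 (NeZero.ne K)
  have hZ : 1 ≤ Z := hd.trans hdZ
  obtain ⟨A, t, hI, ⟨h5, -⟩ | ⟨h5, -, hused, hβ, hscal, harm⟩⟩ := hs
  · rw [h5, hI.numBatches] at hb
    omega
  rw [h5, hI.numBatches] at hb
  obtain ⟨hlog, hq, hqj⟩ := hscal (by omega)
  have hlen := hLZ j (by omega) A hI.nonempty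
  have hdes := (validBatches hd hK hρ hρ1 harms T j (by omega) A hI.nonempty).2
  -- Exhibits a successor, so that `batchArm` unfolds by one batch.
  have hB : numBatches T - 1 - j = (numBatches T - 1 - (j + 1)) + 1 := by omega
  set L := batchList designRule 1 5000 T ρ arms j A with hL
  refine runs_seq ((runs_designProg hI.loaded hI.active j hβ hlog hqj hdZ hKZ hZ hdKZ
    hlen).frame.mono ?_)
  rintro s₁ ⟨hF₁, hL₁, h23, h24⟩
  have hv₁ := hI.loaded.of_frame hF₁ (by decide) (by decide) (by decide)
  have hA₁ := hI.active.of_rarr (hF₁.rarr 2 (by decide))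
  have h3₁ : s₁.nvar 3 = numBatches T := (hF₁.nvar 3 (by decide)).trans hI.numBatches
  have h6₁ : s₁.nvar 6 = T - t := (hF₁.nvar 6 (by decide)).trans hI.remaining
  have hp₁ : s₁.pulls = (List.range t).map fun n => (arm n : ℕ) :=
    (hF₁.pulls (by decide)).trans hI.pulls
  by_cases hr : T - t < L.length
  · refine runs_ite_true ?_ (runs_setVar ⟨A, t, ⟨hI.nonempty, hI.le, ⟨hv₁.dim, hv₁.card, hv₁.vec⟩,
      ?_, ?_, hA₁, hp₁⟩, Or.inl ⟨?_, fun n hn => ?_⟩⟩)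
    · simpa [BExp.eval, NExp.eval, h6₁, hL₁.length] using hr
    · rwa [State.nvar_setVar_of_ne _ (by decide)]
    · rwa [State.nvar_setVar_of_ne _ (by decide)]
    · rw [State.nvar_setVar_self]
      exact h3₁
    · rw [harm n hn, hB, batchArm, if_pos hr]
  refine runs_ite_false ?_ (runs_seq ((runs_learnProg (t := t) hv₁ hA₁ hL₁ h23 h24
    ((hF₁.used (by decide)).trans hused) (by simp [hp₁]) hdes hdZ hKZ hZ hlen).frame.mono ?_))
  · simpa [BExp.eval, NExp.eval, h6₁, hL₁.length] using hr
  rintro s₂ ⟨hF₂, hA₂, hp₂, hused₂⟩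
  have hv₂ := hv₁.of_frame hF₂ (by decide) (by decide) (by decide)
  have harm' : ∀ n, t ≤ n → arm n = if h : n - t < L.length then L[n - t] else
      batchArm designRule 1 5000 T ρ arms ξ (fun t k => Y t k) (numBatches T - 1 - (j + 1)) (j + 1)
        (batchSurvivors designRule 1 5000 T ρ arms ξ (fun t k => Y t k) j A t)
        (t + L.length) n := by
    intro n hn
    rw [harm n hn, hB, batchArm, if_neg hr]
  refine runs_seq (runs_setVar (runs_seq (runs_setVar (runs_setReal ⟨_, t + L.length,
    ⟨batchSurvivors_nonempty ξ (fun t k => Y t k) j hI.nonempty t, by have := hI.le; omega,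
      ⟨hv₂.dim, hv₂.card, hv₂.vec⟩, ?_, ?_, hA₂, ?_⟩,
    Or.inr ⟨?_, by omega, hused₂, ?_, fun _ => ⟨?_, ?_, ?_⟩, fun n hn => ?_⟩⟩))))
  · exact (hF₂.nvar 3 (by decide)).trans h3₁
  · have h6₂ : s₂.nvar 6 = T - t := (hF₂.nvar 6 (by decide)).trans h6₁
    have h7₂ : s₂.nvar 7 = (batchList designRule 1 5000 T ρ arms j A).length :=
      (hF₂.nvar 7 (by decide)).trans hL₁.length
    simp [State.setReal, State.setVar, NExp.eval, h6₂, h7₂, Nat.sub_sub]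
    rfl
  · refine hp₂.trans ?_
    rw [hp₁, List.range_add, List.map_append, List.map_map]
    congr 1
    refine List.ext_getElem (by simp [hL]) fun m h1 h2 => ?_
    have hm : m < L.length := by simpa using h1
    simp [harm' (t + m) (Nat.le_add_right _ _), hm]
    rfl
  · have h5₂ : s₂.nvar 5 = j :=
      (hF₂.nvar 5 (by decide)).trans ((hF₁.nvar 5 (by decide)).trans h5)
    simp [State.setReal, State.setVar, NExp.eval, h5₂]
  · exact (hF₂.nvar 4 (by decide)).trans ((hF₁.nvar 4 (by decide)).trans hβ)
  · rw [State.rarr_setReal_of_ne _ (by decide)]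
    change s₂.rarr 20 0 0 = _
    rw [hF₂.rarr 20 (by decide), hF₁.rarr 20 (by decide), hlog]
  · rw [State.rarr_setReal_of_ne _ (by decide)]
    change s₂.rarr 21 0 0 = _
    rw [hF₂.rarr 21 (by decide), hF₁.rarr 21 (by decide), hq]
  · have h21₂ : s₂.rarr 21 0 0 = growth 1 T := by
      rw [hF₂.rarr 21 (by decide), hF₁.rarr 21 (by decide), hq]
    have h22₂ : s₂.rarr 22 0 0 = growth 1 T ^ (j + 1) := by
      rw [hF₂.rarr 22 (by decide), hF₁.rarr 22 (by decide), hqj]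
    simp [State.setReal, State.setVar, RExp.eval, NExp.eval, RExp.scalar, h21₂, h22₂, pow_succ]
  · rw [harm' n (by omega), dif_neg (by omega)]

/-- The maximum of `1` and the horizon. -/
def NExp.horizon : NExp := .add (.var 2) (.sub (.const 1) (.var 2))

/-- Computes the number of batches, the blow-up factor and the constants of the main loop. -/
def initProg : Prog :=
  .seq (.setVar 3 (.const 0)) <|
  .seq (.while (.rlt (.ofNat (.var 3)) (.log (.ofNat .horizon)))
    (.setVar 3 (.add (.var 3) (.const 1)))) <|
  .seq (.setVar 4 (.const 0)) <|
  .seq (.while (.not (.rlt (.mul (.const 5000) (.div (.mul (.ofNat (.var 1)) (.ofNat (.var 1)))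
      (.mul (.scalar 0) (.scalar 0)))) (.ofNat (.add (.var 4) (.const 1)))))
    (.setVar 4 (.add (.var 4) (.const 1)))) <|
  .seq (.setVar 5 (.const 0)) <|
  .seq (.setVar 6 (.var 2)) <|
  .seq (fill 2 (.var 1) (.const 1) (.const 0) (.const 0) (.const 1)) <|
  .seq (.setReal 20 (.const 0) (.const 0)
    (.log (.mul (.ofNat (.var 1)) (.mul (.ofNat .horizon) (.ofNat .horizon))))) <|
  .seq (.setReal 21 (.const 0) (.const 0) (.exp (.div (.log (.ofNat .horizon))
    (.ofNat (.add (.var 3) (.sub (.const 1) (.var 3))))))) <|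
  .setReal 22 (.const 0) (.const 0) (.scalar 21)

/-- By truncated subtraction T + (1 - T) is max(T, 1). For T = 0 this is consistent because of the
default value log 0 = 0 = log 1. -/
theorem log_cast_horizon (T : ℕ) : Real.log ((T + (1 - T) : ℕ) : ℝ) = Real.log T := by
  rcases Nat.eq_zero_or_pos T with rfl | h
  · simp
  · rw [Nat.sub_eq_zero_of_le h, add_zero]

/-- As K²/ρ² ≥ 1 and 5000 > 2304, the program need not compute the maximum. -/
theorem blowup_eq_floor (hK : 1 ≤ K) (hρ : 0 < ρ) (hρ1 : ρ ≤ 1) :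
    blowup 5000 K ρ = ⌊(5000 : ℝ) * ((K : ℝ) ^ 2 / ρ ^ 2)⌋₊ := by
  rw [blowup, max_eq_left]
  have := one_le_sq_div_sq hK hρ hρ1
  linarith

/-- The final pulls of the active arm with the smallest index. -/
def exploitProg : Prog :=
  .seq (findFirst 8 17 (.var 1) (.rlt (.const 0) (.coord 2 8)))
    (forLoop 15 (.var 6) (.pull (.var 17) 13 (.const 0) (.const 0)))

/-- The batched elimination algorithm. -/
def banditProg : Prog :=
  .seq initProg <|
  .seq (.while (.nlt (.add (.var 5) (.const 1)) (.var 3)) batchProg) exploitProg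

/-- B and β are again found by counting: B is the first n with log T ≤ n, and β the last n with n ≤
5000 K²/ρ². -/
theorem runs_initProg [NeZero K] (hρ : 0 < ρ) (hρ1 : ρ ≤ 1) (hKZ : K ≤ Z)
    (hBZ : numBatches T ≤ Z) (hβZ : blowup 5000 K ρ ≤ Z) :
    Runs ξ Y Z initProg (initState T ρ arms) (LoopInv T ρ arms ξ (fun t k => Y t k)
      ((batchedElimination designRule 1 5000 T ρ arms).arm ξ (fun t k => Y t k)) 0) := by
  have hK : 1 ≤ K := Nat.one_le_iff_ne_zero.2 (NeZero.ne K)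
  set s₀ := initState T ρ arms with hs₀
  refine runs_seq (runs_setVar (runs_seq ((runs_while (fun n s => s.nvar 3 = n ∧
    n ≤ numBatches T ∧ s = s₀.setVar 3 n) ⟨s₀.nvar_setVar_self _ _, Nat.zero_le _, rfl⟩
    ?_).mono ?_)))
  · rintro n s ⟨h3, hn, rfl⟩ hb
    have hlt : n < numBatches T := by
      have h2 : (s₀.setVar 3 n).nvar 2 = T := rfl
      simp only [BExp.eval, RExp.eval, NExp.eval, NExp.horizon, h3, h2, log_cast_horizon] at hb
      exact Nat.lt_ceil.2 hb
    refine ⟨hlt.trans_le hBZ, runs_setVar ⟨State.nvar_setVar_self _ _ _ |>.trans ?_, hlt, ?_⟩⟩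
    · simp [NExp.eval, h3]
    · simp [NExp.eval, State.setVar]
  rintro s₁ ⟨⟨n, h3, hn, rfl⟩, hb⟩
  have hnB : n = numBatches T := by
    have h2 : (s₀.setVar 3 n).nvar 2 = T := rfl
    simp only [BExp.eval, RExp.eval, NExp.eval, NExp.horizon, h3, h2, log_cast_horizon,
      not_lt] at hb
    exact le_antisymm hn (Nat.ceil_le.2 hb)
  subst hnB
  set s₁ := s₀.setVar 3 (numBatches T) with hs₁
  have hx : (0 : ℝ) ≤ 5000 * ((K : ℝ) ^ 2 / ρ ^ 2) := by positivity
  have htest : ∀ n, BExp.eval (s₁.setVar 4 n) (.not (.rlt (.mul (.const 5000)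
      (.div (.mul (.ofNat (.var 1)) (.ofNat (.var 1))) (.mul (.scalar 0) (.scalar 0))))
      (.ofNat (.add (.var 4) (.const 1))))) ↔ n < blowup 5000 K ρ := by
    intro n
    have h1 : (s₁.setVar 4 n).nvar 1 = K := rfl
    have h4 : (s₁.setVar 4 n).nvar 4 = n := State.nvar_setVar_self _ _ _
    have h0 : (s₁.setVar 4 n).rarr 0 0 0 = ρ := rfl
    simp only [BExp.eval, RExp.eval, NExp.eval, RExp.scalar, h1, h4, h0, not_lt]
    rw [blowup_eq_floor hK hρ hρ1, ← Nat.succ_le_iff, Nat.le_floor_iff hx]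
    simp [sq]
  refine runs_seq (runs_setVar (runs_seq ((runs_while (fun n s =>
    n ≤ blowup 5000 K ρ ∧ s = s₁.setVar 4 n) ⟨Nat.zero_le _, rfl⟩ ?_).mono ?_)))
  · rintro n s ⟨hn, rfl⟩ hb
    have hlt := (htest n).1 hb
    refine ⟨hlt.trans_le hβZ, runs_setVar ⟨hlt, ?_⟩⟩
    simp [NExp.eval, State.setVar]
  rintro s₂ ⟨⟨n, hn, rfl⟩, hb⟩
  rw [htest] at hb
  obtain rfl : n = blowup 5000 K ρ := by omega
  set s₂ := s₁.setVar 4 (blowup 5000 K ρ) with hs₂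
  refine runs_seq (runs_setVar (runs_seq (runs_setVar (runs_seq ?_))))
  set s₃ := (s₂.setVar 5 (NExp.eval s₂ (.const 0))).setVar 6
    (NExp.eval (s₂.setVar 5 (NExp.eval s₂ (.const 0))) (.var 2)) with hs₃
  have hv₃ : Loaded (fun k => (arms k).ofLp) s₃ := by
    refine ⟨rfl, rfl, fun k j => ?_⟩
    change s₀.rarr 1 k j = _
    simp [hs₀, initState]
  have h3₃ : s₃.nvar 3 = numBatches T := rfl
  have h4₃ : s₃.nvar 4 = blowup 5000 K ρ := rfl
  have h5₃ : s₃.nvar 5 = 0 := rfl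
  have h6₃ : s₃.nvar 6 = T := rfl
  have h2₃ : s₃.nvar 2 = T := rfl
  refine (runs_fill_fin (Z := Z) hKZ (hK.trans hKZ) (Nat.zero_le Z) (by decide) (fun _ _ _ => 0)
    (fun (_ : Fin K) (_ : Fin 1) => (1 : ℝ)) ?_ ?_ ?_ ?_ ?_).mono ?_
  · exact fun s' h => (hv₃.of_fillFrame h (by decide)).card
  · exact fun _ _ => rfl
  · exact fun _ _ => rfl
  · exact fun _ _ _ l => l.elim0
  · simp [RExp.eval]
  rintro s₄ ⟨hF₄, h₄⟩
  have hv₄ := hv₃.of_fillFrame hF₄ (by decide)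
  have h2₄ : s₄.nvar 2 = T := (hF₄.nvar 2 (by decide) (by decide) (by decide)).trans h2₃
  have h3₄ : s₄.nvar 3 = numBatches T := (hF₄.nvar 3 (by decide) (by decide) (by decide)).trans h3₃
  refine runs_seq (runs_setReal (runs_seq (runs_setReal (runs_setReal
    ⟨Finset.univ, 0, ⟨⟨0, Finset.mem_univ _⟩, Nat.zero_le _, ⟨hv₄.dim, hv₄.card, hv₄.vec⟩, h3₄,
      ?_, ?_, ?_⟩, Or.inr ⟨?_, Nat.zero_le _, ?_, ?_, fun hB => ?_, fun n _ => ?_⟩⟩))))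
  · exact (hF₄.nvar 6 (by decide) (by decide) (by decide)).trans h6₃
  · intro k
    simpa [State.setReal] using h₄ k 0
  · exact hF₄.pulls
  · exact (hF₄.nvar 5 (by decide) (by decide) (by decide)).trans h5₃
  · exact hF₄.used
  · exact (hF₄.nvar 4 (by decide) (by decide) (by decide)).trans h4₃
  -- The computed exp(log T / max(B, 1)) is identified with `growth` only for B ≥ 2; for smaller B
  -- the body of the main loop is never entered.
  · have hT := three_le_of_two_le_numBatches hB
    simp only [RExp.eval, NExp.eval, RExp.scalar, NExp.horizon, State.scalar_setReal]
    simp only [State.setReal, h2₄, h3₄, hv₄.card, Nat.sub_eq_zero_of_le (show 1 ≤ T by omega),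
      Nat.sub_eq_zero_of_le (show 1 ≤ numBatches T by omega), add_zero, growth_eq_exp hB]
    norm_num [logFactor, sq]
  · rw [arm_batchedElimination, Nat.sub_zero]

theorem runs_exploitProg {s : State} {arm : ℕ → Fin K} {A : Finset (Fin K)} {t : ℕ} [NeZero K]
    (hI : MainInv T ρ arms arm A t s) (harm : ∀ n, t ≤ n → arm n = firstArm A) (hKZ : K ≤ Z)
    (hTZ : T ≤ Z) :
    Runs ξ Y Z exploitProg s fun s' => s'.pulls = (List.range T).map fun n => (arm n : ℕ) := by
  refine runs_seq ((runs_findFirst (n := .var 1) (by decide) hKZ A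
    (fun s' h => (hI.loaded.of_frame h (by decide) (by decide) (by decide)).card) ?_).frame.mono ?_)
  · intro s' k h hk
    simp only [BExp.eval, RExp.eval, NExp.eval, RExp.coord, hk]
    rw [hI.active.of_rarr (h.rarr 2 (by decide)) k]
    by_cases hkA : k ∈ A <;> simp [hkA]
  rintro s₁ ⟨hF₁, h17⟩
  have hfirst : s₁.nvar 17 = (firstArm A : Fin K) := by
    rw [h17, dif_pos hI.nonempty, firstArm, dif_pos hI.nonempty]
  have h6 : s₁.nvar 6 = T - t := (hF₁.nvar 6 (by decide)).trans hI.remaining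
  have hp₁ : s₁.pulls = (List.range t).map fun n => (arm n : ℕ) :=
    (hF₁.pulls (by decide)).trans hI.pulls
  refine (runs_forLoop (N := T - t) (b := .var 6) (by omega) (by decide)
    (fun s' h => (h.nvar 6 (by decide)).trans h6)
    (fun j s' => s'.pulls = (List.range (t + j)).map fun n => (arm n : ℕ)) (fun _ _ _ h => h)
    hp₁ ?_).mono ?_
  · intro j s' _ hF _ hI'
    refine runs_pull ?_
    have : s'.nvar 17 = (firstArm A : Fin K) := (hF.nvar 17 (by decide)).trans hfirst
    simp only [NExp.eval, this, hI']
    rw [← add_assoc, List.range_succ, List.map_append, List.map_singleton,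
      harm (t + j) (Nat.le_add_right _ _)]
  · intro s' h
    rwa [Nat.add_sub_cancel' hI.le] at h

theorem runs_banditProg [NeZero K] (hd : 1 ≤ d) (hρ : 0 < ρ) (hρ1 : ρ ≤ 1)
    (harms : ∀ k, ‖arms k‖ ≤ 1) (hdZ : d ≤ Z) (hKZ : K ≤ Z) (hTZ : T ≤ Z) (hdKZ : 2 * d * K ≤ Z)
    (hBZ : numBatches T ≤ Z) (hβZ : blowup 5000 K ρ ≤ Z)
    (hLZ : ∀ i < numBatches T - 1, ∀ A : Finset (Fin K), A.Nonempty →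
      (batchList designRule 1 5000 T ρ arms i A).length ≤ Z) :
    Runs ξ Y Z banditProg (initState T ρ arms) fun s => s.pulls = (List.range T).map fun n =>
      ((batchedElimination designRule 1 5000 T ρ arms).arm ξ (fun t k => Y t k) n : ℕ) := by
  refine runs_seq ((runs_initProg hρ hρ1 hKZ hBZ hβZ).mono fun s₁ h₁ => runs_seq
    ((runs_while _ h₁ fun j s hI hb => ⟨?_, ?_⟩).mono ?_))
  · obtain ⟨A, t, hM, ⟨h5, -⟩ | ⟨h5, -⟩⟩ := hI
    · simp only [BExp.eval, NExp.eval, h5, hM.numBatches] at hb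
      omega
    · simp only [BExp.eval, NExp.eval, h5, hM.numBatches] at hb
      omega
  · exact runs_batchProg hd hρ hρ1 harms hdZ hKZ hdKZ hLZ hI hb
  · rintro s ⟨⟨j, A, t, hM, hor⟩, hb⟩
    refine runs_exploitProg hM ?_ hKZ hTZ
    rcases hor with ⟨-, h⟩ | ⟨h5, hj, -, -, -, h⟩
    · exact h
    · intro n hn
      -- The guard fails with counter j, so j + 1 ≥ B and `batchArm` is at its base case.
      simp only [BExp.eval, NExp.eval, h5, hM.numBatches] at hb
      rw [h n hn, show numBatches T - 1 - j = 0 by omega, batchArm]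

/-! ### Polynomial running time -/

/-- A bound for the number of iterations of each loop, in terms of `d`, `K`, `T` and `1 / ρ`. -/
def iterationBound : MvPolynomial (Fin 4) ℕ :=
  .X 0 + .X 1 + .X 2 + 2 * .X 0 * .X 1 + 5000 * (.X 1 ^ 2 * .X 3 ^ 2) * (1 + 17 * .X 2) + 1

theorem numBatches_le (T : ℕ) : numBatches T ≤ T :=
  Nat.ceil_le.2 (Real.log_le_self (Nat.cast_nonneg T))

/-- All loop lengths, namely d, K, T, 2dK, B ≤ T, β and the sizes of the batches, are at most Z. In
`iterationBound` the integer β is replaced by its upper bound 5000 K²/ρ², which is polynomial in K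
and 1/ρ. -/
theorem implements_banditProg [NeZero K] (hd : 1 ≤ d) (hρ : 0 < ρ) (hρ1 : ρ ≤ 1)
    (harms : ∀ k, ‖arms k‖ ≤ 1) :
    Implements banditProg T ρ arms (batchedElimination designRule 1 5000 T ρ arms)
      (MvPolynomial.aeval ![(d : ℝ), (K : ℝ), (T : ℝ), 1 / ρ]
        (banditProg.bound iterationBound)) := by
  have hK : 1 ≤ K := Nat.one_le_iff_ne_zero.2 (NeZero.ne K)
  set β := blowup 5000 K ρ with hβ
  set Z : ℕ := d + K + T + 2 * d * K + β * (1 + 17 * T) + 1 with hZ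
  have hβT : β * (1 + 17 * T) = β + 17 * (β * T) := by ring
  have hLZ : ∀ i < numBatches T - 1, ∀ A : Finset (Fin K), A.Nonempty →
      (batchList designRule 1 5000 T ρ arms i A).length ≤ Z := by
    intro i hi A hA
    have hB : 2 ≤ numBatches T := by omega
    have h1 := length_batchList_le hd hK hρ hρ1 harms hi hA
    -- Since i + 1 < B and q^B = T; a batch thus has at most 17 β T pulls, even one that is never
    -- executed because it does not fit.
    have h2 : growth 1 T ^ (i + 1) ≤ T := by
      rw [← growth_pow_numBatches hB]
      exact pow_le_pow_right₀ (one_le_growth hB) (by omega)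
    have h3 : ((batchList designRule 1 5000 T ρ arms i A).length : ℝ) ≤
        ((17 * (β * T) : ℕ) : ℝ) := by
      push_cast
      refine h1.trans ?_
      gcongr
    have h4 := Nat.cast_le.1 h3
    omega
  intro ξ Y
  have hBT := numBatches_le T
  obtain ⟨s, n, hE, hn, hs⟩ := runs_banditProg (ξ := ξ) (Y := Y) (Z := Z) (T := T) hd hρ hρ1 harms
    (by omega) (by omega) (by omega) (by omega) (by omega) (by omega) hLZ
  refine ⟨s, n, hE, ?_, hs⟩
  have hcast : ((banditProg.bound Z : ℕ) : ℝ) = banditProg.bound (Z : ℝ) :=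
    Prog.map_bound (Nat.castRingHom ℝ) Z banditProg
  have hpoly : MvPolynomial.aeval ![(d : ℝ), (K : ℝ), (T : ℝ), 1 / ρ]
      (banditProg.bound iterationBound) = banditProg.bound
        (MvPolynomial.aeval ![(d : ℝ), (K : ℝ), (T : ℝ), 1 / ρ] iterationBound) :=
    Prog.map_bound (MvPolynomial.aeval ![(d : ℝ), (K : ℝ), (T : ℝ), 1 / ρ]).toRingHom
      iterationBound banditProg
  rw [hpoly]
  refine (Nat.cast_le.2 hn).trans ?_
  rw [hcast]
  refine Prog.bound_mono (Nat.cast_nonneg _) ?_ _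
  have hβle := blowup_le hK hρ hρ1
  simp only [iterationBound, map_add, map_mul, map_pow, MvPolynomial.aeval_X, map_one, map_ofNat]
  simp only [Matrix.cons_val]
  rw [hZ]
  push_cast
  rw [div_pow, one_pow, mul_one_div]
  gcongr

end MainProgram

end ReproBandit

end

/-! ### The main theorem -/

theorem mainTheorem2 :
    ∃ (C c cβ c₁ c₂ : ℝ) (D : ReproBandit.DesignRule) (P : ReproBandit.Prog)
      (p : MvPolynomial (Fin 4) ℕ),
      0 < C ∧ 0 < c ∧ 1 ≤ cβ ∧ 0 < c₁ ∧ c₁ ≤ c₂ ∧ D.IsValid c₁ c₂ ∧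
      ∀ (d K T : ℕ) (_ : 1 ≤ d) [NeZero K] (ρ : ℝ) (_ : 0 < ρ) (_ : ρ ≤ 1)
        (arms : Fin K → ReproBandit.E d) (_ : ∀ k, ‖arms k‖ ≤ 1)
        (π : ReproBandit.Policy K)
        (_ : π = ReproBandit.batchedElimination D c cβ T ρ arms),
        π.IsMeasurable ∧
        π.IsReproducible arms T ρ ∧
        (∀ M : ReproBandit.Environment d K,
          π.expectedRegret arms T M ≤
            C * ((K : ℝ) ^ 2 / ρ ^ 2) * Real.sqrt (d * T * Real.log (K * T))) ∧
        ReproBandit.Implements P T ρ arms π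
          (MvPolynomial.aeval ![(d : ℝ), (K : ℝ), (T : ℝ), 1 / ρ] p) := by
  refine ⟨5000000, 1, 5000, 16, 17, ReproBandit.designRule, ReproBandit.banditProg,
    ReproBandit.banditProg.bound ReproBandit.iterationBound, by norm_num, one_pos, by norm_num,
    by norm_num, by norm_num, ReproBandit.designRule_isValid, ?_⟩
  rintro d K T hd _ ρ hρ hρ1 arms harms π rfl
  exact ⟨ReproBandit.isMeasurable_batchedElimination _ _ _ T ρ arms,
    ReproBandit.isReproducible_batchedElimination hd hρ hρ1 harms,
    fun M => ReproBandit.expectedRegret_batchedElimination_le hd hρ hρ1 harms M,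
    ReproBandit.implements_banditProg hd hρ hρ1 harms⟩
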